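/- For $s\in\mathbb R$ and $t>0$ let $f_s(t)=\frac{t^s-st+s-1}{s(s-1)}$ if $s\notin\{0,1\}$, $f_0(t)=t-\log t-1$ and $f_1(t)=t\log t-t+1$, so that $f_s''(t)=t^{s-2}$. For a function $f$ on $(0,\infty)$ put $\bar f(a,b)=f(a)+f(b)-2f\!\left(\frac{a+b}2\right)$, and for $a,b>0$ let $$\lambda_s(a,b)=\frac{\bar f_{s+1}(a,b)}{\bar f_s(a,b)}\quad(a\ne b),\qquad \lambda_s(a,a)=a.$$ Let $$H=\frac{2}{1/a+1/b},\quad G=\sqrt{ab},\quad L=\frac{b-a}{\log b-\log a},\quad I=\frac1e\left(\frac{b^b}{a^a}\right)^{1/(b-a)},\quad A=\frac{a+b}2,\quad S=a^{\frac a{a+b}}b^{\frac b{a+b}}$$ be the harmonic, geometric, logarithmic, identric, arithmetic and Gini means of $a,b>0$, with $L(a,a)=I(a,a)=a$. **Theorem 3.** 1. For all $a,b>0$, $\lambda_s(a,b)$ is monotone increasing in $s\in\mathbb R$. 2. $\lambda_s(a,b)\le H(a,b)$ for all $a,b>0$ and each $s\le-4$. 3. $H(a,b)\le\lambda_s(a,b)\le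 G(a,b)$ for all $a,b>0$ and $-3\le s\le-1$. 4. $G(a,b)\le\lambda_s(a,b)\le L(a,b)$ for all $a,b>0$ and $-\frac12\le s\le0$. 5. There is a number $s_0\in(\frac1{12},\frac1{11})$ such that $L(a,b)\le\lambda_s(a,b)\le I(a,b)$ for all $a,b>0$ and $s_0\le s\le1$. 6. There is a number $s_1\in(1.03,1.04)$ such that $I(a,b)\le\lambda_s(a,b)\le A(a,b)$ for all $a,b>0$ and $s_1\le s\le2$. 7. $A(a,b)\le\lambda_s(a,b)\le S(a,b)$ for all $a,b>0$ and $2\le s\le5$. 8. There is no $s\in\mathbb R$ such that $S(a,b)\le\lambda_s(a,b)$ for all $a,b>0$. All these bounds are best possible: for each inequality in 2--7, the stated end of the range of $s$ at which it is limited cannot be improved. That is, for each $s\in\mathbb R$, where an inequality between means is understood to hold for all $a,b>0$: $\lambda_s\le H$ iff $s\le-4$; $H\le\lambda_s$ iff $s\ge-3$; $\lambda_s\le G$ iff $s\le-1$; $G\le\lambda_s$ iff $s\ge-\frac12$; $\lambda_s\le L$ iff $s\le0$; $L\le\lambda_s$ iff $s\ge s_0$; $\lambda_s\le I$ iff $s\le1$;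 $I\le\lambda_s$ iff $s\ge s_1$; $\lambda_s\le A$ iff $s\le2$; $A\le\lambda_s$ iff $s\ge2$; $\lambda_s\le S$ iff $s\le5$. -/

import Mathlib

/-- The harmonic mean. -/
noncomputable def meanH (a b : ℝ) : ℝ := 2 * (1 / a + 1 / b)⁻¹

/-- The geometric mean. -/
noncomputable def meanG (a b : ℝ) : ℝ := Real.sqrt (a * b)

open Classical in
/-- The logarithmic mean, extended by `L(a, a) = a`. -/
noncomputable def meanL (a b : ℝ) : ℝ :=
  if a = b then a else (b - a) / (Real.log b - Real.log a)

open Classical in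
/-- The identric mean, extended by `I(a, a) = a`. -/
noncomputable def meanI (a b : ℝ) : ℝ :=
  if a = b then a else (b ^ b / a ^ a) ^ (1 / (b - a)) / Real.exp 1

/-- The arithmetic mean. -/
noncomputable def meanA (a b : ℝ) : ℝ := (a + b) / 2

/-- The Gini mean. -/
noncomputable def meanS (a b : ℝ) : ℝ := a ^ (a / (a + b)) * b ^ (b / (a + b))

open Classical in
/-- The convex functions `f_s` on `(0, ∞)`, normalised by `f_s(1) = f_s'(1) = 0`,
with `f_s''(t) = t ^ (s - 2)`. -/
noncomputable def fPow (s t : ℝ) : ℝ :=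
  if s = 0 then t - Real.log t - 1
  else if s = 1 then t * Real.log t - t + 1
  else (t ^ s - s * t + s - 1) / (s * (s - 1))

/-- The functional `f(a) + f(b) - 2 f((a + b) / 2)`. -/
noncomputable def jensenBar (f : ℝ → ℝ) (a b : ℝ) : ℝ := f a + f b - 2 * f ((a + b) / 2)

open Classical in
/-- The mean `λ_s(a, b)`; on the diagonal, where the quotient is `0 / 0`, it has the value `a`
that every mean has there. -/
noncomputable def lambdaMean (s a b : ℝ) : ℝ :=
  if a = b then a else jensenBar (fPow (s + 1)) a b / jensenBar (fPow s) a b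

/-!
For `l = λ_s(a, b)` and `s ≤ t`, the function `f_{t+1} - l f_t - l ^ (t - s) (f_{s+1} - l f_s)` is
convex, so that Jensen's inequality gives `l ≤ λ_t(a, b)`: the mean `λ_s` increases with `s`, and
every range of parameters is determined by its finite end.

At that end the inequality is homogeneous and symmetric, hence only has to be proved at the pairs
`(e⁻ᵘ, eᵘ)`, where it becomes an inequality between hyperbolic functions. That the end cannot be
moved follows from the expansion `λ_s(1 - x, 1 + x) = 1 + (s - 2) / 6 * x² + o(x²)` for the upper
bounds and for `A`, and from the behaviour of `λ_s(a, 1)` as `a → 0` for `H`, `G` and `S`.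

The ends `s₀` and `s₁` have no closed form. They are the least parameters satisfying the
inequalities, which exist because `λ_s` is continuous in `s`, and they are located by comparing
`λ_s` with `L` at `s = 1 / 12` and `s = 9 / 100`, and with `I` at `s = 1.03` and `s = 1.0399`.
-/

open Real Set Filter Topology

section Calculus

theorem le_of_hasDerivAt_nonneg {f f' : ℝ → ℝ} {a b : ℝ} (hab : a ≤ b)
    (hf : ∀ x ∈ Icc a b, HasDerivAt f (f' x) x) (hf' : ∀ x ∈ Ioo a b, 0 ≤ f' x) : f a ≤ f b := by
  refine monotoneOn_of_hasDerivWithinAt_nonneg (convex_Icc a b) (f' := f')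
    (fun x hx => (hf x hx).continuousAt.continuousWithinAt)
    (fun x hx => (hf x (interior_subset hx)).hasDerivWithinAt) (fun x hx => hf' x ?_)
    (left_mem_Icc.2 hab) (right_mem_Icc.2 hab) hab
  rwa [interior_Icc] at hx

theorem nonneg_of_hasDerivAt_nonneg {f f' : ℝ → ℝ} (h0 : f 0 = 0)
    (hf : ∀ x, 0 ≤ x → HasDerivAt f (f' x) x) (hf' : ∀ x, 0 < x → 0 ≤ f' x) {x : ℝ}
    (hx : 0 ≤ x) : 0 ≤ f x :=
  h0 ▸ le_of_hasDerivAt_nonneg hx (fun y hy => hf y hy.1) (fun y hy => hf' y hy.1)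

theorem le_of_tendsto_of_hasDerivAt_nonneg {f f' : ℝ → ℝ} {a b l : ℝ} (hab : a < b)
    (hl : Tendsto f (𝓝[>] a) (𝓝 l)) (hf : ∀ x ∈ Ioc a b, HasDerivAt f (f' x) x)
    (hf' : ∀ x ∈ Ioo a b, 0 ≤ f' x) : l ≤ f b := by
  refine le_of_tendsto hl ?_
  filter_upwards [Ioc_mem_nhdsGT hab] with x hx
  exact le_of_hasDerivAt_nonneg hx.2 (fun y hy => hf y ⟨hx.1.trans_le hy.1, hy.2⟩)
    (fun y hy => hf' y ⟨hx.1.trans hy.1, hy.2⟩)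

theorem tendsto_div_pow_succ_of_hasDerivAt {f f' : ℝ → ℝ} {n : ℕ} {c : ℝ}
    (hf : ∀ᶠ x in 𝓝[>] 0, HasDerivAt f (f' x) x) (h0 : Tendsto f (𝓝[>] 0) (𝓝 0))
    (h : Tendsto (fun x => f' x / x ^ n) (𝓝[>] 0) (𝓝 c)) :
    Tendsto (fun x => f x / x ^ (n + 1)) (𝓝[>] 0) (𝓝 (c / (n + 1))) := by
  refine HasDerivAt.lhopital_zero_nhdsGT (g' := fun x => ((n + 1 : ℕ) : ℝ) * x ^ n) hf
    (Eventually.of_forall fun x => by simpa using hasDerivAt_pow (n + 1) x) ?_ h0 ?_ ?_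
  · filter_upwards [self_mem_nhdsWithin] with x hx
    exact mul_ne_zero (Nat.cast_ne_zero.2 n.succ_ne_zero) (pow_ne_zero n (ne_of_gt hx))
  · simpa using ((continuous_pow (n + 1)).tendsto (0 : ℝ)).mono_left nhdsWithin_le_nhds
  · refine (h.div_const (n + 1 : ℝ)).congr fun x => ?_
    rw [Nat.cast_add_one, div_div, mul_comm]

end Calculus

section Jensen

theorem jensenBar_comm (f : ℝ → ℝ) (a b : ℝ) : jensenBar f a b = jensenBar f b a := by
  simp only [jensenBar, add_comm b a, add_comm (f b)]

theorem jensenBar_nonneg_of_convexOn {D : Set ℝ} {f : ℝ → ℝ} (hf : ConvexOn ℝ D f) {a b : ℝ}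
    (ha : a ∈ D) (hb : b ∈ D) : 0 ≤ jensenBar f a b := by
  have h := hf.2 ha hb one_half_pos.le one_half_pos.le (add_halves 1)
  rw [smul_eq_mul, smul_eq_mul, smul_eq_mul, smul_eq_mul, ← mul_add, one_div_mul_eq_div] at h
  rw [jensenBar]
  linarith

theorem jensenBar_pos_of_strictConvexOn {D : Set ℝ} {f : ℝ → ℝ} (hf : StrictConvexOn ℝ D f)
    {a b : ℝ} (ha : a ∈ D) (hb : b ∈ D) (hab : a ≠ b) : 0 < jensenBar f a b := by
  have h := hf.2 ha hb hab one_half_pos one_half_pos (add_halves 1)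
  rw [smul_eq_mul, smul_eq_mul, smul_eq_mul, smul_eq_mul, ← mul_add, one_div_mul_eq_div] at h
  rw [jensenBar]
  linarith

/-- The derivative `f_s'`, normalised like `f_s` to vanish at `1`. -/
noncomputable def fPowDeriv (s t : ℝ) : ℝ :=
  if s = 1 then log t else (t ^ (s - 1) - 1) / (s - 1)

theorem hasDerivAt_fPow (s : ℝ) {t : ℝ} (ht : 0 < t) : HasDerivAt (fPow s) (fPowDeriv s t) t := by
  unfold fPowDeriv
  rcases eq_or_ne s 0 with rfl | h0
  · have h : fPow 0 = fun t => t - log t - 1 := by ext t; simp [fPow]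
    rw [h, if_neg zero_ne_one, zero_sub, rpow_neg_one]
    exact (((hasDerivAt_id t).sub (hasDerivAt_log ht.ne')).sub_const 1).congr_deriv (by ring)
  rcases eq_or_ne s 1 with rfl | h1
  · have h : fPow 1 = fun t => t * log t - t + 1 := by ext t; simp [fPow]
    rw [h, if_pos rfl]
    exact ((((hasDerivAt_id t).mul (hasDerivAt_log ht.ne')).sub (hasDerivAt_id t)).add_const
      1).congr_deriv (by simp [ht.ne'])
  have h : fPow s = fun t => (t ^ s - s * t + s - 1) / (s * (s - 1)) := by
    ext t
    simp [fPow, h0, h1]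
  have hs : s - 1 ≠ 0 := sub_ne_zero.2 h1
  rw [h, if_neg h1]
  refine (((((hasDerivAt_rpow_const (p := s) (Or.inl ht.ne')).sub
    ((hasDerivAt_id t).const_mul s)).add_const s).sub_const 1).div_const _).congr_deriv ?_
  field_simp

theorem hasDerivAt_fPowDeriv (s : ℝ) {t : ℝ} (ht : 0 < t) :
    HasDerivAt (fPowDeriv s) (t ^ (s - 2)) t := by
  rcases eq_or_ne s 1 with rfl | h1
  · have h : fPowDeriv 1 = log := by ext t; simp [fPowDeriv]
    rw [h, show (1 : ℝ) - 2 = -1 by norm_num, rpow_neg_one]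
    exact hasDerivAt_log ht.ne'
  have h : fPowDeriv s = fun t => (t ^ (s - 1) - 1) / (s - 1) := by ext t; simp [fPowDeriv, h1]
  have hs : s - 1 ≠ 0 := sub_ne_zero.2 h1
  rw [h]
  refine (((hasDerivAt_rpow_const (p := s - 1) (Or.inl ht.ne')).sub_const 1).div_const
    (s - 1)).congr_deriv ?_
  rw [sub_sub, one_add_one_eq_two]
  field_simp

theorem strictConvexOn_fPow (s : ℝ) : StrictConvexOn ℝ (Ioi 0) (fPow s) := by
  refine StrictMonoOn.strictConvexOn_of_deriv (convex_Ioi 0)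
    (fun t ht => (hasDerivAt_fPow s ht).continuousAt.continuousWithinAt) ?_
  rw [interior_Ioi]
  refine StrictMonoOn.congr (f₁ := fPowDeriv s) ?_ fun t ht => (hasDerivAt_fPow s ht).deriv.symm
  refine strictMonoOn_of_deriv_pos (convex_Ioi 0)
    (fun t ht => (hasDerivAt_fPowDeriv s ht).continuousAt.continuousWithinAt) fun t ht => ?_
  rw [interior_Ioi] at ht
  rw [(hasDerivAt_fPowDeriv s ht).deriv]
  exact rpow_pos_of_pos ht _

theorem jensenBar_fPow_pos (s : ℝ) {a b : ℝ} (ha : 0 < a) (hb : 0 < b) (hab : a ≠ b) :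
    0 < jensenBar (fPow s) a b :=
  jensenBar_pos_of_strictConvexOn (strictConvexOn_fPow s) ha hb hab

theorem jensenBar_fPow_of_ne {s : ℝ} (h0 : s ≠ 0) (h1 : s ≠ 1) (a b : ℝ) :
    jensenBar (fPow s) a b = (a ^ s + b ^ s - 2 * ((a + b) / 2) ^ s) / (s * (s - 1)) := by
  simp only [jensenBar, fPow, h0, h1, if_false]
  ring

theorem jensenBar_fPow_zero (a b : ℝ) :
    jensenBar (fPow 0) a b = 2 * log ((a + b) / 2) - log a - log b := by
  simp only [jensenBar, fPow, if_true]
  ring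

theorem jensenBar_fPow_one (a b : ℝ) :
    jensenBar (fPow 1) a b = a * log a + b * log b - (a + b) * log ((a + b) / 2) := by
  simp only [jensenBar, fPow, one_ne_zero, if_false, if_true]
  ring

theorem jensenBar_fPow_mul (s : ℝ) {r a b : ℝ} (hr : 0 < r) (ha : 0 < a) (hb : 0 < b) :
    jensenBar (fPow s) (r * a) (r * b) = r ^ s * jensenBar (fPow s) a b := by
  have hm : 0 < (a + b) / 2 := by positivity
  have hrm : (r * a + r * b) / 2 = r * ((a + b) / 2) := by ring
  rcases eq_or_ne s 0 with rfl | h0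
  · rw [jensenBar_fPow_zero, jensenBar_fPow_zero, hrm, log_mul hr.ne' ha.ne',
      log_mul hr.ne' hb.ne', log_mul hr.ne' hm.ne', rpow_zero]
    ring
  rcases eq_or_ne s 1 with rfl | h1
  · rw [jensenBar_fPow_one, jensenBar_fPow_one, hrm, log_mul hr.ne' ha.ne',
      log_mul hr.ne' hb.ne', log_mul hr.ne' hm.ne', rpow_one]
    ring
  rw [jensenBar_fPow_of_ne h0 h1, jensenBar_fPow_of_ne h0 h1, hrm, mul_rpow hr.le ha.le,
    mul_rpow hr.le hb.le, mul_rpow hr.le hm.le]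
  ring

end Jensen

section Lambda

theorem lambdaMean_self (s a : ℝ) : lambdaMean s a a = a := if_pos rfl

theorem lambdaMean_of_ne (s : ℝ) {a b : ℝ} (hab : a ≠ b) :
    lambdaMean s a b = jensenBar (fPow (s + 1)) a b / jensenBar (fPow s) a b := if_neg hab

theorem lambdaMean_pos (s : ℝ) {a b : ℝ} (ha : 0 < a) (hb : 0 < b) : 0 < lambdaMean s a b := by
  rcases eq_or_ne a b with rfl | hab
  · rwa [lambdaMean_self]
  · rw [lambdaMean_of_ne s hab]
    exact div_pos (jensenBar_fPow_pos _ ha hb hab) (jensenBar_fPow_pos _ ha hb hab)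

theorem sub_mul_rpow_sub_rpow_nonneg {x y p : ℝ} (hx : 0 ≤ x) (hy : 0 ≤ y) (hp : 0 ≤ p) :
    0 ≤ (y - x) * (y ^ p - x ^ p) := by
  rcases le_total y x with h | h
  · exact mul_nonneg_of_nonpos_of_nonpos (sub_nonpos.2 h) (sub_nonpos.2 (rpow_le_rpow hy h hp))
  · exact mul_nonneg (sub_nonneg.2 h) (sub_nonneg.2 (rpow_le_rpow hx h hp))

-- The second derivative at `y` is `y ^ (s - 2) * ((y - l) * (y ^ (t - s) - l ^ (t - s)))`.
theorem convexOn_fPow_combination {s t l : ℝ} (hst : s ≤ t) (hl : 0 ≤ l) :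
    ConvexOn ℝ (Ioi 0) fun y => fPow (t + 1) y - l * fPow t y -
      l ^ (t - s) * (fPow (s + 1) y - l * fPow s y) := by
  have hd1 : ∀ y, 0 < y → HasDerivAt (fun y => fPow (t + 1) y - l * fPow t y -
      l ^ (t - s) * (fPow (s + 1) y - l * fPow s y)) (fPowDeriv (t + 1) y - l * fPowDeriv t y -
      l ^ (t - s) * (fPowDeriv (s + 1) y - l * fPowDeriv s y)) y := fun y hy =>
    ((hasDerivAt_fPow (t + 1) hy).sub ((hasDerivAt_fPow t hy).const_mul l)).sub
      (((hasDerivAt_fPow (s + 1) hy).sub ((hasDerivAt_fPow s hy).const_mul l)).const_mul _)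
  refine convexOn_of_hasDerivWithinAt2_nonneg (convex_Ioi 0)
    (fun y hy => (hd1 y hy).continuousAt.continuousWithinAt)
    (fun y hy => (hd1 y (interior_subset hy)).hasDerivWithinAt)
    (fun y hy => HasDerivAt.hasDerivWithinAt <|
      ((hasDerivAt_fPowDeriv (t + 1) (interior_subset hy)).sub
        ((hasDerivAt_fPowDeriv t (interior_subset hy)).const_mul l)).sub
        (((hasDerivAt_fPowDeriv (s + 1) (interior_subset hy)).sub
          ((hasDerivAt_fPowDeriv s (interior_subset hy)).const_mul l)).const_mul _))
    fun y hy => ?_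
  replace hy : 0 < y := interior_subset hy
  have e1 : y ^ (t + 1 - 2) = y ^ (s - 2) * y ^ (t - s) * y := by
    rw [← rpow_add hy, ← rpow_add_one hy.ne']; ring_nf
  have e2 : y ^ (t - 2) = y ^ (s - 2) * y ^ (t - s) := by rw [← rpow_add hy]; ring_nf
  have e3 : y ^ (s + 1 - 2) = y ^ (s - 2) * y := by rw [← rpow_add_one hy.ne']; ring_nf
  calc 0 ≤ y ^ (s - 2) * ((y - l) * (y ^ (t - s) - l ^ (t - s))) :=
        mul_nonneg (rpow_nonneg hy.le _)
          (sub_mul_rpow_sub_rpow_nonneg hl hy.le (sub_nonneg.2 hst))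
    _ = _ := by rw [e1, e2, e3]; ring

theorem lambdaMean_monotone {a b : ℝ} (ha : 0 < a) (hb : 0 < b) :
    Monotone fun s : ℝ => lambdaMean s a b := by
  intro s t hst
  rcases eq_or_ne a b with rfl | hab
  · simp only [lambdaMean_self, le_refl]
  have hl := lambdaMean_pos s ha hb
  have hls : jensenBar (fPow (s + 1)) a b = lambdaMean s a b * jensenBar (fPow s) a b := by
    rw [lambdaMean_of_ne s hab, div_mul_cancel₀ _ (jensenBar_fPow_pos s ha hb hab).ne']
  have hc := jensenBar_nonneg_of_convexOn (convexOn_fPow_combination hst hl.le) ha hb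
  have hlin : lambdaMean s a b * jensenBar (fPow t) a b ≤ jensenBar (fPow (t + 1)) a b := by
    simp only [jensenBar] at hc hls ⊢
    linear_combination hc - lambdaMean s a b ^ (t - s) * hls
  simpa only [lambdaMean_of_ne t hab, le_div_iff₀ (jensenBar_fPow_pos t ha hb hab)] using hlin

end Lambda

section HomogeneousMeans

/-- The inequality `M ≤ N` between means, understood to hold at all pairs of positive numbers. -/
def MeanLE (M N : ℝ → ℝ → ℝ) : Prop := ∀ a b, 0 < a → 0 < b → M a b ≤ N a b

theorem MeanLE.trans {M N P : ℝ → ℝ → ℝ} (hMN : MeanLE M N) (hNP : MeanLE N P) : MeanLE M P :=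
  fun a b ha hb => (hMN a b ha hb).trans (hNP a b ha hb)

theorem meanLE_lambdaMean {s t : ℝ} (hst : s ≤ t) : MeanLE (lambdaMean s) (lambdaMean t) :=
  fun _ _ ha hb => lambdaMean_monotone ha hb hst

/-- Symmetric, reflexive and homogeneous functions of two positive numbers. Such a function is
determined by its values at the pairs `(exp (-u), exp u)` with `0 < u`, which is how means are
compared below. -/
structure IsHomMean (M : ℝ → ℝ → ℝ) : Prop where
  self : ∀ a, 0 < a → M a a = a
  comm : ∀ a b, 0 < a → 0 < b → M a b = M b a
  mul : ∀ r a b, 0 < r → 0 < a → 0 < b → M (r * a) (r * b) = r * M a b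

theorem exists_eq_mul_exp {a b : ℝ} (ha : 0 < a) (hab : a < b) :
    ∃ r u, 0 < r ∧ 0 < u ∧ a = r * exp (-u) ∧ b = r * exp u := by
  have hb := ha.trans hab
  refine ⟨exp ((log a + log b) / 2), (log b - log a) / 2, exp_pos _,
    half_pos (sub_pos.2 (log_lt_log ha hab)), ?_, ?_⟩ <;> rw [← exp_add]
  · rw [show (log a + log b) / 2 + -((log b - log a) / 2) = log a by ring, exp_log ha]
  · rw [show (log a + log b) / 2 + (log b - log a) / 2 = log b by ring, exp_log hb]

theorem IsHomMean.meanLE {M N : ℝ → ℝ → ℝ} (hM : IsHomMean M) (hN : IsHomMean N)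
    (h : ∀ u, 0 < u → M (exp (-u)) (exp u) ≤ N (exp (-u)) (exp u)) : MeanLE M N := by
  have hlt : ∀ a b : ℝ, 0 < a → a < b → M a b ≤ N a b := by
    intro a b ha hab
    obtain ⟨r, u, hr, hu, rfl, rfl⟩ := exists_eq_mul_exp ha hab
    rw [hM.mul _ _ _ hr (exp_pos _) (exp_pos _), hN.mul _ _ _ hr (exp_pos _) (exp_pos _)]
    exact mul_le_mul_of_nonneg_left (h u hu) hr.le
  intro a b ha hb
  rcases lt_trichotomy a b with hab | rfl | hab
  · exact hlt a b ha hab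
  · rw [hM.self a ha, hN.self a ha]
  · rw [hM.comm a b ha hb, hN.comm a b ha hb]
    exact hlt b a hb hab

theorem isHomMean_lambdaMean (s : ℝ) : IsHomMean (lambdaMean s) where
  self a _ := lambdaMean_self s a
  comm a b _ _ := by
    rcases eq_or_ne a b with rfl | hab
    · rfl
    · rw [lambdaMean_of_ne s hab, lambdaMean_of_ne s hab.symm, jensenBar_comm _ a,
        jensenBar_comm _ a]
  mul r a b hr ha hb := by
    rcases eq_or_ne a b with rfl | hab
    · rw [lambdaMean_self, lambdaMean_self]
    · have hrs := (rpow_pos_of_pos hr s).ne'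
      rw [lambdaMean_of_ne s hab, lambdaMean_of_ne s ((mul_right_injective₀ hr.ne').ne hab),
        jensenBar_fPow_mul _ hr ha hb, jensenBar_fPow_mul _ hr ha hb, rpow_add_one hr.ne',
        mul_assoc, mul_div_mul_left _ _ hrs, mul_div_assoc]

theorem isHomMean_meanH : IsHomMean meanH where
  self a ha := by rw [meanH]; field_simp; norm_num
  comm a b _ _ := by rw [meanH, meanH, add_comm]
  mul r a b hr ha hb := by rw [meanH, meanH]; field_simp

theorem isHomMean_meanG : IsHomMean meanG where
  self a ha := sqrt_mul_self ha.le
  comm a b _ _ := by rw [meanG, meanG, mul_comm]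
  mul r a b hr _ _ := by
    rw [meanG, meanG, mul_mul_mul_comm, sqrt_mul (mul_self_nonneg r), sqrt_mul_self hr.le]

theorem isHomMean_meanL : IsHomMean meanL where
  self a _ := if_pos rfl
  comm a b _ _ := by
    rcases eq_or_ne a b with rfl | hab
    · rfl
    · rw [meanL, meanL, if_neg hab, if_neg hab.symm, ← neg_sub a b, ← neg_sub (log a),
        neg_div_neg_eq]
  mul r a b hr ha hb := by
    rcases eq_or_ne a b with rfl | hab
    · rw [meanL, meanL, if_pos rfl, if_pos rfl]
    · rw [meanL, meanL, if_neg hab, if_neg ((mul_right_injective₀ hr.ne').ne hab),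
        log_mul hr.ne' ha.ne', log_mul hr.ne' hb.ne', add_sub_add_left_eq_sub, ← mul_sub,
        mul_div_assoc]

theorem meanI_of_ne {a b : ℝ} (ha : 0 < a) (hb : 0 < b) (hab : a ≠ b) :
    meanI a b = exp ((b * log b - a * log a) / (b - a) - 1) := by
  rw [meanI, if_neg hab, exp_sub, rpow_def_of_pos (by positivity),
    log_div (by positivity) (by positivity), log_rpow hb, log_rpow ha, mul_one_div]

theorem meanS_eq_exp {a b : ℝ} (ha : 0 < a) (hb : 0 < b) :
    meanS a b = exp ((a * log a + b * log b) / (a + b)) := by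
  rw [meanS, rpow_def_of_pos ha, rpow_def_of_pos hb, ← exp_add]
  ring_nf

theorem exp_log_add {r : ℝ} (hr : 0 < r) (x : ℝ) : exp (log r + x) = r * exp x := by
  rw [exp_add, exp_log hr]

theorem isHomMean_meanI : IsHomMean meanI where
  self a _ := if_pos rfl
  comm a b ha hb := by
    rcases eq_or_ne a b with rfl | hab
    · rfl
    · rw [meanI_of_ne ha hb hab, meanI_of_ne hb ha hab.symm, ← neg_sub a b,
        ← neg_sub (a * log a), neg_div_neg_eq]
  mul r a b hr ha hb := by
    rcases eq_or_ne a b with rfl | hab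
    · rw [meanI, meanI, if_pos rfl, if_pos rfl]
    · have hba : b - a ≠ 0 := sub_ne_zero.2 hab.symm
      rw [meanI_of_ne ha hb hab, meanI_of_ne (mul_pos hr ha) (mul_pos hr hb)
        ((mul_right_injective₀ hr.ne').ne hab), log_mul hr.ne' ha.ne', log_mul hr.ne' hb.ne']
      rw [← exp_log_add hr, ← mul_sub]
      congr 1
      field_simp
      ring

theorem isHomMean_meanS : IsHomMean meanS where
  self a ha := by
    rw [meanS_eq_exp ha ha, ← two_mul, ← two_mul, mul_div_mul_left _ _ two_ne_zero,
      mul_div_cancel_left₀ _ ha.ne', exp_log ha]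
  comm a b ha hb := by
    rw [meanS_eq_exp ha hb, meanS_eq_exp hb ha, add_comm a b, add_comm (a * log a)]
  mul r a b hr ha hb := by
    rw [meanS_eq_exp ha hb, meanS_eq_exp (mul_pos hr ha) (mul_pos hr hb),
      log_mul hr.ne' ha.ne', log_mul hr.ne' hb.ne']
    rw [← exp_log_add hr]
    congr 1
    field_simp
    ring

end HomogeneousMeans

section ExponentialPairs

theorem exp_neg_add_exp_div_two (u : ℝ) : (exp (-u) + exp u) / 2 = cosh u := by
  rw [cosh_eq, add_comm]

theorem exp_neg_ne_exp {u : ℝ} (hu : 0 < u) : exp (-u) ≠ exp u :=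
  (exp_lt_exp.2 (neg_lt_self hu)).ne

theorem meanH_exp (u : ℝ) : meanH (exp (-u)) (exp u) = 1 / cosh u := by
  rw [meanH, cosh_eq, exp_neg]
  field_simp

theorem meanG_exp (u : ℝ) : meanG (exp (-u)) (exp u) = 1 := by
  rw [meanG, ← exp_add, neg_add_cancel, exp_zero, sqrt_one]

theorem meanL_exp {u : ℝ} (hu : 0 < u) : meanL (exp (-u)) (exp u) = sinh u / u := by
  rw [meanL, if_neg (exp_neg_ne_exp hu), log_exp, log_exp, sinh_eq]
  field_simp
  ring

theorem meanI_exp {u : ℝ} (hu : 0 < u) :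
    meanI (exp (-u)) (exp u) = exp (u * cosh u / sinh u - 1) := by
  have h : exp u - exp (-u) ≠ 0 := sub_ne_zero.2 (exp_neg_ne_exp hu).symm
  rw [meanI_of_ne (exp_pos _) (exp_pos _) (exp_neg_ne_exp hu), log_exp, log_exp, sinh_eq, cosh_eq]
  congr 2
  field_simp
  ring

theorem meanS_exp (u : ℝ) : meanS (exp (-u)) (exp u) = exp (u * sinh u / cosh u) := by
  rw [meanS_eq_exp (exp_pos _) (exp_pos _), log_exp, log_exp, sinh_eq, cosh_eq]
  congr 1
  field_simp
  ring

theorem jensenBar_fPow_exp {s : ℝ} (h0 : s ≠ 0) (h1 : s ≠ 1) (u : ℝ) :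
    jensenBar (fPow s) (exp (-u)) (exp u) =
      2 * (cosh (s * u) - cosh u ^ s) / (s * (s - 1)) := by
  rw [jensenBar_fPow_of_ne h0 h1, exp_neg_add_exp_div_two, cosh_eq (s * u), ← exp_mul, ← exp_mul]
  ring_nf

theorem jensenBar_fPow_natCast_exp {n : ℕ} (hn : 2 ≤ n) (u : ℝ) :
    jensenBar (fPow n) (exp (-u)) (exp u) =
      2 * (cosh (n * u) - cosh u ^ n) / (n * (n - 1)) := by
  rw [jensenBar_fPow_exp (by positivity) (by exact_mod_cast (by omega : n ≠ 1)), rpow_natCast]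

theorem jensenBar_fPow_neg_natCast_exp {n : ℕ} (hn : n ≠ 0) (u : ℝ) :
    jensenBar (fPow (-n)) (exp (-u)) (exp u) =
      2 * (cosh (n * u) - (cosh u ^ n)⁻¹) / (n * (n + 1)) := by
  have hn' : (0 : ℝ) < n := by positivity
  rw [jensenBar_fPow_exp (by linarith) (by linarith), rpow_neg (cosh_pos u).le, rpow_natCast,
    neg_mul, cosh_neg]
  ring_nf

theorem jensenBar_fPow_zero_exp (u : ℝ) :
    jensenBar (fPow 0) (exp (-u)) (exp u) = 2 * log (cosh u) := by
  rw [jensenBar_fPow_zero, exp_neg_add_exp_div_two, log_exp, log_exp]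
  ring

theorem jensenBar_fPow_one_exp (u : ℝ) :
    jensenBar (fPow 1) (exp (-u)) (exp u) = 2 * (u * sinh u - cosh u * log (cosh u)) := by
  rw [jensenBar_fPow_one, exp_neg_add_exp_div_two, log_exp, log_exp, sinh_eq, cosh_eq]
  ring

theorem lambdaMean_exp_le_iff {s u B : ℝ} (hu : 0 < u) :
    lambdaMean s (exp (-u)) (exp u) ≤ B ↔ jensenBar (fPow (s + 1)) (exp (-u)) (exp u) ≤
      B * jensenBar (fPow s) (exp (-u)) (exp u) := by
  rw [lambdaMean_of_ne s (exp_neg_ne_exp hu), div_le_iff₀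
    (jensenBar_fPow_pos s (exp_pos _) (exp_pos _) (exp_neg_ne_exp hu))]

theorem le_lambdaMean_exp_iff {s u B : ℝ} (hu : 0 < u) :
    B ≤ lambdaMean s (exp (-u)) (exp u) ↔ B * jensenBar (fPow s) (exp (-u)) (exp u) ≤
      jensenBar (fPow (s + 1)) (exp (-u)) (exp u) := by
  rw [lambdaMean_of_ne s (exp_neg_ne_exp hu), le_div_iff₀
    (jensenBar_fPow_pos s (exp_pos _) (exp_pos _) (exp_neg_ne_exp hu))]

end ExponentialPairs

section Hyperbolic

theorem tanh_nonneg {u : ℝ} (hu : 0 ≤ u) : 0 ≤ tanh u := by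
  rw [tanh_eq_sinh_div_cosh]
  exact div_nonneg (sinh_nonneg_iff.2 hu) (cosh_pos u).le

theorem cosh_sq_mul_one_sub_tanh_sq (u : ℝ) : cosh u ^ 2 * (1 - tanh u ^ 2) = 1 := by
  have hc := (cosh_pos u).ne'
  rw [tanh_eq_sinh_div_cosh, mul_sub, mul_one, ← mul_pow, mul_div_cancel₀ _ hc,
    cosh_sq_sub_sinh_sq]

theorem hasDerivAt_tanh (u : ℝ) : HasDerivAt tanh (1 - tanh u ^ 2) u := by
  have hc := (cosh_pos u).ne'
  rw [show tanh = fun u => sinh u / cosh u from funext tanh_eq_sinh_div_cosh]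
  refine ((hasDerivAt_sinh u).fun_div (hasDerivAt_cosh u) hc).congr_deriv ?_
  field_simp

theorem hasDerivAt_log_cosh (u : ℝ) : HasDerivAt (fun u => log (cosh u)) (tanh u) u := by
  rw [tanh_eq_sinh_div_cosh]
  exact (hasDerivAt_cosh u).log (cosh_pos u).ne'

theorem log_cosh_nonneg (u : ℝ) : 0 ≤ log (cosh u) := log_nonneg (one_le_cosh u)

theorem cosh_four_mul (u : ℝ) : cosh (4 * u) = 8 * cosh u ^ 4 - 8 * cosh u ^ 2 + 1 := by
  rw [show 4 * u = 2 * (2 * u) by ring, cosh_two_mul (2 * u), sinh_sq, cosh_two_mul, sinh_sq]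
  ring

theorem cosh_five_mul (u : ℝ) : cosh (5 * u) = 16 * cosh u ^ 5 - 20 * cosh u ^ 3 + 5 * cosh u := by
  rw [show 5 * u = 3 * u + 2 * u by ring, cosh_add, cosh_three_mul, cosh_two_mul, sinh_three_mul,
    sinh_two_mul]
  linear_combination (8 * cosh u * sinh u ^ 2 + 12 * cosh u ^ 3 - 5 * cosh u) * sinh_sq u

theorem cosh_six_mul (u : ℝ) :
    cosh (6 * u) = 32 * cosh u ^ 6 - 48 * cosh u ^ 4 + 18 * cosh u ^ 2 - 1 := by
  rw [show 6 * u = 2 * (3 * u) by ring, cosh_two_mul, sinh_sq, cosh_three_mul]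
  ring

theorem tendsto_sinh_div_self : Tendsto (fun u : ℝ => sinh u / u) (𝓝[>] 0) (𝓝 1) := by
  have h := (hasDerivAt_sinh 0).tendsto_slope
  rw [cosh_zero] at h
  refine (h.mono_left (nhdsWithin_mono _ fun x hx => ne_of_gt hx)).congr fun u => ?_
  rw [slope_def_field, sinh_zero, sub_zero, sub_zero]

theorem tendsto_cosh_nhdsGT_zero : Tendsto cosh (𝓝[>] 0) (𝓝 1) :=
  cosh_zero ▸ continuous_cosh.continuousWithinAt

theorem tendsto_log_cosh_div_sq : Tendsto (fun u => log (cosh u) / u ^ 2) (𝓝[>] 0) (𝓝 (1 / 2)) := by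
  have h0 : Tendsto (fun u => log (cosh u)) (𝓝[>] 0) (𝓝 0) := by
    simpa using tendsto_cosh_nhdsGT_zero.log one_ne_zero
  have h := tendsto_sinh_div_self.div tendsto_cosh_nhdsGT_zero one_ne_zero
  rw [div_one] at h
  refine (tendsto_div_pow_succ_of_hasDerivAt (n := 1) (Eventually.of_forall hasDerivAt_log_cosh) h0
    (h.congr fun u => ?_)).trans_eq (by norm_num)
  rw [Pi.div_apply, tanh_eq_sinh_div_cosh, pow_one, div_right_comm]

end Hyperbolic

section HarmonicGeometric

theorem meanLE_lambdaMean_neg_four_meanH : MeanLE (lambdaMean (-4)) meanH := by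
  refine (isHomMean_lambdaMean _).meanLE isHomMean_meanH fun u hu => ?_
  have h3 := jensenBar_fPow_neg_natCast_exp three_ne_zero u
  have h4 := jensenBar_fPow_neg_natCast_exp four_ne_zero u
  simp only [Nat.cast_ofNat] at h3 h4
  rw [lambdaMean_exp_le_iff hu, meanH_exp, show (-4 : ℝ) + 1 = -3 by norm_num, h3, h4,
    cosh_three_mul, cosh_four_mul, ← sub_nonneg]
  have := cosh_pos u
  have hs : 0 ≤ cosh u ^ 2 - 1 := by rw [← sinh_sq]; positivity
  calc 0 ≤ (cosh u ^ 2 - 1) ^ 3 * (4 * cosh u ^ 2 + 3) / (30 * cosh u ^ 5) := by positivity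
    _ = _ := by field_simp; ring

theorem meanLE_meanH_lambdaMean_neg_three : MeanLE meanH (lambdaMean (-3)) := by
  refine isHomMean_meanH.meanLE (isHomMean_lambdaMean _) fun u hu => ?_
  have h2 := jensenBar_fPow_neg_natCast_exp two_ne_zero u
  have h3 := jensenBar_fPow_neg_natCast_exp three_ne_zero u
  simp only [Nat.cast_ofNat] at h2 h3
  rw [le_lambdaMean_exp_iff hu, meanH_exp, show (-3 : ℝ) + 1 = -2 by norm_num, h2, h3,
    cosh_two_mul, sinh_sq, cosh_three_mul, ← sub_nonneg]
  have := cosh_pos u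
  calc 0 ≤ (cosh u ^ 2 - 1) ^ 2 / (6 * cosh u ^ 4) := by positivity
    _ = _ := by field_simp; ring

theorem meanLE_lambdaMean_neg_one_meanG : MeanLE (lambdaMean (-1)) meanG := by
  refine (isHomMean_lambdaMean _).meanLE isHomMean_meanG fun u hu => ?_
  have h1 := jensenBar_fPow_neg_natCast_exp one_ne_zero u
  rw [Nat.cast_one] at h1
  rw [lambdaMean_exp_le_iff hu, meanG_exp, neg_add_cancel, jensenBar_fPow_zero_exp, h1]
  have h := self_le_sinh_iff.2 (log_cosh_nonneg u)
  rw [sinh_eq, exp_neg, exp_log (cosh_pos u)] at h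
  simp only [one_mul, pow_one]
  linarith

theorem four_mul_cosh_half_le (u : ℝ) : 4 * cosh (u / 2) ≤ 3 * √(cosh u) + (√(cosh u))⁻¹ := by
  have := sqrt_pos.2 (cosh_pos u)
  have hpq : 2 * cosh (u / 2) ^ 2 = √(cosh u) ^ 2 + 1 := by
    rw [sq_sqrt (cosh_pos u).le]
    nth_rewrite 2 [← mul_div_cancel₀ u two_ne_zero]
    rw [cosh_two_mul, sinh_sq]
    ring
  refine (sq_le_sq₀ (by positivity) (by positivity)).1 ?_
  have h : (3 * √(cosh u) + (√(cosh u))⁻¹) ^ 2 =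
      (4 * cosh (u / 2)) ^ 2 + (√(cosh u) - (√(cosh u))⁻¹) ^ 2 := by
    rw [mul_pow, show (4 : ℝ) ^ 2 = 8 * 2 by norm_num, mul_assoc, hpq]
    field_simp
    ring
  rw [h]
  exact le_add_of_nonneg_right (sq_nonneg _)

theorem meanLE_meanG_lambdaMean_neg_half : MeanLE meanG (lambdaMean (-1 / 2)) := by
  refine isHomMean_meanG.meanLE (isHomMean_lambdaMean _) fun u hu => ?_
  rw [le_lambdaMean_exp_iff hu, meanG_exp, show (-1 / 2 : ℝ) + 1 = 1 / 2 by norm_num,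
    show (-1 / 2 : ℝ) = -(1 / 2) by norm_num, jensenBar_fPow_exp (by norm_num) (by norm_num),
    jensenBar_fPow_exp (by norm_num) (by norm_num), rpow_neg (cosh_pos u).le, ← sqrt_eq_rpow,
    neg_mul, cosh_neg, one_div_mul_eq_div]
  linear_combination 8 / 3 * four_mul_cosh_half_le u

end HarmonicGeometric

section Logarithmic

theorem hasDerivAt_cosh_rpow (p u : ℝ) :
    HasDerivAt (fun u => cosh u ^ p) (p * cosh u ^ (p - 1) * sinh u) u :=
  ((hasDerivAt_cosh u).rpow_const (Or.inl (cosh_pos u).ne')).congr_deriv (by ring)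

theorem deriv_lazarevic_nonneg (u : ℝ) :
    0 ≤ cosh u * cosh u ^ (-1 / 3 : ℝ) +
      sinh u * (-1 / 3 * cosh u ^ (-1 / 3 - 1 : ℝ) * sinh u) - 1 := by
  obtain ⟨r, hr, hc⟩ : ∃ r, 0 < r ∧ cosh u = r ^ 3 := by
    refine ⟨cosh u ^ (1 / 3 : ℝ), rpow_pos_of_pos (cosh_pos u) _, ?_⟩
    rw [← rpow_mul_natCast (cosh_pos u).le]
    norm_num
  have h1 : cosh u ^ (-1 / 3 : ℝ) = r⁻¹ := by
    rw [hc, ← rpow_natCast_mul hr.le, ← rpow_neg_one]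
    norm_num
  have h4 : cosh u ^ (-1 / 3 - 1 : ℝ) = (r ^ 4)⁻¹ := by
    rw [rpow_sub_one (cosh_pos u).ne', h1, hc]
    field_simp
  have hs : sinh u ^ 2 = r ^ 6 - 1 := by rw [sinh_sq, hc]; ring
  calc 0 ≤ (r ^ 2 - 1) ^ 2 * (2 * r ^ 2 + 1) / (3 * r ^ 4) := by positivity
    _ = r ^ 3 * r⁻¹ - 1 / 3 * (r ^ 4)⁻¹ * (r ^ 6 - 1) - 1 := by field_simp; ring
    _ = _ := by rw [← hs, h1, h4, hc]; ring

-- Lazarević's inequality.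
theorem pow_three_mul_cosh_le {u : ℝ} (hu : 0 ≤ u) : u ^ 3 * cosh u ≤ sinh u ^ 3 := by
  have h : 0 ≤ sinh u * cosh u ^ (-1 / 3 : ℝ) - u :=
    nonneg_of_hasDerivAt_nonneg (f := fun u => sinh u * cosh u ^ (-1 / 3 : ℝ) - u) (by simp)
      (fun v _ => ((hasDerivAt_sinh v).mul (hasDerivAt_cosh_rpow (-1 / 3) v)).sub
        (hasDerivAt_id v)) (fun v _ => deriv_lazarevic_nonneg v) hu
  have h3 := pow_le_pow_left₀ hu (sub_nonneg.1 h) 3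
  rwa [mul_pow, ← rpow_mul_natCast (cosh_pos u).le, show (-1 / 3 : ℝ) * (3 : ℕ) = -1 by norm_num,
    rpow_neg_one, ← div_eq_mul_inv, le_div_iff₀ (cosh_pos u)] at h3

theorem sinh_add_mul_cosh_pos {u : ℝ} (hu : 0 < u) : 0 < sinh u + u * cosh u :=
  add_pos (sinh_pos_iff.2 hu) (mul_pos hu (cosh_pos u))

theorem tendsto_sq_mul_sinh_div : Tendsto (fun u => u ^ 2 * sinh u / (sinh u + u * cosh u))
    (𝓝[>] 0) (𝓝 0) := by
  have hsq : Tendsto (fun u : ℝ => u ^ 2) (𝓝[>] 0) (𝓝 0) := by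
    simpa using ((continuous_pow 2).tendsto (0 : ℝ)).mono_left nhdsWithin_le_nhds
  refine squeeze_zero' ?_ ?_ hsq <;> filter_upwards [self_mem_nhdsWithin] with u (hu : 0 < u)
  · have := sinh_add_mul_cosh_pos hu
    have := sinh_pos_iff.2 hu
    positivity
  · rw [div_le_iff₀ (sinh_add_mul_cosh_pos hu)]
    gcongr
    exact le_add_of_nonneg_right (mul_pos hu (cosh_pos u)).le

-- The difference of `log (cosh u)` and the quotient vanishes at `0`; Lazarević's inequality says
-- that it increases.
theorem sq_mul_sinh_le {u : ℝ} (hu : 0 < u) :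
    u ^ 2 * sinh u ≤ log (cosh u) * (sinh u + u * cosh u) := by
  rw [← div_le_iff₀ (sinh_add_mul_cosh_pos hu), ← sub_nonneg]
  have h0 : Tendsto (fun u => log (cosh u) - u ^ 2 * sinh u / (sinh u + u * cosh u))
      (𝓝[>] 0) (𝓝 0) := by
    simpa using (tendsto_cosh_nhdsGT_zero.log one_ne_zero).sub tendsto_sq_mul_sinh_div
  refine le_of_tendsto_of_hasDerivAt_nonneg
    (f := fun u => log (cosh u) - u ^ 2 * sinh u / (sinh u + u * cosh u))
    (f' := fun v => (sinh v ^ 3 - v ^ 3 * cosh v) / (cosh v * (sinh v + v * cosh v) ^ 2))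
    hu h0 (fun v hv => ?_) fun v hv => ?_
  · have hc := (cosh_pos v).ne'
    have hp := (sinh_add_mul_cosh_pos hv.1).ne'
    refine ((hasDerivAt_log_cosh v).fun_sub (((hasDerivAt_pow 2 v).fun_mul
      (hasDerivAt_sinh v)).fun_div ((hasDerivAt_sinh v).fun_add
      ((hasDerivAt_id v).fun_mul (hasDerivAt_cosh v))) hp)).congr_deriv ?_
    simp only [id, tanh_eq_sinh_div_cosh]
    generalize hpv : sinh v + v * cosh v = p at hp ⊢
    field_simp
    rw [← hpv]
    linear_combination -v ^ 3 * cosh v * cosh_sq v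
  · have := cosh_pos v
    exact div_nonneg (sub_nonneg.2 (pow_three_mul_cosh_le hv.1.le)) (by positivity)

theorem meanLE_lambdaMean_zero_meanL : MeanLE (lambdaMean 0) meanL := by
  refine (isHomMean_lambdaMean _).meanLE isHomMean_meanL fun u hu => ?_
  rw [lambdaMean_exp_le_iff hu, meanL_exp hu, zero_add, jensenBar_fPow_one_exp,
    jensenBar_fPow_zero_exp, div_mul_eq_mul_div, le_div_iff₀ hu]
  linear_combination 2 * sq_mul_sinh_le hu

end Logarithmic

section Identric

theorem jensenBar_fPow_one_exp_pos {u : ℝ} (hu : 0 < u) :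
    0 < u * sinh u - cosh u * log (cosh u) := by
  have h := jensenBar_fPow_pos 1 (exp_pos (-u)) (exp_pos u) (exp_neg_ne_exp hu)
  rw [jensenBar_fPow_one_exp] at h
  linarith

theorem hasDerivAt_mul_cosh_div_sinh {u : ℝ} (hu : 0 < u) :
    HasDerivAt (fun u => u * cosh u / sinh u) ((cosh u * sinh u - u) / sinh u ^ 2) u := by
  refine (((hasDerivAt_id u).fun_mul (hasDerivAt_cosh u)).fun_div (hasDerivAt_sinh u)
    (sinh_pos_iff.2 hu).ne').congr_deriv ?_
  simp only [id, one_mul]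
  congr 1
  linear_combination -u * cosh_sq_sub_sinh_sq u

theorem tendsto_mul_cosh_div_sinh :
    Tendsto (fun u => u * cosh u / sinh u) (𝓝[>] 0) (𝓝 1) := by
  have h := tendsto_cosh_nhdsGT_zero.div tendsto_sinh_div_self one_ne_zero
  rw [div_one] at h
  refine h.congr' ?_
  filter_upwards [self_mem_nhdsWithin] with u (hu : 0 < u)
  have := sinh_pos_iff.2 hu
  simp only [Pi.div_apply]
  field_simp

theorem tendsto_two_mul_div_sinh_sq :
    Tendsto (fun u => 2 * (u * sinh u - cosh u * log (cosh u)) / sinh u ^ 2) (𝓝[>] 0) (𝓝 1) := by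
  have h := ((tendsto_sinh_div_self.sub
    (tendsto_cosh_nhdsGT_zero.mul tendsto_log_cosh_div_sq)).const_mul 2).div
      (tendsto_sinh_div_self.pow 2) (by norm_num)
  rw [show (2 * (1 - 1 * (1 / 2)) / 1 ^ 2 : ℝ) = 1 by norm_num] at h
  refine h.congr' ?_
  filter_upwards [self_mem_nhdsWithin] with u (hu : 0 < u)
  have := sinh_pos_iff.2 hu
  simp only [Pi.div_apply]
  field_simp

theorem hasDerivAt_log_two_mul_div_sinh_sq {u : ℝ} (hu : 0 < u) :
    HasDerivAt (fun u => log (2 * (u * sinh u - cosh u * log (cosh u)) / sinh u ^ 2))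
      ((u * cosh u - sinh u * log (cosh u)) / (u * sinh u - cosh u * log (cosh u)) -
        2 * (cosh u / sinh u)) u := by
  have hs := (sinh_pos_iff.2 hu).ne'
  have hq := (jensenBar_fPow_one_exp_pos hu).ne'
  refine (((((hasDerivAt_id u).fun_mul (hasDerivAt_sinh u)).fun_sub ((hasDerivAt_cosh u).fun_mul
    (hasDerivAt_log_cosh u))).const_mul 2).fun_div ((hasDerivAt_sinh u).fun_pow 2)
      (pow_ne_zero 2 hs)).log (div_ne_zero (mul_ne_zero two_ne_zero hq) (pow_ne_zero 2 hs))
    |>.congr_deriv ?_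
  have := (cosh_pos u).ne'
  simp only [id, tanh_eq_sinh_div_cosh]
  generalize hqu : u * sinh u - cosh u * log (cosh u) = q at hq ⊢
  field_simp
  rw [← hqu]
  ring

-- The logarithm of the quotient of the two sides tends to `0` at `0`; its derivative is
-- nonnegative by the inequality behind `λ₀ ≤ L`.
theorem sinh_sq_le_identric {u : ℝ} (hu : 0 < u) :
    sinh u ^ 2 ≤ exp (u * cosh u / sinh u - 1) * (2 * (u * sinh u - cosh u * log (cosh u))) := by
  have hlim := (tendsto_mul_cosh_div_sinh.sub_const 1).add
    (tendsto_two_mul_div_sinh_sq.log one_ne_zero)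
  rw [sub_self, log_one, zero_add] at hlim
  have h : 0 ≤ u * cosh u / sinh u - 1 +
      log (2 * (u * sinh u - cosh u * log (cosh u)) / sinh u ^ 2) := by
    refine le_of_tendsto_of_hasDerivAt_nonneg
      (f := fun u => u * cosh u / sinh u - 1 +
        log (2 * (u * sinh u - cosh u * log (cosh u)) / sinh u ^ 2))
      (f' := fun v => (log (cosh v) * (sinh v + v * cosh v) - v ^ 2 * sinh v) /
        (sinh v ^ 2 * (v * sinh v - cosh v * log (cosh v))))
      hu hlim (fun v hv => ?_) fun v hv => ?_
    · have hs := (sinh_pos_iff.2 hv.1).ne'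
      have hq := (jensenBar_fPow_one_exp_pos hv.1).ne'
      refine (((hasDerivAt_mul_cosh_div_sinh hv.1).sub_const 1).fun_add
        (hasDerivAt_log_two_mul_div_sinh_sq hv.1)).congr_deriv ?_
      generalize hqv : v * sinh v - cosh v * log (cosh v) = q at hq ⊢
      field_simp
      rw [← hqv]
      linear_combination log (cosh v) * sinh v * cosh_sq v
    · have := jensenBar_fPow_one_exp_pos hv.1
      exact div_nonneg (sub_nonneg.2 (sq_mul_sinh_le hv.1)) (by positivity)
  have hs := sinh_pos_iff.2 hu
  have hq := jensenBar_fPow_one_exp_pos hu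
  rw [← sub_le_iff_le_add', zero_sub, le_log_iff_exp_le (by positivity),
    le_div_iff₀ (by positivity), exp_neg, inv_mul_le_iff₀ (exp_pos _)] at h
  exact h

theorem meanLE_lambdaMean_one_meanI : MeanLE (lambdaMean 1) meanI := by
  refine (isHomMean_lambdaMean _).meanLE isHomMean_meanI fun u hu => ?_
  have h2 := jensenBar_fPow_natCast_exp le_rfl u
  simp only [Nat.cast_ofNat] at h2
  rw [lambdaMean_exp_le_iff hu, meanI_exp hu, one_add_one_eq_two, jensenBar_fPow_one_exp, h2,
    cosh_two_mul]
  linear_combination sinh_sq_le_identric hu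

end Identric

section Arithmetic

theorem lambdaMean_two {a b : ℝ} (ha : 0 < a) (hb : 0 < b) : lambdaMean 2 a b = meanA a b := by
  rcases eq_or_ne a b with rfl | hab
  · rw [lambdaMean_self, meanA, add_self_div_two]
  have h := jensenBar_fPow_pos 2 ha hb hab
  rw [lambdaMean_of_ne 2 hab, div_eq_iff h.ne', jensenBar_fPow_of_ne (by norm_num) (by norm_num),
    jensenBar_fPow_of_ne (by norm_num) (by norm_num), show (2 : ℝ) + 1 = (3 : ℕ) by norm_num, meanA]
  simp only [rpow_natCast, rpow_two]
  ring

end Arithmetic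

section Gini

theorem tanh_add_pow_three_div_le {u : ℝ} (hu : 0 ≤ u) : tanh u + tanh u ^ 3 / 3 ≤ u := by
  rw [← sub_nonneg]
  refine nonneg_of_hasDerivAt_nonneg (f := fun u => u - (tanh u + tanh u ^ 3 / 3)) (by simp)
    (f' := fun v => tanh v ^ 4) (fun v _ => ?_) (fun v _ => by positivity) hu
  refine ((hasDerivAt_id v).fun_sub ((hasDerivAt_tanh v).fun_add
    (((hasDerivAt_tanh v).fun_pow 3).div_const 3))).congr_deriv ?_
  ring

theorem hasDerivAt_log_one_add_tanh (u : ℝ) :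
    HasDerivAt (fun u => log (1 + tanh u ^ 2 / 2) - log (1 + tanh u ^ 2 + tanh u ^ 4 / 15))
      (-tanh u * (1 - tanh u ^ 2) * (1 + 4 * tanh u ^ 2 / 15 + tanh u ^ 4 / 15) /
        ((1 + tanh u ^ 2 + tanh u ^ 4 / 15) * (1 + tanh u ^ 2 / 2))) u := by
  have ht := hasDerivAt_tanh u
  have h2 : 1 + tanh u ^ 2 / 2 ≠ 0 := by positivity
  have h4 : 1 + tanh u ^ 2 + tanh u ^ 4 / 15 ≠ 0 := by positivity
  refine ((((ht.fun_pow 2).div_const 2).const_add 1).log h2).fun_sub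
    ((((ht.fun_pow 2).const_add 1).fun_add ((ht.fun_pow 4).div_const 15)).log h4)
    |>.congr_deriv ?_
  field_simp
  ring

theorem mul_le_tanh_add_mul {t : ℝ} (ht : 0 ≤ t) :
    t * (1 + 4 * t ^ 2 / 15 + t ^ 4 / 15) ≤
      (t + t ^ 3 / 3) * ((1 + t ^ 2 + t ^ 4 / 15) * (1 + t ^ 2 / 2)) := by
  have : 0 ≤ t ^ 3 * (47 / 30 + t ^ 2 + 2 / 9 * t ^ 4 + t ^ 6 / 90) := by positivity
  linear_combination this

theorem log_cosh_add_log_le {u : ℝ} (hu : 0 ≤ u) :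
    log (cosh u) + log (1 + tanh u ^ 2 + tanh u ^ 4 / 15) ≤
      u * tanh u + log (1 + tanh u ^ 2 / 2) := by
  have h : 0 ≤ u * tanh u - log (cosh u) +
      (log (1 + tanh u ^ 2 / 2) - log (1 + tanh u ^ 2 + tanh u ^ 4 / 15)) := by
    refine nonneg_of_hasDerivAt_nonneg (f := fun u => u * tanh u - log (cosh u) +
        (log (1 + tanh u ^ 2 / 2) - log (1 + tanh u ^ 2 + tanh u ^ 4 / 15)))
      (f' := fun v => (1 - tanh v ^ 2) * (v - tanh v * (1 + 4 * tanh v ^ 2 / 15 + tanh v ^ 4 / 15) /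
        ((1 + tanh v ^ 2 + tanh v ^ 4 / 15) * (1 + tanh v ^ 2 / 2))))
      (by simp) (fun v _ => ?_) (fun v hv => ?_) hu
    · refine ((((hasDerivAt_id v).fun_mul (hasDerivAt_tanh v)).fun_sub
        (hasDerivAt_log_cosh v)).fun_add (hasDerivAt_log_one_add_tanh v)).congr_deriv ?_
      simp only [id]
      ring
    · refine mul_nonneg (sub_nonneg.2 (tanh_sq_lt_one v).le) (sub_nonneg.2 ?_)
      rw [div_le_iff₀ (by positivity)]
      exact (mul_le_tanh_add_mul (tanh_nonneg hv.le)).trans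
        (mul_le_mul_of_nonneg_right (tanh_add_pow_three_div_le hv.le) (by positivity))
  linarith

theorem cosh_mul_tanh_poly_le {u : ℝ} (hu : 0 ≤ u) :
    cosh u * (1 + tanh u ^ 2 + tanh u ^ 4 / 15) ≤ exp (u * tanh u) * (1 + tanh u ^ 2 / 2) := by
  have := cosh_pos u
  rw [← log_le_log_iff (by positivity) (by positivity), log_mul (by positivity) (by positivity),
    log_mul (by positivity) (by positivity), log_exp]
  exact log_cosh_add_log_le hu

theorem meanLE_lambdaMean_five_meanS : MeanLE (lambdaMean 5) meanS := by
  refine (isHomMean_lambdaMean _).meanLE isHomMean_meanS fun u hu => ?_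
  have hJ5 := jensenBar_fPow_natCast_exp (n := 5) (by norm_num) u
  have hJ6 := jensenBar_fPow_natCast_exp (n := 6) (by norm_num) u
  simp only [Nat.cast_ofNat] at hJ5 hJ6
  rw [lambdaMean_exp_le_iff hu, meanS_exp, show (5 : ℝ) + 1 = 6 by norm_num, hJ5, hJ6,
    cosh_five_mul, cosh_six_mul, mul_div_assoc u, ← tanh_eq_sinh_div_cosh]
  have := cosh_pos u
  have h := mul_le_mul_of_nonneg_left (cosh_mul_tanh_poly_le hu.le)
    (show 0 ≤ cosh u ^ 5 * tanh u ^ 2 by positivity)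
  have ht : cosh u ^ 2 * tanh u ^ 2 = cosh u ^ 2 - 1 := by
    linear_combination -cosh_sq_mul_one_sub_tanh_sq u
  have h6 : cosh u ^ 5 * tanh u ^ 2 * (cosh u * (1 + tanh u ^ 2 + tanh u ^ 4 / 15)) =
      (31 * cosh u ^ 6 - 48 * cosh u ^ 4 + 18 * cosh u ^ 2 - 1) / 15 :=
    calc _ = cosh u ^ 4 * (cosh u ^ 2 * tanh u ^ 2) + cosh u ^ 2 * (cosh u ^ 2 * tanh u ^ 2) ^ 2 +
          (cosh u ^ 2 * tanh u ^ 2) ^ 3 / 15 := by ring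
      _ = _ := by rw [ht]; ring
  have h5 : cosh u ^ 5 * tanh u ^ 2 * (exp (u * tanh u) * (1 + tanh u ^ 2 / 2)) =
      exp (u * tanh u) * ((3 * cosh u ^ 5 - 4 * cosh u ^ 3 + cosh u) / 2) :=
    calc _ = exp (u * tanh u) * cosh u * (cosh u ^ 2 * (cosh u ^ 2 * tanh u ^ 2) +
          (cosh u ^ 2 * tanh u ^ 2) ^ 2 / 2) := by ring
      _ = _ := by rw [ht]; ring
  linear_combination h - h6 + h5

end Gini

section Diagonal

/-- The function `M` has the expansion `M (1 - x) (1 + x) = 1 + c x² + o(x²)` as `x → 0⁺`. -/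
def HasDiagCoeff (M : ℝ → ℝ → ℝ) (c : ℝ) : Prop :=
  Tendsto (fun x => (M (1 - x) (1 + x) - 1) / x ^ 2) (𝓝[>] 0) (𝓝 c)

theorem eventually_mem_Ioo : ∀ᶠ x : ℝ in 𝓝[>] 0, x ∈ Ioo 0 1 := Ioo_mem_nhdsGT one_pos

theorem HasDiagCoeff.le {M N : ℝ → ℝ → ℝ} {c d : ℝ} (hM : HasDiagCoeff M c) (hN : HasDiagCoeff N d)
    (h : MeanLE M N) : c ≤ d := by
  refine le_of_tendsto_of_tendsto hM hN ?_
  filter_upwards [eventually_mem_Ioo] with x ⟨h0, h1⟩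
  have := h (1 - x) (1 + x) (by linarith) (by linarith)
  gcongr

theorem hasDerivAt_comp_one_add {f : ℝ → ℝ} {f' x : ℝ} (hf : HasDerivAt f f' (1 + x)) :
    HasDerivAt (fun x => f (1 + x)) f' x :=
  hf.comp_const_add 1 x

theorem hasDerivAt_comp_one_sub {f : ℝ → ℝ} {f' x : ℝ} (hf : HasDerivAt f f' (1 - x)) :
    HasDerivAt (fun x => f (1 - x)) (-f') x :=
  hf.comp_const_sub 1 x

theorem tendsto_jensenBar_div_pow {F F' F'' : ℝ → ℝ} (hF : ∀ t, 0 < t → HasDerivAt F (F' t) t)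
    (hF' : ∀ t, 0 < t → HasDerivAt F' (F'' t) t) {n : ℕ} {c : ℝ}
    (h : Tendsto (fun x => (F'' (1 - x) + F'' (1 + x)) / x ^ n) (𝓝[>] 0) (𝓝 c)) :
    Tendsto (fun x => jensenBar F (1 - x) (1 + x) / x ^ (n + 2)) (𝓝[>] 0)
      (𝓝 (c / (n + 1) / (n + 2))) := by
  have hG : ∀ x ∈ Ico (0 : ℝ) 1, HasDerivAt (fun x => jensenBar F (1 - x) (1 + x))
      (-F' (1 - x) + F' (1 + x)) x := fun x hx => by
    simp only [jensenBar, sub_add_add_cancel]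
    exact ((hasDerivAt_comp_one_sub (hF _ (by linarith [hx.2]))).add
      (hasDerivAt_comp_one_add (hF _ (by linarith [hx.1])))).sub_const _
  have hG' : ∀ x ∈ Ico (0 : ℝ) 1, HasDerivAt (fun x => -F' (1 - x) + F' (1 + x))
      (F'' (1 - x) + F'' (1 + x)) x := fun x hx =>
    ((hasDerivAt_comp_one_sub (hF' _ (by linarith [hx.2]))).fun_neg.fun_add
      (hasDerivAt_comp_one_add (hF' _ (by linarith [hx.1])))).congr_deriv (by ring)
  have h0 : (0 : ℝ) ∈ Ico (0 : ℝ) 1 := ⟨le_rfl, one_pos⟩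
  have h1 := tendsto_div_pow_succ_of_hasDerivAt (n := n)
    (eventually_mem_Ioo.mono fun x hx => hG' x (Ioo_subset_Ico_self hx))
    (by simpa using (hG' 0 h0).continuousAt.tendsto.mono_left nhdsWithin_le_nhds) h
  have h2 := tendsto_div_pow_succ_of_hasDerivAt
    (eventually_mem_Ioo.mono fun x hx => hG x (Ioo_subset_Ico_self hx))
    (by simpa [jensenBar, ← two_mul] using
      (hG 0 h0).continuousAt.tendsto.mono_left nhdsWithin_le_nhds) h1
  convert h2 using 3
  push_cast
  ring

theorem tendsto_jensenBar_fPow_div_sq (s : ℝ) :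
    Tendsto (fun x => jensenBar (fPow s) (1 - x) (1 + x) / x ^ 2) (𝓝[>] 0) (𝓝 1) := by
  have hcont : ContinuousAt (fun x : ℝ => (1 - x) ^ (s - 2) + (1 + x) ^ (s - 2)) 0 :=
    ((by fun_prop : ContinuousAt (fun x : ℝ => 1 - x) 0).rpow_const (Or.inl (by norm_num))).add
      ((by fun_prop : ContinuousAt (fun x : ℝ => 1 + x) 0).rpow_const (Or.inl (by norm_num)))
  have h := tendsto_jensenBar_div_pow (fun _ => hasDerivAt_fPow s)
    (fun _ => hasDerivAt_fPowDeriv s) (n := 0) (c := 2)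
    (by simpa [one_add_one_eq_two] using hcont.tendsto.mono_left nhdsWithin_le_nhds)
  simpa using h

theorem tendsto_slope_one_add_rpow_sub (p : ℝ) :
    Tendsto (fun x => ((1 + x) ^ p - (1 - x) ^ p) / x) (𝓝[>] 0) (𝓝 (2 * p)) := by
  have h : HasDerivAt (fun x : ℝ => (1 + x) ^ p - (1 - x) ^ p) (2 * p) 0 :=
    ((hasDerivAt_comp_one_add (hasDerivAt_rpow_const (by norm_num))).sub
      (hasDerivAt_comp_one_sub (hasDerivAt_rpow_const (by norm_num)))).congr_deriv
        (by simp [two_mul])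
  refine (h.tendsto_slope.mono_left (nhdsGT_le_nhdsNE 0)).congr fun x => ?_
  simp [slope_def_field]

theorem tendsto_jensenBar_fPow_succ_sub_div (s : ℝ) :
    Tendsto (fun x => (jensenBar (fPow (s + 1)) (1 - x) (1 + x) -
      jensenBar (fPow s) (1 - x) (1 + x)) / x ^ 4) (𝓝[>] 0) (𝓝 ((s - 2) / 6)) := by
  have h := tendsto_jensenBar_div_pow (n := 2) (c := 2 * (s - 2))
    (fun _ ht => (hasDerivAt_fPow (s + 1) ht).fun_sub (hasDerivAt_fPow s ht))
    (fun _ ht => (hasDerivAt_fPowDeriv (s + 1) ht).fun_sub (hasDerivAt_fPowDeriv s ht)) ?_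
  · convert h using 2
    · simp only [jensenBar]
      ring
    · push_cast
      ring_nf
  · refine (tendsto_slope_one_add_rpow_sub (s - 2)).congr' ?_
    filter_upwards [eventually_mem_Ioo] with x ⟨h0, h1⟩
    have hsub : s + 1 - 2 = s - 2 + 1 := by ring
    rw [hsub, rpow_add_one (by linarith), rpow_add_one (by linarith)]
    field_simp
    ring

theorem hasDiagCoeff_lambdaMean (s : ℝ) : HasDiagCoeff (lambdaMean s) ((s - 2) / 6) := by
  have h := (tendsto_jensenBar_fPow_succ_sub_div s).div (tendsto_jensenBar_fPow_div_sq s)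
    one_ne_zero
  rw [div_one] at h
  refine h.congr' ?_
  filter_upwards [eventually_mem_Ioo] with x ⟨h0, h1⟩
  have hne : 1 - x ≠ 1 + x := by linarith
  have hJ := jensenBar_fPow_pos s (by linarith) (by linarith) hne
  rw [lambdaMean_of_ne s hne, Pi.div_apply]
  field_simp

theorem hasDiagCoeff_meanH : HasDiagCoeff meanH (-1) := by
  refine tendsto_const_nhds.congr' ?_
  filter_upwards [eventually_mem_Ioo] with x ⟨h0, h1⟩
  have : 1 - x ≠ 0 := by linarith
  rw [meanH]
  field_simp
  ring

theorem hasDiagCoeff_meanG : HasDiagCoeff meanG (-1 / 2) := by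
  have hcont : ContinuousAt (fun x : ℝ => -1 / (1 + √(1 - x ^ 2))) 0 :=
    ContinuousAt.div (by fun_prop) (by fun_prop) (by simp)
  have h : Tendsto (fun x : ℝ => -1 / (1 + √(1 - x ^ 2))) (𝓝[>] 0) (𝓝 (-1 / 2)) := by
    simpa [one_add_one_eq_two] using hcont.tendsto.mono_left nhdsWithin_le_nhds
  refine h.congr' ?_
  filter_upwards [eventually_mem_Ioo] with x ⟨h0, h1⟩
  have hs := sq_sqrt (show 0 ≤ 1 - x ^ 2 by nlinarith)
  rw [meanG, show (1 - x) * (1 + x) = 1 - x ^ 2 by ring, div_eq_div_iff (by positivity)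
    (by positivity)]
  linear_combination -hs

theorem tendsto_log_one_add_sub_log_one_sub_div :
    Tendsto (fun x => (log (1 + x) - log (1 - x) - 2 * x) / x ^ 3) (𝓝[>] 0) (𝓝 (2 / 3)) := by
  have h := tendsto_div_pow_succ_of_hasDerivAt (n := 2) (c := 2)
    (f := fun x => log (1 + x) - log (1 - x) - 2 * x) (f' := fun x => 2 * x ^ 2 / (1 - x ^ 2))
    ?_ ?_ ?_
  · convert h using 2
    norm_num
  · filter_upwards [eventually_mem_Ioo] with x ⟨h0, h1⟩
    have hm : 1 - x ≠ 0 := by linarith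
    have hp : 1 + x ≠ 0 := by linarith
    have hx : 1 - x ^ 2 ≠ 0 := by rw [show 1 - x ^ 2 = (1 - x) * (1 + x) by ring]; positivity
    refine (((hasDerivAt_comp_one_add (hasDerivAt_log hp)).fun_sub (hasDerivAt_comp_one_sub
      (hasDerivAt_log hm))).fun_sub ((hasDerivAt_id x).const_mul 2)).congr_deriv ?_
    field_simp
    ring
  · have hcont : ContinuousAt (fun x : ℝ => log (1 + x) - log (1 - x) - 2 * x) 0 := by
      fun_prop (disch := norm_num)
    simpa using hcont.tendsto.mono_left nhdsWithin_le_nhds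
  · have hcont : ContinuousAt (fun x : ℝ => 2 / (1 - x ^ 2)) 0 := by fun_prop (disch := norm_num)
    have h2 : Tendsto (fun x : ℝ => 2 / (1 - x ^ 2)) (𝓝[>] 0) (𝓝 2) := by
      simpa using hcont.tendsto.mono_left nhdsWithin_le_nhds
    refine h2.congr' ?_
    filter_upwards [self_mem_nhdsWithin] with x (hx : 0 < x)
    field_simp

theorem tendsto_mul_sq_nhdsGT_zero {f : ℝ → ℝ} {c : ℝ} (hf : Tendsto f (𝓝[>] 0) (𝓝 c)) :
    Tendsto (fun x => f x * x ^ 2) (𝓝[>] 0) (𝓝 0) := by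
  simpa using hf.mul (((continuous_pow 2).tendsto (0 : ℝ)).mono_left nhdsWithin_le_nhds)

theorem hasDiagCoeff_meanA : HasDiagCoeff meanA 0 := by
  refine tendsto_const_nhds.congr fun x => ?_
  rw [meanA]
  ring

theorem hasDiagCoeff_meanL : HasDiagCoeff meanL (-1 / 3) := by
  have h3 := tendsto_log_one_add_sub_log_one_sub_div
  have h := h3.neg.div ((tendsto_mul_sq_nhdsGT_zero h3).add_const 2) (by norm_num)
  rw [show -(2 / 3) / (0 + 2) = (-1 / 3 : ℝ) by norm_num] at h
  refine h.congr' ?_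
  filter_upwards [eventually_mem_Ioo] with x ⟨h0, h1⟩
  have hl : 0 < log (1 + x) - log (1 - x) :=
    sub_pos.2 (log_lt_log (by linarith) (by linarith))
  rw [meanL, if_neg (by linarith), Pi.div_apply]
  generalize log (1 + x) - log (1 - x) = l at hl ⊢
  rw [show (l - 2 * x) / x ^ 3 * x ^ 2 + 2 = l / x by field_simp; ring]
  field_simp
  ring

-- The divided difference of `exp` at `0` is continuous with value `1` there.
theorem hasDiagCoeff_of_eq_exp {M : ℝ → ℝ → ℝ} {f : ℝ → ℝ} {c : ℝ}
    (hM : ∀ x ∈ Ioo (0 : ℝ) 1, M (1 - x) (1 + x) = exp (f x))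
    (hf : Tendsto (fun x => f x / x ^ 2) (𝓝[>] 0) (𝓝 c)) : HasDiagCoeff M c := by
  have hf0 : Tendsto f (𝓝[>] 0) (𝓝 0) := by
    refine (tendsto_mul_sq_nhdsGT_zero hf).congr' ?_
    filter_upwards [self_mem_nhdsWithin] with x (hx : 0 < x)
    field_simp
  have hd : Tendsto (fun x => dslope exp 0 (f x)) (𝓝[>] 0) (𝓝 1) := by
    have h := (continuousAt_dslope_same.2 differentiable_exp.differentiableAt).tendsto.comp hf0
    rwa [dslope_same, Real.deriv_exp, exp_zero] at h
  have h := hd.mul hf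
  rw [one_mul] at h
  refine h.congr' ?_
  filter_upwards [eventually_mem_Ioo] with x hx
  have h1 := sub_smul_dslope exp 0 (f x)
  rw [sub_zero, smul_eq_mul, exp_zero] at h1
  rw [hM x hx, ← h1]
  ring

theorem jensenBar_fPow_zero_one_sub_one_add (x : ℝ) :
    jensenBar (fPow 0) (1 - x) (1 + x) = -(log (1 - x) + log (1 + x)) := by
  rw [jensenBar_fPow_zero, sub_add_add_cancel]
  norm_num
  ring

theorem jensenBar_fPow_one_one_sub_one_add (x : ℝ) :
    jensenBar (fPow 1) (1 - x) (1 + x) = (1 - x) * log (1 - x) + (1 + x) * log (1 + x) := by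
  rw [jensenBar_fPow_one, sub_add_add_cancel]
  norm_num

theorem tendsto_mul_log_one_add_sub_div :
    Tendsto (fun x => ((1 + x) * log (1 + x) - (1 - x) * log (1 - x) - 2 * x) / x ^ 3)
      (𝓝[>] 0) (𝓝 (-1 / 3)) := by
  have h := tendsto_div_pow_succ_of_hasDerivAt (n := 2) (c := -1)
    (f := fun x => (1 + x) * log (1 + x) - (1 - x) * log (1 - x) - 2 * x)
    (f' := fun x => log (1 - x) + log (1 + x)) ?_ ?_ ?_
  · convert h using 2
    norm_num
  · filter_upwards [eventually_mem_Ioo] with x ⟨h0, h1⟩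
    refine (((hasDerivAt_comp_one_add (hasDerivAt_mul_log (by linarith))).fun_sub
      (hasDerivAt_comp_one_sub (hasDerivAt_mul_log (by linarith)))).fun_sub
        ((hasDerivAt_id x).const_mul 2)).congr_deriv ?_
    ring
  · have hcont : ContinuousAt (fun x : ℝ => (1 + x) * log (1 + x) - (1 - x) * log (1 - x) - 2 * x)
        0 := by fun_prop (disch := norm_num)
    simpa using hcont.tendsto.mono_left nhdsWithin_le_nhds
  · refine (tendsto_jensenBar_fPow_div_sq 0).neg.congr fun x => ?_
    rw [jensenBar_fPow_zero_one_sub_one_add]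
    ring

theorem hasDiagCoeff_meanI : HasDiagCoeff meanI (-1 / 6) := by
  refine hasDiagCoeff_of_eq_exp
    (f := fun x => ((1 + x) * log (1 + x) - (1 - x) * log (1 - x)) / (2 * x) - 1)
    (fun x hx => ?_) ?_
  · rw [meanI_of_ne (by linarith [hx.2]) (by linarith [hx.1]) (by linarith [hx.1])]
    congr 3
    ring
  · have h := tendsto_mul_log_one_add_sub_div.div_const 2
    rw [show -1 / 3 / 2 = (-1 / 6 : ℝ) by norm_num] at h
    refine h.congr' ?_
    filter_upwards [self_mem_nhdsWithin] with x (hx : 0 < x)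
    field_simp

theorem hasDiagCoeff_meanS : HasDiagCoeff meanS (1 / 2) := by
  refine hasDiagCoeff_of_eq_exp (f := fun x => jensenBar (fPow 1) (1 - x) (1 + x) / 2)
    (fun x hx => ?_) ?_
  · rw [meanS_eq_exp (by linarith [hx.2]) (by linarith [hx.1]), jensenBar_fPow_one_one_sub_one_add]
    ring_nf
  · refine ((tendsto_jensenBar_fPow_div_sq 1).div_const 2).congr fun x => ?_
    ring

end Diagonal

section Boundary

theorem tendsto_rpow_nhdsGT_zero {p : ℝ} (hp : 0 < p) :
    Tendsto (fun a : ℝ => a ^ p) (𝓝[>] 0) (𝓝 0) := by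
  have h := (continuousAt_rpow_const 0 p (Or.inr hp.le)).tendsto
  rw [zero_rpow hp.ne'] at h
  exact h.mono_left nhdsWithin_le_nhds

theorem tendsto_one_sub_two_mul_midpoint_rpow (p : ℝ) :
    Tendsto (fun a : ℝ => 1 - 2 * ((a + 1) / 2) ^ p) (𝓝[>] 0) (𝓝 (1 - 2 * (1 / 2) ^ p)) := by
  have hcont : ContinuousAt (fun a : ℝ => 1 - 2 * ((a + 1) / 2) ^ p) 0 :=
    continuousAt_const.sub (continuousAt_const.mul
      ((by fun_prop : ContinuousAt (fun a : ℝ => (a + 1) / 2) 0).rpow_const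
        (Or.inl (by norm_num))))
  simpa using hcont.tendsto.mono_left nhdsWithin_le_nhds

theorem jensenBar_fPow_right_one {s : ℝ} (h0 : s ≠ 0) (h1 : s ≠ 1) (a : ℝ) :
    jensenBar (fPow s) a 1 = (a ^ s + (1 - 2 * ((a + 1) / 2) ^ s)) / (s * (s - 1)) := by
  rw [jensenBar_fPow_of_ne h0 h1, one_rpow]
  ring

theorem tendsto_jensenBar_fPow_right_one {s : ℝ} (h0 : 0 < s) (h1 : s ≠ 1) :
    Tendsto (fun a => jensenBar (fPow s) a 1) (𝓝[>] 0)
      (𝓝 ((1 - 2 * (1 / 2) ^ s) / (s * (s - 1)))) := by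
  have h := ((tendsto_rpow_nhdsGT_zero h0).add
    (tendsto_one_sub_two_mul_midpoint_rpow s)).div_const (s * (s - 1))
  rw [zero_add] at h
  exact h.congr fun a => (jensenBar_fPow_right_one h0.ne' h1 a).symm

theorem tendsto_rpow_neg_mul_jensenBar_fPow_right_one {s : ℝ} (h0 : s < 0) :
    Tendsto (fun a => a ^ (-s) * jensenBar (fPow s) a 1) (𝓝[>] 0) (𝓝 (1 / (s * (s - 1)))) := by
  have h := (((tendsto_rpow_nhdsGT_zero (neg_pos.2 h0)).mul
    (tendsto_one_sub_two_mul_midpoint_rpow s)).const_add 1).div_const (s * (s - 1))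
  rw [zero_mul, add_zero] at h
  refine h.congr' ?_
  filter_upwards [self_mem_nhdsWithin] with a (ha : 0 < a)
  rw [jensenBar_fPow_right_one h0.ne (by linarith), ← mul_div_assoc, mul_add, ← rpow_add ha,
    neg_add_cancel, rpow_zero]

theorem MeanLE.eventually_mul_jensenBar_le {M : ℝ → ℝ → ℝ} {s : ℝ} (h : MeanLE M (lambdaMean s)) :
    ∀ᶠ a in 𝓝[>] 0, M a 1 * jensenBar (fPow s) a 1 ≤ jensenBar (fPow (s + 1)) a 1 := by
  filter_upwards [eventually_mem_Ioo] with a ⟨h0, h1⟩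
  have ha := h a 1 h0 one_pos
  rwa [lambdaMean_of_ne s h1.ne, le_div_iff₀ (jensenBar_fPow_pos s h0 one_pos h1.ne)] at ha

theorem tendsto_meanH_div : Tendsto (fun a => meanH a 1 / a) (𝓝[>] 0) (𝓝 2) := by
  have hcont : ContinuousAt (fun a : ℝ => 2 / (1 + a)) 0 := by fun_prop (disch := norm_num)
  have h : Tendsto (fun a : ℝ => 2 / (1 + a)) (𝓝[>] 0) (𝓝 2) := by
    simpa using hcont.tendsto.mono_left nhdsWithin_le_nhds
  refine h.congr' ?_
  filter_upwards [self_mem_nhdsWithin] with a (ha : 0 < a)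
  rw [meanH]
  field_simp

theorem neg_three_le_of_meanLE_meanH_lambdaMean {s : ℝ} (h : MeanLE meanH (lambdaMean s)) :
    -3 ≤ s := by
  by_contra! hs
  have hlim : 2 * (1 / (s * (s - 1))) ≤ 1 / ((s + 1) * (s + 1 - 1)) := by
    refine le_of_tendsto_of_tendsto
      (tendsto_meanH_div.mul (tendsto_rpow_neg_mul_jensenBar_fPow_right_one (by linarith)))
      (tendsto_rpow_neg_mul_jensenBar_fPow_right_one (by linarith)) ?_
    filter_upwards [self_mem_nhdsWithin, h.eventually_mul_jensenBar_le] with a (ha : 0 < a) hle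
    calc meanH a 1 / a * (a ^ (-s) * jensenBar (fPow s) a 1)
        = a ^ (-(s + 1)) * (meanH a 1 * jensenBar (fPow s) a 1) := by
          rw [neg_add, rpow_add ha, rpow_neg_one]
          ring
      _ ≤ _ := mul_le_mul_of_nonneg_left hle (rpow_nonneg ha.le _)
  rw [mul_one_div, div_le_div_iff₀ (by nlinarith) (by nlinarith)] at hlim
  nlinarith

theorem neg_half_le_of_meanLE_meanG_lambdaMean {s : ℝ} (h : MeanLE meanG (lambdaMean s)) :
    -1 / 2 ≤ s := by
  by_contra! hs
  obtain ⟨t, ht1, ht2, hst⟩ : ∃ t : ℝ, -1 < t ∧ t < -1 / 2 ∧ s ≤ t :=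
    ⟨max s (-3 / 4), lt_max_of_lt_right (by norm_num), max_lt hs (by norm_num), le_max_left _ _⟩
  have hlim := le_of_tendsto_of_tendsto
    (tendsto_rpow_neg_mul_jensenBar_fPow_right_one (by linarith : t < 0))
    ((tendsto_rpow_nhdsGT_zero (by linarith : 0 < -t - 1 / 2)).mul
      (tendsto_jensenBar_fPow_right_one (by linarith : 0 < t + 1) (by linarith))) ?_
  · have : 0 < 1 / (t * (t - 1)) := one_div_pos.2 (by nlinarith)
    linarith
  · filter_upwards [self_mem_nhdsWithin,
      (h.trans (meanLE_lambdaMean hst)).eventually_mul_jensenBar_le] with a (ha : 0 < a) hle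
    calc a ^ (-t) * jensenBar (fPow t) a 1
        = a ^ (-t - 1 / 2) * (meanG a 1 * jensenBar (fPow t) a 1) := by
          rw [meanG, mul_one, sqrt_eq_rpow, ← mul_assoc, ← rpow_add ha, sub_add_cancel]
      _ ≤ _ := mul_le_mul_of_nonneg_left hle (rpow_nonneg ha.le _)

theorem MeanLE.limit_right_one_le {M : ℝ → ℝ → ℝ} {s l : ℝ} (hs : 1 < s)
    (hM : Tendsto (fun a => M a 1) (𝓝[>] 0) (𝓝 l)) (h : MeanLE M (lambdaMean s)) :
    l * (1 - 2 * (1 / 2) ^ s) * (s + 1) ≤ (1 - (1 / 2) ^ s) * (s - 1) := by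
  have h0 : 0 < s := by linarith
  have hlim := le_of_tendsto_of_tendsto (hM.mul (tendsto_jensenBar_fPow_right_one h0 hs.ne'))
    (tendsto_jensenBar_fPow_right_one (s := s + 1) (by linarith) (by linarith))
    h.eventually_mul_jensenBar_le
  rw [rpow_add_one (by norm_num), add_sub_cancel_right, ← mul_div_assoc,
    div_le_div_iff₀ (mul_pos h0 (sub_pos.2 hs)) (by positivity)] at hlim
  refine le_of_mul_le_mul_left ?_ h0
  linear_combination hlim

theorem tendsto_meanS_right_one : Tendsto (fun a => meanS a 1) (𝓝[>] 0) (𝓝 1) := by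
  have hcont : ContinuousAt (fun a : ℝ => exp (a * log a / (a + 1))) 0 :=
    (continuous_mul_log.continuousAt.div (by fun_prop) (by norm_num)).rexp
  have h := hcont.tendsto.mono_left (nhdsWithin_le_nhds (s := Ioi 0))
  rw [zero_mul, zero_div, exp_zero] at h
  refine h.congr' ?_
  filter_upwards [self_mem_nhdsWithin] with a (ha : 0 < a)
  rw [meanS_eq_exp ha one_pos, log_one, mul_zero, add_zero]

theorem not_meanLE_meanS_lambdaMean (s : ℝ) : ¬ MeanLE meanS (lambdaMean s) := by
  intro h
  have ht : 2 ≤ max s 2 := le_max_right _ _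
  have hlim := MeanLE.limit_right_one_le (by linarith) tendsto_meanS_right_one
    (h.trans (meanLE_lambdaMean (le_max_left s 2)))
  generalize max s 2 = t at ht hlim
  have hpow : (1 / 2 : ℝ) ^ t * (1 + t) ≤ 1 := by
    have hbern := one_add_mul_self_le_rpow_one_add (s := 1) (by norm_num) (p := t) (by linarith)
    rw [mul_one, one_add_one_eq_two] at hbern
    rwa [one_div, inv_rpow zero_le_two, inv_mul_le_iff₀ (by positivity), mul_one]
  have : (1 / 2 : ℝ) ^ t ≤ 1 / 3 := by
    rw [le_div_iff₀ three_pos]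
    exact (mul_le_mul_of_nonneg_left (by linarith) (by positivity)).trans hpow
  nlinarith

theorem tendsto_meanI_right_one : Tendsto (fun a => meanI a 1) (𝓝[>] 0) (𝓝 (exp (-1))) := by
  have hcont : ContinuousAt (fun a : ℝ => exp (-(a * log a) / (1 - a) - 1)) 0 :=
    ((continuous_mul_log.continuousAt.neg.div (by fun_prop) (by norm_num)).sub
      continuousAt_const).rexp
  have h := hcont.tendsto.mono_left (nhdsWithin_le_nhds (s := Ioi 0))
  rw [zero_mul, neg_zero, zero_div, zero_sub] at h
  refine h.congr' ?_
  filter_upwards [eventually_mem_Ioo] with a ⟨h0, h1⟩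
  rw [meanI_of_ne h0 one_pos h1.ne, log_one, mul_zero, zero_sub]

theorem one_half_rpow_le : (1 / 2 : ℝ) ^ (1.03 : ℝ) ≤ 0.48972 := by
  rw [← pow_le_pow_iff_left₀ (by positivity) (by norm_num) (by norm_num : 100 ≠ 0),
    ← rpow_mul_natCast (by norm_num), show (1.03 : ℝ) * (100 : ℕ) = (103 : ℕ) by norm_num,
    rpow_natCast]
  norm_num

theorem not_meanLE_meanI_lambdaMean_1_03 : ¬ MeanLE meanI (lambdaMean 1.03) := by
  intro h
  have hlim := MeanLE.limit_right_one_le (by norm_num) tendsto_meanI_right_one h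
  have hr := one_half_rpow_le
  have he := exp_neg_one_gt_d9
  generalize (1 / 2 : ℝ) ^ (1.03 : ℝ) = r at *
  have : 0 ≤ (exp (-1) - 0.36787) * (1 - 2 * r) := mul_nonneg (by linarith) (by linarith)
  linarith

end Boundary

section LambertConvergents

-- The bounds below are the convergents of Lambert's continued fraction
-- `u * cosh u / sinh u = 1 + u ^ 2 / (3 + u ^ 2 / (5 + ⋯))`: the difference of the two sides
-- of each is an antiderivative of `u` times the difference of the two sides of the previous one.

theorem sinh_le_mul_cosh {u : ℝ} (hu : 0 ≤ u) : sinh u ≤ u * cosh u := by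
  rw [← sub_nonneg]
  refine nonneg_of_hasDerivAt_nonneg (f := fun u => u * cosh u - sinh u)
    (f' := fun v => v * sinh v) (by simp) (fun v _ => ?_)
    (fun v hv => mul_nonneg hv.le (sinh_nonneg_iff.2 hv.le)) hu
  refine (((hasDerivAt_id v).fun_mul (hasDerivAt_cosh v)).fun_sub
    (hasDerivAt_sinh v)).congr_deriv ?_
  simp only [id]
  ring

theorem lambert_two {u : ℝ} (hu : 0 ≤ u) : 3 * u * cosh u ≤ (3 + u ^ 2) * sinh u := by
  rw [← sub_nonneg]
  refine nonneg_of_hasDerivAt_nonneg (f := fun u => (3 + u ^ 2) * sinh u - 3 * u * cosh u)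
    (f' := fun v => v * (v * cosh v - sinh v)) (by simp) (fun v _ => ?_)
    (fun v hv => mul_nonneg hv.le (sub_nonneg.2 (sinh_le_mul_cosh hv.le))) hu
  refine (((((hasDerivAt_id v).fun_pow 2).const_add 3).fun_mul (hasDerivAt_sinh v)).fun_sub
    (((hasDerivAt_id v).const_mul 3).fun_mul (hasDerivAt_cosh v))).congr_deriv ?_
  simp only [id]
  push_cast
  ring

theorem lambert_three {u : ℝ} (hu : 0 ≤ u) :
    (15 + 6 * u ^ 2) * sinh u ≤ (15 * u + u ^ 3) * cosh u := by
  rw [← sub_nonneg]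
  refine nonneg_of_hasDerivAt_nonneg
    (f := fun u => (15 * u + u ^ 3) * cosh u - (15 + 6 * u ^ 2) * sinh u)
    (f' := fun v => v * ((3 + v ^ 2) * sinh v - 3 * v * cosh v)) (by simp) (fun v _ => ?_)
    (fun v hv => mul_nonneg hv.le (sub_nonneg.2 (lambert_two hv.le))) hu
  refine (((((hasDerivAt_id v).const_mul 15).fun_add ((hasDerivAt_id v).fun_pow 3)).fun_mul
    (hasDerivAt_cosh v)).fun_sub (((((hasDerivAt_id v).fun_pow 2).const_mul 6).const_add
    15).fun_mul (hasDerivAt_sinh v))).congr_deriv ?_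
  simp only [id]
  push_cast
  ring

theorem lambert_four {u : ℝ} (hu : 0 ≤ u) :
    (105 * u + 10 * u ^ 3) * cosh u ≤ (105 + 45 * u ^ 2 + u ^ 4) * sinh u := by
  rw [← sub_nonneg]
  refine nonneg_of_hasDerivAt_nonneg
    (f := fun u => (105 + 45 * u ^ 2 + u ^ 4) * sinh u - (105 * u + 10 * u ^ 3) * cosh u)
    (f' := fun v => v * ((15 * v + v ^ 3) * cosh v - (15 + 6 * v ^ 2) * sinh v)) (by simp)
    (fun v _ => ?_) (fun v hv => mul_nonneg hv.le (sub_nonneg.2 (lambert_three hv.le))) hu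
  refine (((((((hasDerivAt_id v).fun_pow 2).const_mul 45).const_add 105).fun_add
    ((hasDerivAt_id v).fun_pow 4)).fun_mul (hasDerivAt_sinh v)).fun_sub
    ((((hasDerivAt_id v).const_mul 105).fun_add
    (((hasDerivAt_id v).fun_pow 3).const_mul 10)).fun_mul (hasDerivAt_cosh v))).congr_deriv ?_
  simp only [id]
  push_cast
  ring

theorem lambert_five {u : ℝ} (hu : 0 ≤ u) :
    (945 + 420 * u ^ 2 + 15 * u ^ 4) * sinh u ≤ (945 * u + 105 * u ^ 3 + u ^ 5) * cosh u := by
  rw [← sub_nonneg]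
  refine nonneg_of_hasDerivAt_nonneg
    (f := fun u => (945 * u + 105 * u ^ 3 + u ^ 5) * cosh u -
      (945 + 420 * u ^ 2 + 15 * u ^ 4) * sinh u)
    (f' := fun v => v * ((105 + 45 * v ^ 2 + v ^ 4) * sinh v - (105 * v + 10 * v ^ 3) * cosh v))
    (by simp) (fun v _ => ?_)
    (fun v hv => mul_nonneg hv.le (sub_nonneg.2 (lambert_four hv.le))) hu
  refine ((((((hasDerivAt_id v).const_mul 945).fun_add
    (((hasDerivAt_id v).fun_pow 3).const_mul 105)).fun_add
    ((hasDerivAt_id v).fun_pow 5)).fun_mul (hasDerivAt_cosh v)).fun_sub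
    ((((((hasDerivAt_id v).fun_pow 2).const_mul 420).const_add 945).fun_add
    (((hasDerivAt_id v).fun_pow 4).const_mul 15)).fun_mul (hasDerivAt_sinh v))).congr_deriv ?_
  simp only [id]
  push_cast
  ring

theorem cosh_mul_sub_cube_le {z : ℝ} (hz : 0 ≤ z) : cosh z * (z - z ^ 3 / 3) ≤ sinh z := by
  rw [← sub_nonneg]
  refine nonneg_of_hasDerivAt_nonneg (f := fun z => sinh z - cosh z * (z - z ^ 3 / 3))
    (f' := fun z => z * (z * cosh z - sinh z) + z ^ 3 / 3 * sinh z) (by simp)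
    (fun v _ => ?_) (fun v hv => ?_) hz
  · refine ((hasDerivAt_sinh v).fun_sub ((hasDerivAt_cosh v).fun_mul
      ((hasDerivAt_id v).fun_sub (((hasDerivAt_id v).fun_pow 3).div_const 3)))).congr_deriv ?_
    simp only [id]
    push_cast
    ring
  · have := sinh_pos_iff.2 hv
    exact add_nonneg (mul_nonneg hv.le (sub_nonneg.2 (sinh_le_mul_cosh hv.le))) (by positivity)

end LambertConvergents

section LogarithmicThreshold

theorem hasDerivAt_sinh_mul (s u : ℝ) :
    HasDerivAt (fun u => sinh (s * u)) (s * cosh (s * u)) u :=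
  ((hasDerivAt_const_mul s).sinh).congr_deriv (mul_comm _ _)

theorem hasDerivAt_cosh_mul (s u : ℝ) :
    HasDerivAt (fun u => cosh (s * u)) (s * sinh (s * u)) u :=
  ((hasDerivAt_const_mul s).cosh).congr_deriv (mul_comm _ _)

/-- The denominator of the quotient which `L ≤ λ_s`, restricted to the pairs `(e⁻ᵘ, eᵘ)`,
compares with `cosh u ^ s`. -/
noncomputable def logDen (s u : ℝ) : ℝ := (1 - s) * u * cosh u + (1 + s) * sinh u

/-- The numerator of the quotient which `L ≤ λ_s`, restricted to the pairs `(e⁻ᵘ, eᵘ)`,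
compares with `cosh u ^ s`. -/
noncomputable def logNum (s u : ℝ) : ℝ :=
  cosh (s * u) * logDen s u + (1 - s) * u * sinh u * sinh (s * u)

theorem logDen_pos {s u : ℝ} (hs0 : 0 < s) (hs1 : s < 1) (hu : 0 < u) : 0 < logDen s u := by
  have := sinh_pos_iff.2 hu
  have := cosh_pos u
  have : 0 < 1 - s := sub_pos.2 hs1
  unfold logDen
  positivity

theorem logNum_pos {s u : ℝ} (hs0 : 0 < s) (hs1 : s < 1) (hu : 0 < u) : 0 < logNum s u := by
  have hden := logDen_pos hs0 hs1 hu
  have := sinh_pos_iff.2 hu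
  have := sinh_pos_iff.2 (mul_pos hs0 hu)
  have := cosh_pos (s * u)
  have : 0 < 1 - s := sub_pos.2 hs1
  unfold logNum
  positivity

theorem meanL_le_lambdaMean_exp_iff {s u : ℝ} (hs0 : 0 < s) (hs1 : s < 1) (hu : 0 < u) :
    meanL (exp (-u)) (exp u) ≤ lambdaMean s (exp (-u)) (exp u) ↔
      cosh u ^ s * logDen s u ≤ logNum s u := by
  rw [le_lambdaMean_exp_iff hu, meanL_exp hu, jensenBar_fPow_exp hs0.ne' hs1.ne,
    jensenBar_fPow_exp (by linarith) (by linarith), show (s + 1) * u = u + s * u by ring,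
    cosh_add, rpow_add_one (cosh_pos u).ne', ← sub_nonneg,
    ← sub_nonneg (b := cosh u ^ s * _)]
  obtain ⟨q, rfl⟩ : ∃ q, s = 1 - q := ⟨1 - s, by ring⟩
  have hq : 0 < q := by linarith
  have hq' : 2 - q ≠ 0 := by linarith
  have hdiff : 2 * (cosh u * cosh ((1 - q) * u) + sinh u * sinh ((1 - q) * u) -
        cosh u ^ (1 - q) * cosh u) / ((1 - q + 1) * (1 - q + 1 - 1)) -
      sinh u / u * (2 * (cosh ((1 - q) * u) - cosh u ^ (1 - q)) / ((1 - q) * (1 - q - 1))) =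
      2 / ((2 - q) * (1 - q) * q * u) *
        (logNum (1 - q) u - cosh u ^ (1 - q) * logDen (1 - q) u) := by
    have hs := hs0.ne'
    rw [show 1 - q + 1 = 2 - q by ring, show 2 - q - 1 = 1 - q by ring,
      show 1 - q - 1 = -q by ring, logNum, logDen]
    generalize cosh u ^ (1 - q) = X
    generalize cosh ((1 - q) * u) = C
    generalize sinh ((1 - q) * u) = Z
    field_simp
    ring
  rw [hdiff]
  have h2q : 0 < 2 - q := by linarith
  exact mul_nonneg_iff_of_pos_left (by positivity)

theorem hasDerivAt_logDen (s u : ℝ) :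
    HasDerivAt (logDen s) (2 * cosh u + (1 - s) * u * sinh u) u := by
  refine (((hasDerivAt_const_mul (1 - s)).fun_mul (hasDerivAt_cosh u)).fun_add
    ((hasDerivAt_sinh u).const_mul (1 + s))).congr_deriv ?_
  ring

theorem hasDerivAt_logNum (s u : ℝ) :
    HasDerivAt (logNum s) (s * sinh (s * u) * logDen s u +
      cosh (s * u) * (2 * cosh u + (1 - s) * u * sinh u) +
      (1 - s) * ((sinh u + u * cosh u) * sinh (s * u) + s * u * sinh u * cosh (s * u))) u := by
  refine (((hasDerivAt_cosh_mul s u).fun_mul (hasDerivAt_logDen s u)).fun_add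
    (((hasDerivAt_const_mul (1 - s)).fun_mul (hasDerivAt_sinh u)).fun_mul
    (hasDerivAt_sinh_mul s u))).congr_deriv ?_
  ring

theorem tendsto_logNum_div_logDen (s : ℝ) :
    Tendsto (fun u => logNum s u / logDen s u) (𝓝[>] 0) (𝓝 1) := by
  have hcosh := tendsto_cosh_nhdsGT_zero
  have hcosh' : Tendsto (fun u => cosh (s * u)) (𝓝[>] 0) (𝓝 1) :=
    ((continuous_cosh.comp (continuous_const_mul s)).tendsto' 0 1 (by simp)).mono_left
      nhdsWithin_le_nhds
  have hsinh' : Tendsto (fun u => sinh (s * u)) (𝓝[>] 0) (𝓝 0) :=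
    ((continuous_sinh.comp (continuous_const_mul s)).tendsto' 0 0 (by simp)).mono_left
      nhdsWithin_le_nhds
  have hsinh : Tendsto sinh (𝓝[>] 0) (𝓝 0) :=
    (continuous_sinh.tendsto' 0 0 sinh_zero).mono_left nhdsWithin_le_nhds
  have hden : Tendsto (fun u => (1 - s) * cosh u + (1 + s) * (sinh u / u)) (𝓝[>] 0) (𝓝 2) := by
    have := (hcosh.const_mul (1 - s)).add (tendsto_sinh_div_self.const_mul (1 + s))
    rwa [show (1 - s) * 1 + (1 + s) * 1 = (2 : ℝ) by ring] at this
  have hquot := ((hcosh'.mul hden).add ((hsinh.const_mul (1 - s)).mul hsinh')).div hden two_ne_zero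
  rw [show ((1 : ℝ) * 2 + (1 - s) * 0 * 0) / 2 = 1 by norm_num] at hquot
  refine hquot.congr' ?_
  filter_upwards [self_mem_nhdsWithin] with u hu
  have hu : u ≠ 0 := (mem_Ioi.1 hu).ne'
  have hDen : logDen s u = u * ((1 - s) * cosh u + (1 + s) * (sinh u / u)) := by
    unfold logDen
    field_simp
  simp only [Pi.div_apply]
  rw [logNum, hDen, ← mul_div_mul_left _ _ hu]
  congr 1
  ring

end LogarithmicThreshold

section LogarithmicSmall

/-- The coefficient of `sinh (s * u)` in the derivative of
`log (logNum s u / logDen s u) - s * log (cosh u)`, up to a positive factor, as a polynomial in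
`U = u ^ 2` and `h = u * cosh u / sinh u`. -/
def logDerivCoeff (s U h : ℝ) : ℝ :=
  s * h * ((1 - s) * h + (1 + s)) ^ 2 + (1 - s) * h * ((1 - s) * (h ^ 2 - U) + (1 + s)) -
    s * (1 - s) * U * ((1 - s) * h + (1 + s))

theorem logDerivCoeff_convergent {U k s : ℝ} (hU : 0 ≤ U) (hU' : U ≤ 9 / 4)
    (hk : k = (945 + 420 * U + 15 * U ^ 2) / (945 + 105 * U + U ^ 2)) (hs : s = 9 / 100) :
    (1 + s) * ((1 - s) * k + (1 + s)) ≤ (1 - s ^ 2 * U / 3) * logDerivCoeff s U k := by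
  have : 0 ≤ 9 / 4 - U := by linarith
  have : 0 < 945 + 105 * U + U ^ 2 := by positivity
  rw [← sub_nonneg]
  have hform : (1 - s ^ 2 * U / 3) * logDerivCoeff s U k - (1 + s) * ((1 - s) * k + (1 + s)) =
      U * (1741935104 / 10125 * (9 / 4 - U) ^ 7 +
        28039053616 / 28125 * U * (9 / 4 - U) ^ 6 +
        15248236857994 / 6328125 * U ^ 2 * (9 / 4 - U) ^ 5 +
        98675465736421 / 31640625 * U ^ 3 * (9 / 4 - U) ^ 4 +
        2906076309794021 / 1265625000 * U ^ 4 * (9 / 4 - U) ^ 3 +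
        2357526411899057 / 2531250000 * U ^ 5 * (9 / 4 - U) ^ 2 +
        7215326736204989 / 40500000000 * U ^ 6 * (9 / 4 - U) +
        3649705070304701 / 405000000000 * U ^ 7) / (945 + 105 * U + U ^ 2) ^ 3 := by
    rw [logDerivCoeff, hk, hs]
    field_simp
    ring
  rw [hform]
  positivity

theorem logDerivCoeff_sub_mono {U h k s : ℝ} (hU : U ≤ 9 / 4) (hk : 1 ≤ k)
    (hkh : k ≤ h) (hs : s = 9 / 100) :
    (1 - s ^ 2 * U / 3) * logDerivCoeff s U k - (1 + s) * ((1 - s) * k + (1 + s)) ≤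
      (1 - s ^ 2 * U / 3) * logDerivCoeff s U h - (1 + s) * ((1 - s) * h + (1 + s)) := by
  have hslope : 6 / 5 ≤ (1 - s) ^ 2 * (1 + s) * (h ^ 2 + h * k + k ^ 2 - U) +
      2 * s * (1 - s ^ 2) * (h + k) + s * (1 + s) ^ 2 + (1 - s ^ 2) := by
    have : 3 / 4 ≤ h ^ 2 + h * k + k ^ 2 - U := by nlinarith
    rw [hs]
    nlinarith
  have hfactor : 99 / 100 ≤ 1 - s ^ 2 * U / 3 := by
    rw [hs]
    linarith
  have hquot : 1 - s ^ 2 ≤ (1 - s ^ 2 * U / 3) * ((1 - s) ^ 2 * (1 + s) *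
      (h ^ 2 + h * k + k ^ 2 - U) + 2 * s * (1 - s ^ 2) * (h + k) + s * (1 + s) ^ 2 +
      (1 - s ^ 2)) := by
    have := mul_le_mul hfactor hslope (by norm_num) (by linarith)
    nlinarith [sq_nonneg s]
  have := mul_nonneg (sub_nonneg.2 hkh) (sub_nonneg.2 hquot)
  unfold logDerivCoeff
  linarith

theorem le_logDerivCoeff {U h s : ℝ} (hU : 0 ≤ U) (hU' : U ≤ 9 / 4)
    (hh : (945 + 420 * U + 15 * U ^ 2) / (945 + 105 * U + U ^ 2) ≤ h) (hs : s = 9 / 100) :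
    (1 + s) * ((1 - s) * h + (1 + s)) ≤ (1 - s ^ 2 * U / 3) * logDerivCoeff s U h := by
  have hone : 1 ≤ (945 + 420 * U + 15 * U ^ 2) / (945 + 105 * U + U ^ 2) := by
    rw [le_div_iff₀ (by positivity)]
    nlinarith [sq_nonneg U]
  have hmono := logDerivCoeff_sub_mono hU' hone hh hs
  have hconv := logDerivCoeff_convergent hU hU' rfl hs
  linarith

theorem cosh_mul_le_sinh_mul_logDerivCoeff {u s h : ℝ} (hu : 0 < u) (hu' : u ≤ 3 / 2)
    (hs : s = 9 / 100) (hh : h = u * cosh u / sinh u) :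
    cosh (s * u) * (s * (1 + s) * u * ((1 - s) * h + (1 + s))) ≤
      sinh (s * u) * logDerivCoeff s (u ^ 2) h := by
  have hsinh := sinh_pos_iff.2 hu
  have hU : u ^ 2 ≤ 9 / 4 := by nlinarith
  have hconv : (945 + 420 * u ^ 2 + 15 * (u ^ 2) ^ 2) / (945 + 105 * u ^ 2 + (u ^ 2) ^ 2) ≤ h := by
    rw [hh, div_le_div_iff₀ (by positivity) hsinh]
    linarith [lambert_five hu.le]
  have hcoeff := le_logDerivCoeff (sq_nonneg u) hU hconv hs
  have : 0 < s := by rw [hs]; norm_num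
  have hs1 : 0 < 1 - s := by rw [hs]; norm_num
  have hh0 : 0 < h := by rw [hh]; have := cosh_pos u; positivity
  have hfactor : 0 < 1 - s ^ 2 * u ^ 2 / 3 := by rw [hs]; linarith
  have hcoeff0 : 0 ≤ logDerivCoeff s (u ^ 2) h :=
    nonneg_of_mul_nonneg_right ((by positivity : (0 : ℝ) ≤ _).trans hcoeff) hfactor
  have := cosh_pos (s * u)
  calc cosh (s * u) * (s * (1 + s) * u * ((1 - s) * h + (1 + s)))
      = cosh (s * u) * (s * u) * ((1 + s) * ((1 - s) * h + (1 + s))) := by ring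
    _ ≤ cosh (s * u) * (s * u) * ((1 - s ^ 2 * u ^ 2 / 3) * logDerivCoeff s (u ^ 2) h) :=
        mul_le_mul_of_nonneg_left hcoeff (by positivity)
    _ = cosh (s * u) * (s * u - (s * u) ^ 3 / 3) * logDerivCoeff s (u ^ 2) h := by ring
    _ ≤ sinh (s * u) * logDerivCoeff s (u ^ 2) h :=
        mul_le_mul_of_nonneg_right (cosh_mul_sub_cube_le (by positivity)) hcoeff0

theorem hasDerivAt_log_logNum_div_logDen {s u : ℝ} (hs0 : 0 < s) (hs1 : s < 1) (hu : 0 < u) :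
    HasDerivAt (fun u => log (logNum s u / logDen s u) - s * log (cosh u))
      (sinh u ^ 3 * (sinh (s * u) * logDerivCoeff s (u ^ 2) (u * cosh u / sinh u) -
        cosh (s * u) * (s * (1 + s) * u * ((1 - s) * (u * cosh u / sinh u) + (1 + s)))) /
        (u * cosh u * logNum s u * logDen s u)) u := by
  have hden := (logDen_pos hs0 hs1 hu).ne'
  have hnum := (logNum_pos hs0 hs1 hu).ne'
  have hcosh := (cosh_pos u).ne'
  have hsinh := (sinh_pos_iff.2 hu).ne'
  refine ((((hasDerivAt_logNum s u).fun_div (hasDerivAt_logDen s u) hden).log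
    (div_ne_zero hnum hden)).fun_sub ((hasDerivAt_log_cosh u).const_mul s)).congr_deriv ?_
  have hwronskian : ((s * sinh (s * u) * logDen s u +
      cosh (s * u) * (2 * cosh u + (1 - s) * u * sinh u) +
      (1 - s) * ((sinh u + u * cosh u) * sinh (s * u) + s * u * sinh u * cosh (s * u))) *
        logDen s u - logNum s u * (2 * cosh u + (1 - s) * u * sinh u)) * cosh u * u -
      s * sinh u * u * logNum s u * logDen s u =
      sinh u ^ 3 * (sinh (s * u) * logDerivCoeff s (u ^ 2) (u * cosh u / sinh u) -
        cosh (s * u) * (s * (1 + s) * u * ((1 - s) * (u * cosh u / sinh u) + (1 + s)))) := by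
    unfold logDerivCoeff logNum logDen
    field_simp
    ring
  rw [tanh_eq_sinh_div_cosh, ← hwronskian]
  field_simp

theorem cosh_rpow_mul_logDen_le_of_le_three_halves {u s : ℝ} (hu : 0 < u) (hu' : u ≤ 3 / 2)
    (hs : s = 9 / 100) : cosh u ^ s * logDen s u ≤ logNum s u := by
  have hs0 : 0 < s := by rw [hs]; norm_num
  have hs1 : s < 1 := by rw [hs]; norm_num
  have hden := logDen_pos hs0 hs1 hu
  have hcosh := cosh_pos u
  have hlim : Tendsto (fun u => log (logNum s u / logDen s u) - s * log (cosh u))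
      (𝓝[>] 0) (𝓝 0) := by
    have := ((tendsto_logNum_div_logDen s).log one_ne_zero).sub
      ((tendsto_cosh_nhdsGT_zero.log one_ne_zero).const_mul s)
    rwa [log_one, mul_zero, sub_zero] at this
  have hlog := le_of_tendsto_of_hasDerivAt_nonneg hu hlim
    (fun v hv => hasDerivAt_log_logNum_div_logDen hs0 hs1 hv.1) fun v hv => by
      have hv0 : 0 < v := hv.1
      have := cosh_pos v
      have := sinh_pos_iff.2 hv0
      have hnum := logNum_pos hs0 hs1 hv0
      have hden := logDen_pos hs0 hs1 hv0
      have hle := cosh_mul_le_sinh_mul_logDerivCoeff hv0 (hv.2.le.trans hu') hs rfl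
      exact div_nonneg (mul_nonneg (by positivity) (sub_nonneg.2 hle)) (by positivity)
  rw [← le_div_iff₀ hden, ← log_le_log_iff (by positivity)
    (div_pos (logNum_pos hs0 hs1 hu) hden), log_rpow hcosh]
  linarith

end LogarithmicSmall

section ExpNeg

theorem neg_one_pow_mul_exp_neg_sub_sum_nonneg (n : ℕ) {z : ℝ} (hz : 0 ≤ z) :
    0 ≤ (-1) ^ n * (exp (-z) - ∑ i ∈ Finset.range n, (-z) ^ i / i.factorial) := by
  induction n generalizing z with
  | zero => simp [exp_nonneg]
  | succ n ih =>
    refine nonneg_of_hasDerivAt_nonneg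
      (f := fun z => (-1) ^ (n + 1) *
        (exp (-z) - ∑ i ∈ Finset.range (n + 1), (-z) ^ i / i.factorial))
      (f' := fun z => (-1) ^ n * (exp (-z) - ∑ i ∈ Finset.range n, (-z) ^ i / i.factorial))
      ?_ (fun x _ => ?_) (fun x hx => ih hx.le) hz
    · simp [Finset.sum_range_succ']
    · have hsum : HasDerivAt (fun z : ℝ => ∑ i ∈ Finset.range (n + 1), (-z) ^ i / i.factorial)
          (∑ i ∈ Finset.range (n + 1), (i * (-x) ^ (i - 1) * (-1)) / i.factorial) x :=
        HasDerivAt.fun_sum fun i _ => ((hasDerivAt_neg x).fun_pow i).div_const _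
      have hshift : ∑ i ∈ Finset.range (n + 1), ((i : ℝ) * (-x) ^ (i - 1) * (-1)) / i.factorial =
          -∑ i ∈ Finset.range n, (-x) ^ i / i.factorial := by
        rw [Finset.sum_range_succ', ← Finset.sum_neg_distrib]
        simp only [Nat.cast_zero, zero_mul, zero_div, add_zero]
        refine Finset.sum_congr rfl fun i _ => ?_
        rw [Nat.factorial_succ]
        push_cast
        field_simp
      refine ((((hasDerivAt_neg x).exp).fun_sub hsum).const_mul ((-1) ^ (n + 1))).congr_deriv ?_
      rw [hshift]
      ring

theorem exp_neg_le_quadratic {z : ℝ} (hz : 0 ≤ z) : exp (-z) ≤ 1 - z + z ^ 2 / 2 := by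
  have := neg_one_pow_mul_exp_neg_sub_sum_nonneg 3 hz
  simp only [Finset.sum_range_succ, Finset.sum_range_zero, Nat.factorial] at this
  norm_num at this
  linarith

theorem cubic_le_exp_neg {z : ℝ} (hz : 0 ≤ z) : 1 - z + z ^ 2 / 2 - z ^ 3 / 6 ≤ exp (-z) := by
  have := neg_one_pow_mul_exp_neg_sub_sum_nonneg 4 hz
  simp only [Finset.sum_range_succ, Finset.sum_range_zero, Nat.factorial] at this
  norm_num at this
  linarith

theorem exp_neg_le_quartic {z : ℝ} (hz : 0 ≤ z) :
    exp (-z) ≤ 1 - z + z ^ 2 / 2 - z ^ 3 / 6 + z ^ 4 / 24 := by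
  have := neg_one_pow_mul_exp_neg_sub_sum_nonneg 5 hz
  simp only [Finset.sum_range_succ, Finset.sum_range_zero, Nat.factorial] at this
  norm_num at this
  linarith

theorem quintic_le_exp_neg {z : ℝ} (hz : 0 ≤ z) :
    1 - z + z ^ 2 / 2 - z ^ 3 / 6 + z ^ 4 / 24 - z ^ 5 / 120 ≤ exp (-z) := by
  have := neg_one_pow_mul_exp_neg_sub_sum_nonneg 6 hz
  simp only [Finset.sum_range_succ, Finset.sum_range_zero, Nat.factorial] at this
  norm_num at this
  linarith

theorem exp_neg_natCast_le (n : ℕ) : exp (-(n : ℝ)) ≤ 0.3678794412 ^ n := by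
  rw [show -(n : ℝ) = n * -1 by ring, exp_nat_mul]
  exact pow_le_pow_left₀ (exp_nonneg _) exp_neg_one_lt_d9.le n

theorem cosh_eq_exp_mul (u : ℝ) : cosh u = exp u * ((1 + exp (-2 * u)) / 2) := by
  rw [cosh_eq, show -2 * u = -u + -u by ring, exp_add, exp_neg]
  field_simp

theorem sinh_eq_exp_mul (u : ℝ) : sinh u = exp u * ((1 - exp (-2 * u)) / 2) := by
  rw [sinh_eq, show -2 * u = -u + -u by ring, exp_add, exp_neg]
  field_simp

theorem cosh_rpow_eq (s u : ℝ) :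
    cosh u ^ s = exp (s * u) * (2 ^ (-s) * (1 + exp (-2 * u)) ^ s) := by
  rw [cosh_eq_exp_mul, mul_rpow (exp_nonneg _) (by positivity),
    div_rpow (by positivity) zero_le_two, ← exp_mul, rpow_neg zero_le_two, mul_comm u s]
  ring

end ExpNeg

section LogarithmicLarge

theorem cosh_rpow_mul_logDen_le_of_exp {s u K p y E : ℝ} (hu : 0 < u) (hs0 : 0 < s)
    (hs1 : s < 1) (hK : 2 ^ (-s) ≤ K) (hp : p = (1 - s) * u) (hy : y = exp (-2 * u))
    (hE : E = exp (-2 * (s * u)))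
    (h : K * (1 + s * y) * (p * (1 + y) + (1 + s) * (1 - y)) ≤
      p * (1 + E * y) + (1 + s) * (1 - y) * (1 + E) / 2) :
    cosh u ^ s * logDen s u ≤ logNum s u := by
  have hy0 : 0 < y := by rw [hy]; positivity
  have hy1 : y < 1 := by rw [hy, exp_lt_one_iff]; linarith
  have hden : 0 ≤ p * (1 + y) + (1 + s) * (1 - y) := by
    have hp0 : 0 ≤ p := hp ▸ mul_nonneg (by linarith) hu.le
    have : 0 < 1 - y := by linarith
    positivity
  have hbernoulli : (1 + y) ^ s ≤ 1 + s * y :=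
    rpow_one_add_le_one_add_mul_self (by linarith) hs0.le hs1.le
  have hK0 : 0 ≤ K := (rpow_nonneg zero_le_two _).trans hK
  have hpow : 2 ^ (-s) * (1 + y) ^ s ≤ K * (1 + s * y) := by gcongr
  have hle := mul_le_mul_of_nonneg_left ((mul_le_mul_of_nonneg_right hpow hden).trans h)
    (show 0 ≤ exp (s * u) * exp u / 2 by positivity)
  rw [logNum, logDen, cosh_rpow_eq, cosh_eq_exp_mul u, sinh_eq_exp_mul u,
    cosh_eq_exp_mul (s * u), sinh_eq_exp_mul (s * u), ← hy, ← hE, ← hp]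
  linarith

theorem exp_bound_of_le {s K p y z Y E e : ℝ} (hs : 0 ≤ s) (hK : 1 ≤ K * (1 + s))
    (hp : 1 + s ≤ p) (hy : 0 ≤ y) (hyz : y ≤ z) (hyY : y ≤ Y) (heE : e ≤ E) (hE : E ≤ 1)
    (h : 0 ≤ p + (1 + s) * (1 + e) / 2 - K * (p + (1 + s)) +
      z * (p * e - (1 + s) * (1 + e) / 2 - K * (p - (1 + s) + s * (p + (1 + s))) -
        K * s * Y * (p - (1 + s)))) :
    K * (1 + s * y) * (p * (1 + y) + (1 + s) * (1 - y)) ≤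
      p * (1 + E * y) + (1 + s) * (1 - y) * (1 + E) / 2 := by
  have hK0 : 0 ≤ K := by by_contra! hK0; nlinarith
  have hp' : 0 ≤ p - (1 + s) := sub_nonneg.2 hp
  have hY : 0 ≤ Y := hy.trans hyY
  have hslope : p * e - (1 + s) * (1 + e) / 2 - K * (p - (1 + s) + s * (p + (1 + s))) -
      K * s * Y * (p - (1 + s)) ≤ 0 := by
    have he : 0 ≤ (1 - e) * (p - (1 + s) / 2) := mul_nonneg (by linarith) (by linarith)
    have hquad : 0 ≤ K * s * Y * (p - (1 + s)) := by positivity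
    have hlin : 0 ≤ (K * (1 + s) - 1) * (p - (1 + s)) := mul_nonneg (by linarith) hp'
    have hconst : 0 ≤ K * s * (2 * (1 + s)) := by positivity
    linarith
  have hzy := mul_nonneg_of_nonpos_of_nonpos (sub_nonpos.2 hyz) hslope
  have hEe : 0 ≤ (E - e) * ((1 + s) / 2 + y * (p - (1 + s) / 2)) :=
    mul_nonneg (by linarith) (add_nonneg (by linarith) (mul_nonneg hy (by linarith)))
  have hYy : 0 ≤ K * s * (p - (1 + s)) * (y * (Y - y)) := by
    have : 0 ≤ Y - y := sub_nonneg.2 hyY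
    positivity
  linarith

theorem two_rpow_neg_nine_div_hundred_le : (2 : ℝ) ^ (-(9 / 100) : ℝ) ≤ 18791 / 20000 := by
  have hlog : log 2 * -(9 / 100) ≤ -0.06238 := by linarith [log_two_gt_d9]
  rw [rpow_def_of_pos two_pos]
  exact (exp_le_exp.2 hlog).trans ((exp_neg_le_quartic (by norm_num)).trans (by norm_num))

theorem cosh_rpow_mul_logDen_le_of_taylor {n : ℕ} {u x s e Y : ℝ} (hs : s = 9 / 100) (hn : 3 ≤ n)
    (hx : 0 ≤ x) (hu : u = (n + x) / 2) (hY : 0.3678794412 ^ n ≤ Y) (he0 : 0 ≤ e)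
    (he : e ≤ 1 - s * n + (s * n) ^ 2 / 2 - (s * n) ^ 3 / 6 + (s * n) ^ 4 / 24 -
      (s * n) ^ 5 / 120)
    (h : ∀ p, p = (1 - s) * u →
      0 ≤ p + (1 + s) * (1 + e * (1 - s * x + (s * x) ^ 2 / 2 - (s * x) ^ 3 / 6)) / 2 -
        18791 / 20000 * (p + (1 + s)) + Y * (1 - x + x ^ 2 / 2 - x ^ 3 / 6 + x ^ 4 / 24) *
        (p * (e * (1 - s * x + (s * x) ^ 2 / 2 - (s * x) ^ 3 / 6)) -
          (1 + s) * (1 + e * (1 - s * x + (s * x) ^ 2 / 2 - (s * x) ^ 3 / 6)) / 2 -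
          18791 / 20000 * (p - (1 + s) + s * (p + (1 + s))) -
          18791 / 20000 * s * Y * (p - (1 + s)))) :
    cosh u ^ s * logDen s u ≤ logNum s u := by
  have hn' : (3 : ℝ) ≤ n := by exact_mod_cast hn
  have hs0 : 0 < s := by rw [hs]; norm_num
  have hYn : exp (-(n : ℝ)) ≤ Y := (exp_neg_natCast_le n).trans hY
  have hY0 : 0 ≤ Y := (exp_nonneg _).trans hYn
  have hy : exp (-2 * u) = exp (-(n : ℝ)) * exp (-x) := by
    rw [hu, ← exp_add]
    ring_nf
  have hE : exp (-2 * (s * u)) = exp (-(s * n)) * exp (-(s * x)) := by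
    rw [hu, ← exp_add]
    ring_nf
  refine cosh_rpow_mul_logDen_le_of_exp (K := 18791 / 20000) (by linarith) hs0
    (by rw [hs]; norm_num) (hs ▸ two_rpow_neg_nine_div_hundred_le) rfl rfl rfl
    (exp_bound_of_le hs0.le (by rw [hs]; norm_num) (by rw [hs]; linarith) (exp_nonneg _) ?_ ?_ ?_
      ?_ (h _ rfl))
  · rw [hy]
    exact mul_le_mul hYn (exp_neg_le_quartic hx) (exp_nonneg _) hY0
  · rw [hy]
    exact (mul_le_of_le_one_right (exp_nonneg _) (exp_le_one_iff.2 (by linarith))).trans hYn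
  · rw [hE]
    exact (mul_le_mul_of_nonneg_left (cubic_le_exp_neg (by positivity)) he0).trans
      (mul_le_mul_of_nonneg_right (he.trans (quintic_le_exp_neg (by positivity)))
        (exp_nonneg _))
  · rw [exp_le_one_iff, hu]
    have : 0 ≤ s * ((n + x) / 2) := by positivity
    linarith

theorem cosh_rpow_mul_logDen_le_of_le_seven_halves {u s : ℝ} (hs : s = 9 / 100) (hu : 3 / 2 ≤ u)
    (hu' : u ≤ 7 / 2) : cosh u ^ s * logDen s u ≤ logNum s u := by
  have hbernstein : ∀ {x : ℝ}, 0 ≤ x → x ≤ 1 → ∀ k m : ℕ, 0 ≤ x ^ k * (1 - x) ^ m :=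
    fun hx hx' k m => mul_nonneg (pow_nonneg hx k) (pow_nonneg (sub_nonneg.2 hx') m)
  rcases le_total u 2 with h2 | h2
  · obtain ⟨x, rfl⟩ : ∃ x, u = (3 + x) / 2 := ⟨2 * u - 3, by ring⟩
    have hB := hbernstein (x := x) (by linarith) (by linarith)
    refine cosh_rpow_mul_logDen_le_of_taylor (n := 3) (x := x) (e := 7633 / 10000) (Y := 249 / 5000)
      hs (by norm_num) (by linarith) (by push_cast; rfl) (by norm_num) (by norm_num)
      (by rw [hs]; norm_num) fun p hp => ?_
    rw [hp, hs]
    linarith [hB 0 8, hB 1 7, hB 2 6, hB 3 5, hB 4 4, hB 5 3, hB 6 2, hB 7 1, hB 8 0]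
  rcases le_total u (5 / 2) with h3 | h3
  · obtain ⟨x, rfl⟩ : ∃ x, u = (4 + x) / 2 := ⟨2 * u - 4, by ring⟩
    have hB := hbernstein (x := x) (by linarith) (by linarith)
    refine cosh_rpow_mul_logDen_le_of_taylor (n := 4) (x := x) (e := 436 / 625) (Y := 229 / 12500)
      hs (by norm_num) (by linarith) (by push_cast; rfl) (by norm_num) (by norm_num)
      (by rw [hs]; norm_num) fun p hp => ?_
    rw [hp, hs]
    linarith [hB 0 8, hB 1 7, hB 2 6, hB 3 5, hB 4 4, hB 5 3, hB 6 2, hB 7 1, hB 8 0]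
  rcases le_total u 3 with h4 | h4
  · obtain ⟨x, rfl⟩ : ∃ x, u = (5 + x) / 2 := ⟨2 * u - 5, by ring⟩
    have hB := hbernstein (x := x) (by linarith) (by linarith)
    refine cosh_rpow_mul_logDen_le_of_taylor (n := 5) (x := x) (e := 797 / 1250)
      (Y := 3369 / 500000)
      hs (by norm_num) (by linarith) (by push_cast; rfl) (by norm_num) (by norm_num)
      (by rw [hs]; norm_num) fun p hp => ?_
    rw [hp, hs]
    linarith [hB 0 8, hB 1 7, hB 2 6, hB 3 5, hB 4 4, hB 5 3, hB 6 2, hB 7 1, hB 8 0]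
  · obtain ⟨x, rfl⟩ : ∃ x, u = (6 + x) / 2 := ⟨2 * u - 6, by ring⟩
    have hB := hbernstein (x := x) (by linarith) (by linarith)
    refine cosh_rpow_mul_logDen_le_of_taylor (n := 6) (x := x) (e := 5827 / 10000) (Y := 31 / 12500)
      hs (by norm_num) (by linarith) (by push_cast; rfl) (by norm_num) (by norm_num)
      (by rw [hs]; norm_num) fun p hp => ?_
    rw [hp, hs]
    linarith [hB 0 8, hB 1 7, hB 2 6, hB 3 5, hB 4 4, hB 5 3, hB 6 2, hB 7 1, hB 8 0]

theorem mul_exp_neg_le_one (v : ℝ) : v * exp (-v) ≤ 1 := by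
  rw [exp_neg, ← div_eq_mul_inv, div_le_one (exp_pos v)]
  linarith [add_one_le_exp v]

theorem cosh_rpow_mul_logDen_le_of_seven_halves_le {u s : ℝ} (hs : s = 9 / 100)
    (hu : 7 / 2 ≤ u) : cosh u ^ s * logDen s u ≤ logNum s u := by
  have hs0 : 0 < s := by rw [hs]; norm_num
  refine cosh_rpow_mul_logDen_le_of_exp (K := 18791 / 20000) (by linarith) hs0
    (by rw [hs]; norm_num) (hs ▸ two_rpow_neg_nine_div_hundred_le) rfl rfl rfl ?_
  obtain ⟨v, rfl⟩ : ∃ v, u = (7 + v) / 2 := ⟨2 * u - 7, by ring⟩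
  have : 0 ≤ v := by linarith
  have hy : exp (-2 * ((7 + v) / 2)) = exp (-7) * exp (-v) := by
    rw [← exp_add]
    ring_nf
  have hE : exp (-2 * (s * ((7 + v) / 2))) = exp (-(s * 7)) * exp (-(s * v)) := by
    rw [← exp_add]
    ring_nf
  have hY : exp (-7) ≤ 0.000912 := by
    have := exp_neg_natCast_le 7
    norm_num at this ⊢
    linarith
  have hyY : exp (-2 * ((7 + v) / 2)) ≤ 0.000912 := by
    rw [hy]
    exact (mul_le_of_le_one_right (exp_nonneg _) (exp_le_one_iff.2 (by linarith))).trans hY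
  have hvy : v * exp (-2 * ((7 + v) / 2)) ≤ 0.000912 := by
    rw [hy, mul_left_comm]
    exact (mul_le_of_le_one_right (exp_nonneg _) (mul_exp_neg_le_one v)).trans hY
  have hE7 : 0.5324 ≤ exp (-(s * 7)) :=
    (by rw [hs]; norm_num : (_ : ℝ) ≤ _).trans (quintic_le_exp_neg (by positivity))
  have hEv : 0.5324 * (1 - s * v) ≤ exp (-2 * (s * ((7 + v) / 2))) := by
    rw [hE]
    exact (mul_le_mul_of_nonneg_left (one_sub_le_exp_neg _) (by norm_num)).trans
      (mul_le_mul_of_nonneg_right hE7 (exp_nonneg _))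
  have hy0 := exp_nonneg (-2 * ((7 + v) / 2))
  have hE0 := exp_nonneg (-2 * (s * ((7 + v) / 2)))
  rw [hs] at hEv hE0 ⊢
  set y := exp (-2 * ((7 + v) / 2))
  set E := exp (-2 * (9 / 100 * ((7 + v) / 2)))
  have hEy : 0 ≤ ((1 - 9 / 100) * ((7 + v) / 2) - (1 + 9 / 100) / 2) * (E * y) :=
    mul_nonneg (by linarith) (mul_nonneg hE0 hy0)
  have hyy : y * y ≤ 0.000912 * y := mul_le_mul_of_nonneg_right hyY hy0
  have hvyy : v * y * y ≤ 0.000912 * y := mul_le_mul_of_nonneg_right hvy hy0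
  linarith

end LogarithmicLarge

section LogarithmicEndpoints

theorem meanLE_meanL_lambdaMean_nine_div_hundred : MeanLE meanL (lambdaMean (9 / 100)) := by
  refine isHomMean_meanL.meanLE (isHomMean_lambdaMean _) fun u hu => ?_
  rw [meanL_le_lambdaMean_exp_iff (by norm_num) (by norm_num) hu]
  rcases le_total u (3 / 2) with hsmall | hlarge
  · exact cosh_rpow_mul_logDen_le_of_le_three_halves hu hsmall rfl
  rcases le_total u (7 / 2) with hmid | htail
  · exact cosh_rpow_mul_logDen_le_of_le_seven_halves rfl hlarge hmid
  · exact cosh_rpow_mul_logDen_le_of_seven_halves_le rfl htail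

theorem log_five_quarters_le : log (5 / 4) ≤ 0.2232 := by
  rw [log_le_iff_le_exp (by norm_num)]
  have hexp := sum_le_exp_of_nonneg (x := 0.2232) (by norm_num) 5
  simp only [Finset.sum_range_succ, Finset.sum_range_zero, Nat.factorial] at hexp
  norm_num at hexp ⊢
  linarith

theorem not_meanLE_meanL_lambdaMean_one_div_twelve : ¬ MeanLE meanL (lambdaMean (1 / 12)) := by
  intro h
  have hl0 : 0 < log (5 / 4) := log_pos (by norm_num)
  have hl1 := log_five_quarters_le
  have hexp : exp (log (5 / 4)) = 5 / 4 := exp_log (by norm_num)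
  generalize log (5 / 4) = l at hl0 hl1 hexp
  have hexp' : exp (12 * l) = (5 / 4) ^ 12 := by
    rw [← hexp, ← exp_nat_mul]
    norm_num
  have hu : 0 < 12 * l := by positivity
  have key := (meanL_le_lambdaMean_exp_iff (by norm_num) (by norm_num) hu).1
    (h _ _ (exp_pos _) (exp_pos _))
  have hden := (logDen_pos (s := 1 / 12) (by norm_num) (by norm_num) hu).le
  have hcosh : cosh (12 * l) = ((5 / 4) ^ 12 + ((5 / 4) ^ 12)⁻¹) / 2 := by
    rw [cosh_eq, exp_neg, hexp']
  have hsinh : sinh (12 * l) = ((5 / 4) ^ 12 - ((5 / 4) ^ 12)⁻¹) / 2 := by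
    rw [sinh_eq, exp_neg, hexp']
  have hpow : 1.1802 ≤ cosh (12 * l) ^ (1 / 12 : ℝ) := by
    rw [one_div, le_rpow_inv_iff_of_pos (by norm_num) (cosh_pos _).le (by norm_num), hcosh]
    norm_num
  have hle := (mul_le_mul_of_nonneg_right hpow hden).trans key
  rw [logNum, logDen, show 1 / 12 * (12 * l) = l by ring, cosh_eq l, sinh_eq l, exp_neg l,
    hexp, hcosh, hsinh] at hle
  norm_num at hle hl1
  linarith

end LogarithmicEndpoints

section Threshold

theorem continuousAt_jensenBar_fPow {a b s : ℝ} (ha : 0 < a) (hb : 0 < b) (h0 : s ≠ 0)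
    (h1 : s ≠ 1) : ContinuousAt (fun s => jensenBar (fPow s) a b) s := by
  have hm : 0 < (a + b) / 2 := by positivity
  have heq : (fun s => jensenBar (fPow s) a b) =ᶠ[𝓝 s]
      fun s => (a ^ s + b ^ s - 2 * ((a + b) / 2) ^ s) / (s * (s - 1)) := by
    filter_upwards [isOpen_ne.mem_nhds h0, isOpen_ne.mem_nhds h1] with t ht0 ht1
    exact jensenBar_fPow_of_ne ht0 ht1 a b
  refine ContinuousAt.congr ?_ heq.symm
  exact (((continuousAt_const_rpow ha.ne').add (continuousAt_const_rpow hb.ne')).sub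
    (continuousAt_const.mul (continuousAt_const_rpow hm.ne'))).div
    (continuousAt_id.mul (continuousAt_id.sub continuousAt_const))
    (mul_ne_zero h0 (sub_ne_zero.2 h1))

theorem continuousAt_lambdaMean {a b s : ℝ} (ha : 0 < a) (hb : 0 < b) (hs : s + 1 ≠ 0)
    (h0 : s ≠ 0) (h1 : s ≠ 1) : ContinuousAt (fun s => lambdaMean s a b) s := by
  by_cases hab : a = b
  · subst hab
    simp only [lambdaMean_self]
    exact continuousAt_const
  · simp only [lambdaMean_of_ne _ hab]
    have hnum : ContinuousAt (fun s => jensenBar (fPow (s + 1)) a b) s :=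
      ContinuousAt.comp' (f := fun s => s + 1)
        (continuousAt_jensenBar_fPow ha hb hs (by simpa using h0))
        (continuousAt_id.add continuousAt_const)
    exact hnum.div (continuousAt_jensenBar_fPow ha hb h0 h1)
      (jensenBar_fPow_pos s ha hb hab).ne'

theorem exists_meanLE_lambdaMean_iff_le {M : ℝ → ℝ → ℝ} {l r : ℝ}
    (hl : ¬ MeanLE M (lambdaMean l)) (hr : MeanLE M (lambdaMean r))
    (hlr : ∀ s ∈ Icc l r, s + 1 ≠ 0 ∧ s ≠ 0 ∧ s ≠ 1) :
    ∃ s₀ ∈ Ioc l r, ∀ s : ℝ, MeanLE M (lambdaMean s) ↔ s₀ ≤ s := by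
  set T := {s : ℝ | MeanLE M (lambdaMean s)}
  have hup : ∀ s ∈ T, ∀ t, s ≤ t → t ∈ T := fun s hs t hst =>
    MeanLE.trans hs (meanLE_lambdaMean hst)
  have hlb : ∀ s ∈ T, l < s := fun s hs => by
    by_contra! hsl
    exact hl (hup s hs l hsl)
  have hbdd : BddBelow T := ⟨l, fun s hs => (hlb s hs).le⟩
  have hgt : ∀ s, sInf T < s → s ∈ T := fun s hs => by
    obtain ⟨t, ht, hts⟩ := exists_lt_of_csInf_lt ⟨r, hr⟩ hs
    exact hup t ht s hts.le
  have hle : sInf T ≤ r := csInf_le hbdd hr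
  obtain ⟨hs, h0, h1⟩ := hlr (sInf T) ⟨le_csInf ⟨r, hr⟩ fun s hs => (hlb s hs).le, hle⟩
  have hmem : sInf T ∈ T := fun a b ha hb =>
    ge_of_tendsto ((continuousAt_lambdaMean ha hb hs h0 h1).mono_left
      (nhdsWithin_le_nhds (s := Ioi (sInf T))))
      (by filter_upwards [self_mem_nhdsWithin] with s hs using hgt s hs a b ha hb)
  exact ⟨sInf T, ⟨hlb _ hmem, hle⟩, fun s => ⟨fun h => csInf_le hbdd h, hup _ hmem s⟩⟩

end Threshold

section IdentricThreshold

theorem lambert_five_ratio_bound {U : ℝ} (hU : 0 ≤ U) (hU' : U ≤ 17 / 10) :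
    2 * U * ((945 + 105 * U + U ^ 2) / (945 + 420 * U + 15 * U ^ 2)) ^ 2 ≤
      (1 - (945 + 105 * U + U ^ 2) / (945 + 420 * U + 15 * U ^ 2)) *
        (1 - ((945 + 105 * U + U ^ 2) / (945 + 420 * U + 15 * U ^ 2)) ^ 2 * U) *
          (6 + 5 * U + U ^ 2) := by
  have hpoly : 0 ≤ (315 + 14 * U) * ((945 + 420 * U + 15 * U ^ 2) ^ 2 -
      (945 + 105 * U + U ^ 2) ^ 2 * U) * (6 + 5 * U + U ^ 2) -
        2 * (945 + 105 * U + U ^ 2) ^ 2 * (945 + 420 * U + 15 * U ^ 2) := by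
    have hB (k m : ℕ) : 0 ≤ U ^ k * (17 / 10 - U) ^ m :=
      mul_nonneg (pow_nonneg hU k) (pow_nonneg (sub_nonneg.2 hU') m)
    linarith [hB 1 7, hB 2 6, hB 3 5, hB 4 4, hB 5 3, hB 6 2, hB 7 1, hB 8 0]
  rw [← sub_nonneg]
  refine (div_nonneg (mul_nonneg hU hpoly)
    (by positivity : 0 ≤ (945 + 420 * U + 15 * U ^ 2) ^ 3)).trans_eq ?_
  field_simp
  ring

theorem two_mul_mul_cosh_mul_sinh_sq_le {u : ℝ} (hu : 0 < u) (hu' : u ^ 2 ≤ 17 / 10) :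
    2 * u * cosh u * sinh u ^ 2 ≤
      (u * cosh u - sinh u) * ((3 + u ^ 2) * (2 + u ^ 2)) := by
  have := cosh_pos u
  have := sinh_pos_iff.2 hu
  have hratio := lambert_five_ratio_bound (sq_nonneg u) hu'
  obtain ⟨k, hk⟩ : ∃ k, k = sinh u / (u * cosh u) := ⟨_, rfl⟩
  have hkκ : k ≤ (945 + 105 * u ^ 2 + (u ^ 2) ^ 2) / (945 + 420 * u ^ 2 + 15 * (u ^ 2) ^ 2) := by
    rw [hk, div_le_div_iff₀ (by positivity) (by positivity)]
    linarith [lambert_five hu.le]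
  have hκ1 : (945 + 105 * u ^ 2 + (u ^ 2) ^ 2) / (945 + 420 * u ^ 2 + 15 * (u ^ 2) ^ 2) ≤ 1 := by
    rw [div_le_one (by positivity)]
    linarith [sq_nonneg u, sq_nonneg (u ^ 2)]
  have hk0 : 0 ≤ k := hk ▸ by positivity
  generalize (945 + 105 * u ^ 2 + (u ^ 2) ^ 2) / (945 + 420 * u ^ 2 + 15 * (u ^ 2) ^ 2) = κ
    at hratio hkκ hκ1
  have hsinh_eq : sinh u = k * u * cosh u := by rw [hk]; field_simp
  have hcosh_sq : cosh u ^ 2 * (1 - k ^ 2 * u ^ 2) = 1 := by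
    linear_combination cosh_sq u + (sinh u + k * u * cosh u) * hsinh_eq
  have hk1 : 0 ≤ 1 - k ^ 2 * u ^ 2 :=
    (pos_of_mul_pos_right (hcosh_sq.symm ▸ one_pos) (sq_nonneg (cosh u))).le
  have hsq : k ^ 2 ≤ κ ^ 2 := pow_le_pow_left₀ hk0 hkκ 2
  have hbound : 2 * u ^ 2 * k ^ 2 ≤
      (1 - k) * (1 - k ^ 2 * u ^ 2) * (6 + 5 * u ^ 2 + (u ^ 2) ^ 2) := by
    calc 2 * u ^ 2 * k ^ 2 ≤ 2 * u ^ 2 * κ ^ 2 := by gcongr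
      _ ≤ (1 - κ) * (1 - κ ^ 2 * u ^ 2) * (6 + 5 * u ^ 2 + (u ^ 2) ^ 2) := hratio
      _ ≤ (1 - κ) * (1 - k ^ 2 * u ^ 2) * (6 + 5 * u ^ 2 + (u ^ 2) ^ 2) := by
        gcongr
      _ ≤ (1 - k) * (1 - k ^ 2 * u ^ 2) * (6 + 5 * u ^ 2 + (u ^ 2) ^ 2) := by gcongr
  have hmul := mul_le_mul_of_nonneg_left hbound (by positivity : 0 ≤ u * cosh u ^ 3)
  rw [hsinh_eq]
  linear_combination hmul + u * cosh u * (1 - k) * (6 + 5 * u ^ 2 + (u ^ 2) ^ 2) * hcosh_sq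

theorem exp_mul_cosh_div_sinh_sub_one_mul_le {u : ℝ} (hu : 0 < u) (hu' : u ^ 2 ≤ 17 / 10) :
    exp (u * cosh u / sinh u - 1) * (6 + 3 * u ^ 2) ≤ cosh u * (6 + 2 * u ^ 2) := by
  have hcosh := cosh_pos u
  have hpoly (a b : ℝ) :
      Tendsto (fun u : ℝ => a + b * u ^ 2) (𝓝[>] 0) (𝓝 a) :=
    (Continuous.tendsto' (by fun_prop) 0 a (by simp)).mono_left nhdsWithin_le_nhds
  have hlim := ((tendsto_cosh_nhdsGT_zero.log one_ne_zero).add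
    (((hpoly 6 2).log (by norm_num)).sub ((hpoly 6 3).log (by norm_num)))).sub
    tendsto_mul_cosh_div_sinh
  rw [log_one, sub_self, zero_add, zero_sub] at hlim
  have hlog := le_of_tendsto_of_hasDerivAt_nonneg
    (f' := fun v => ((v * cosh v - sinh v) * ((3 + v ^ 2) * (2 + v ^ 2)) -
      2 * v * cosh v * sinh v ^ 2) / ((3 + v ^ 2) * (2 + v ^ 2) * cosh v * sinh v ^ 2))
    hu hlim (fun v hv => ?_) (fun v hv => ?_)
  · rw [← exp_log (by positivity : 0 < cosh u * (6 + 2 * u ^ 2)),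
      ← exp_log (by positivity : 0 < 6 + 3 * u ^ 2), ← exp_add, exp_le_exp,
      log_mul hcosh.ne' (by positivity)]
    linarith
  · have hsinh := sinh_pos_iff.2 hv.1
    have := cosh_pos v
    refine ((hasDerivAt_log_cosh v).fun_add
      ((((((hasDerivAt_id v).fun_pow 2).const_mul 2).const_add 6).log ?_).fun_sub
      (((((hasDerivAt_id v).fun_pow 2).const_mul 3).const_add 6).log ?_))).fun_sub
      (hasDerivAt_mul_cosh_div_sinh hv.1) |>.congr_deriv ?_
    · simp only [id]; positivity
    · simp only [id]; positivity
    · rw [tanh_eq_sinh_div_cosh]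
      simp only [id]
      field_simp
      push_cast
      linear_combination -6 * sinh v * (6 + 5 * v ^ 2 + v ^ 4) ^ 2 * cosh_sq v
  · have hsinh := sinh_pos_iff.2 hv.1
    have := cosh_pos v
    refine div_nonneg (sub_nonneg.2 (two_mul_mul_cosh_mul_sinh_sq_le hv.1 ?_)) (by positivity)
    exact (pow_le_pow_left₀ hv.1.le hv.2.le 2).trans hu'

/-- The denominator of the quotient which `I ≤ λ_s`, restricted to the pairs `(e⁻ᵘ, eᵘ)`,
compares with `cosh u ^ s`. -/
noncomputable def idDen (s u : ℝ) : ℝ :=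
  (s + 1) * exp (u * cosh u / sinh u - 1) - (s - 1) * cosh u

/-- The numerator of the quotient which `I ≤ λ_s`, restricted to the pairs `(e⁻ᵘ, eᵘ)`,
compares with `cosh u ^ s`. -/
noncomputable def idNum (s u : ℝ) : ℝ :=
  cosh (s * u) * idDen s u - (s - 1) * sinh u * sinh (s * u)

theorem meanI_le_lambdaMean_exp_iff {s u : ℝ} (hs : 1 < s) (hu : 0 < u) :
    meanI (exp (-u)) (exp u) ≤ lambdaMean s (exp (-u)) (exp u) ↔
      idNum s u ≤ cosh u ^ s * idDen s u := by
  have hs0 : 0 < s := by linarith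
  have : 0 < s - 1 := by linarith
  rw [le_lambdaMean_exp_iff hu, meanI_exp hu, jensenBar_fPow_exp hs0.ne' hs.ne',
    jensenBar_fPow_exp (by linarith) (by linarith), show (s + 1) * u = u + s * u by ring,
    cosh_add, rpow_add_one (cosh_pos u).ne', add_sub_cancel_right, mul_div_assoc',
    div_le_div_iff₀ (by positivity) (by positivity), ← sub_nonneg,
    ← sub_nonneg (a := cosh u ^ s * _)]
  refine iff_of_eq (congrArg _ ?_) |>.trans (mul_nonneg_iff_of_pos_left
    (show 0 < 2 * s by positivity))
  unfold idNum idDen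
  ring

theorem hasDerivAt_idDen (s : ℝ) {u : ℝ} (hu : 0 < u) :
    HasDerivAt (idDen s) ((s + 1) * (exp (u * cosh u / sinh u - 1) *
      ((cosh u * sinh u - u) / sinh u ^ 2)) - (s - 1) * sinh u) u :=
  (((hasDerivAt_mul_cosh_div_sinh hu).sub_const 1).exp.const_mul (s + 1)).fun_sub
    ((hasDerivAt_cosh u).const_mul (s - 1))

theorem hasDerivAt_idNum (s : ℝ) {u d : ℝ} (hd : HasDerivAt (idDen s) d u) :
    HasDerivAt (idNum s) (s * sinh (s * u) * idDen s u + cosh (s * u) * d -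
      (s - 1) * (cosh u * sinh (s * u) + s * sinh u * cosh (s * u))) u := by
  refine (((hasDerivAt_cosh_mul s u).fun_mul hd).fun_sub
    (((hasDerivAt_sinh u).const_mul (s - 1)).fun_mul (hasDerivAt_sinh_mul s u))).congr_deriv ?_
  ring

theorem tendsto_cosh_rpow_mul_idNum_div_idDen (s : ℝ) :
    Tendsto (fun u => cosh u ^ (-s) * (idNum s u / idDen s u)) (𝓝[>] 0) (𝓝 1) := by
  have hcosh := tendsto_cosh_nhdsGT_zero
  have hcosh' : Tendsto (fun u => cosh (s * u)) (𝓝[>] 0) (𝓝 1) :=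
    ((continuous_cosh.comp (continuous_const_mul s)).tendsto' 0 1 (by simp)).mono_left
      nhdsWithin_le_nhds
  have hsinh' : Tendsto (fun u => sinh (s * u)) (𝓝[>] 0) (𝓝 0) :=
    ((continuous_sinh.comp (continuous_const_mul s)).tendsto' 0 0 (by simp)).mono_left
      nhdsWithin_le_nhds
  have hsinh : Tendsto sinh (𝓝[>] 0) (𝓝 0) :=
    (continuous_sinh.tendsto' 0 0 sinh_zero).mono_left nhdsWithin_le_nhds
  have hexp : Tendsto (fun u => exp (u * cosh u / sinh u - 1)) (𝓝[>] 0) (𝓝 1) := by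
    have := (continuous_exp.tendsto _).comp (tendsto_mul_cosh_div_sinh.sub_const 1)
    rwa [sub_self, exp_zero] at this
  have hden : Tendsto (idDen s) (𝓝[>] 0) (𝓝 2) := by
    have := (hexp.const_mul (s + 1)).sub (hcosh.const_mul (s - 1))
    rwa [show (s + 1) * 1 - (s - 1) * 1 = (2 : ℝ) by ring] at this
  have hnum := (hcosh'.mul hden).sub ((hsinh.const_mul (s - 1)).mul hsinh')
  have := (hcosh.rpow_const (p := -s) (Or.inl one_ne_zero)).mul (hnum.div hden two_ne_zero)
  rwa [one_rpow, show (1 : ℝ) * ((1 * 2 - (s - 1) * 0 * 0) / 2) = 1 by norm_num] at this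

theorem hasDerivAt_cosh_rpow_mul_idNum_div_idDen {s u : ℝ} (hu : 0 < u) (hden : idDen s u ≠ 0) :
    HasDerivAt (fun u => cosh u ^ (-s) * (idNum s u / idDen s u))
      (cosh u ^ (-s) / cosh u * (s * sinh ((s - 1) * u) -
        (s - 1) * s * sinh u * cosh ((s - 1) * u) / idDen s u -
        (s - 1) * cosh u * sinh (s * u) *
          ((s + 1) * exp (u * cosh u / sinh u - 1) * u / sinh u - (s - 1)) / idDen s u ^ 2)) u := by
  have hcosh := (cosh_pos u).ne'
  have hsinh := (sinh_pos_iff.2 hu).ne'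
  have hderiv := hasDerivAt_idDen s hu
  refine ((hasDerivAt_cosh_rpow (-s) u).fun_mul
    ((hasDerivAt_idNum s hderiv).fun_div hderiv hden)).congr_deriv ?_
  rw [rpow_sub_one hcosh, show (s - 1) * u = s * u - u by ring, sinh_sub, cosh_sub]
  have hM : (s + 1) * exp (u * cosh u / sinh u - 1) * u / sinh u - (s - 1) =
      cosh u * idDen s u - sinh u * ((s + 1) * (exp (u * cosh u / sinh u - 1) *
        ((cosh u * sinh u - u) / sinh u ^ 2)) - (s - 1) * sinh u) := by
    unfold idDen
    field_simp
    linear_combination (s - 1) * sinh u * cosh_sq u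
  rw [hM, idNum]
  generalize (s + 1) * (exp (u * cosh u / sinh u - 1) *
    ((cosh u * sinh u - u) / sinh u ^ 2)) - (s - 1) * sinh u = d
  generalize idDen s u = D at hden ⊢
  field_simp
  ring

end IdentricThreshold

section IdentricSmall

theorem identric_quadratic_bound {U s : ℝ} (hU : 0 ≤ U) (hU' : U ≤ 17 / 10)
    (hs : s = 1.0399) {h i : ℝ} (hh : h = (105 + 45 * U + U ^ 2) / (105 + 10 * U))
    (hi : i = (s + 1) * ((6 + 2 * U) / (6 + 3 * U))) :
    0 ≤ s * (i - (s - 1)) + (i * h - (s - 1)) * (1 + (s - 1) * h) -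
      h * s * (i - (s - 1)) ^ 2 := by
  have hB (k m : ℕ) : 0 ≤ U ^ k * (17 / 10 - U) ^ m :=
    mul_nonneg (pow_nonneg hU k) (pow_nonneg (sub_nonneg.2 hU') m)
  have hpoly : 0 ≤ 21536.325846 * U - 3000.422430168975 * U ^ 2 - 3667.129979724225 * U ^ 3 -
      129.362636105445 * U ^ 4 + 5.56297028801 * U ^ 5 + 0.48835206 * U ^ 6 := by
    linarith [hB 1 5, hB 2 4, hB 3 3, hB 4 2, hB 5 1, hB 6 0]
  subst hs
  rw [hh, hi]
  refine (div_nonneg hpoly (by positivity : 0 ≤ ((105 + 10 * U) * (6 + 3 * U)) ^ 2)).trans_eq ?_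
  field_simp
  ring

theorem identric_quadratic_nonneg {U h i s : ℝ} (hU : 0 ≤ U) (hU' : U ≤ 17 / 10)
    (hs : s = 1.0399) (hh1 : 1 ≤ h) (hh : h ≤ (105 + 45 * U + U ^ 2) / (105 + 10 * U))
    (hi1 : 7 / 10 ≤ i) (hi : i ≤ (s + 1) * ((6 + 2 * U) / (6 + 3 * U))) :
    0 ≤ s * (i - (s - 1)) + (i * h - (s - 1)) * (1 + (s - 1) * h) -
      h * s * (i - (s - 1)) ^ 2 := by
  have hbound := identric_quadratic_bound hU hU' hs rfl rfl
  have hh₂ : (105 + 45 * U + U ^ 2) / (105 + 10 * U) ≤ 1.52 := by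
    rw [div_le_iff₀ (by positivity)]
    nlinarith
  have hi₂ : 1.72 ≤ (s + 1) * ((6 + 2 * U) / (6 + 3 * U)) := by
    rw [mul_div_assoc', le_div_iff₀ (by positivity), hs]
    linarith
  generalize (105 + 45 * U + U ^ 2) / (105 + 10 * U) = h₂ at *
  generalize (s + 1) * ((6 + 2 * U) / (6 + 3 * U)) = i₂ at *
  subst hs
  have hmono_h : 0 ≤ (h₂ - h) * (1.0399 * (i₂ - 0.0399) ^ 2 + 0.0399 ^ 2 -
      i₂ * (1 + 0.0399 * (h + h₂))) := by
    refine mul_nonneg (sub_nonneg.2 hh) ?_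
    have : i₂ * (1 + 0.0399 * (h + h₂)) ≤ i₂ * 1.2 := by gcongr; linarith
    nlinarith
  have hmono_i : 0 ≤ (i₂ - i) * (1.0399 * h * (i + i₂ - 2 * 0.0399) - h -
      0.0399 * h ^ 2 - 1.0399) := by
    refine mul_nonneg (sub_nonneg.2 hi) ?_
    have : h * 2.34 ≤ h * (i + i₂ - 2 * 0.0399) := by gcongr; linarith
    have : h ^ 2 ≤ 1.52 * h := by nlinarith
    linarith
  linarith

theorem slope_nonneg_of_quadratic_nonneg {ε s c S h i v p q : ℝ} (hε : 0 ≤ ε) (hs : 0 ≤ s)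
    (hc : 0 < c) (hS : 0 ≤ S) (hp : 0 ≤ p) (hq : 0 ≤ q) (hqp : q ≤ ε * v * p)
    (hvc : v * c = h * S) (hi : ε ≤ i) (hih : ε ≤ i * h)
    (hQ : 0 ≤ s * (i - ε) + (i * h - ε) * (1 + ε * h) - h * s * (i - ε) ^ 2) :
    q * (c * (s * (i - ε) ^ 2 - ε * (i * h - ε))) ≤
      p * (ε * S * (s * (i - ε) + (i * h - ε))) := by
  have := sub_nonneg.2 hi
  have := sub_nonneg.2 hih
  rcases le_total 0 (s * (i - ε) ^ 2 - ε * (i * h - ε)) with hsign | hsign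
  · calc q * (c * (s * (i - ε) ^ 2 - ε * (i * h - ε)))
        ≤ ε * v * p * (c * (s * (i - ε) ^ 2 - ε * (i * h - ε))) := by gcongr
      _ = p * (ε * S * (s * (i - ε) + (i * h - ε))) - p * ε * S *
          (s * (i - ε) + (i * h - ε) * (1 + ε * h) - h * s * (i - ε) ^ 2) := by
        linear_combination ε * p * (s * (i - ε) ^ 2 - ε * (i * h - ε)) * hvc
      _ ≤ _ := sub_le_self _ (by positivity)
  · exact (mul_nonpos_of_nonneg_of_nonpos hq (mul_nonpos_of_nonneg_of_nonpos hc.le hsign)).trans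
      (by positivity)

theorem inv_exp_one_le_exp_div_cosh {u : ℝ} (hu : 0 < u) :
    exp (-1) ≤ exp (u * cosh u / sinh u - 1) / cosh u := by
  have hsinh := sinh_pos_iff.2 hu
  have hle : u ≤ u * cosh u / sinh u := by
    rw [mul_div_assoc]
    exact le_mul_of_one_le_right hu.le ((one_le_div hsinh).2 (sinh_lt_cosh u).le)
  rw [le_div_iff₀ (cosh_pos u), sub_eq_neg_add, exp_add]
  gcongr
  refine le_trans ?_ (exp_le_exp.2 hle)
  rw [← cosh_add_sinh]
  exact le_add_of_nonneg_right (sinh_nonneg_iff.2 hu.le)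

theorem mul_cosh_div_sinh_le {u : ℝ} (hu : 0 < u) :
    u * cosh u / sinh u ≤ (105 + 45 * u ^ 2 + (u ^ 2) ^ 2) / (105 + 10 * u ^ 2) := by
  rw [div_le_div_iff₀ (sinh_pos_iff.2 hu) (by positivity)]
  linarith [lambert_four hu.le]

theorem idDen_eq (s u : ℝ) :
    idDen s u = cosh u * ((s + 1) * (exp (u * cosh u / sinh u - 1) / cosh u) - (s - 1)) := by
  have := (cosh_pos u).ne'
  unfold idDen
  field_simp

theorem idDen_pos {s u : ℝ} (hs : s = 1.0399) (hu : 0 < u) : 0 < idDen s u := by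
  rw [idDen_eq]
  refine mul_pos (cosh_pos u) ?_
  have := inv_exp_one_le_exp_div_cosh hu
  have := exp_neg_one_gt_d9
  rw [hs]
  linarith

theorem identric_slope_nonneg {s u : ℝ} (hs : s = 1.0399) (hu : 0 < u)
    (hu' : u ^ 2 ≤ 17 / 10) :
    s * sinh ((s - 1) * u) ≤ (s - 1) * s * sinh u * cosh ((s - 1) * u) / idDen s u +
        (s - 1) * cosh u * sinh (s * u) *
          ((s + 1) * exp (u * cosh u / sinh u - 1) * u / sinh u - (s - 1)) / idDen s u ^ 2 := by
  have hcosh := cosh_pos u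
  have hsinh := sinh_pos_iff.2 hu
  have hs0 : 0 < s := by rw [hs]; norm_num
  have hs1 : 0 < s - 1 := by rw [hs]; norm_num
  have hh1 : 1 ≤ u * cosh u / sinh u := (one_le_div hsinh).2 (sinh_le_mul_cosh hu.le)
  have hh := mul_cosh_div_sinh_le hu
  have hden := idDen_eq s u
  have hTle := inv_exp_one_le_exp_div_cosh hu
  have hT : exp (u * cosh u / sinh u - 1) / cosh u ≤ (6 + 2 * u ^ 2) / (6 + 3 * u ^ 2) := by
    rw [div_le_div_iff₀ hcosh (by positivity), mul_comm (6 + 2 * u ^ 2)]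
    exact exp_mul_cosh_div_sinh_sub_one_mul_le hu hu'
  generalize hi : (s + 1) * (exp (u * cosh u / sinh u - 1) / cosh u) = i at hden
  have hi1 : 7 / 10 ≤ i := by
    rw [← hi, hs]
    linarith [exp_neg_one_gt_d9]
  have hi2 : i ≤ (s + 1) * ((6 + 2 * u ^ 2) / (6 + 3 * u ^ 2)) := by
    rw [← hi]
    gcongr
  have hih : (s + 1) * exp (u * cosh u / sinh u - 1) * u / sinh u =
      i * (u * cosh u / sinh u) := by
    rw [← hi]
    field_simp
  have hvc : u * cosh u = u * cosh u / sinh u * sinh u := by field_simp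
  have hQ := identric_quadratic_nonneg (sq_nonneg u) hu' hs hh1 hh hi1 hi2
  rw [hih, hden]
  clear hih hi hi2 hT hTle
  generalize u * cosh u / sinh u = h at *
  have hiε : 0 < i - (s - 1) := by rw [hs]; linarith
  have hslope := slope_nonneg_of_quadratic_nonneg hs1.le hs0.le hcosh hsinh.le
    (cosh_pos ((s - 1) * u)).le (sinh_nonneg_iff.2 (by positivity : 0 ≤ (s - 1) * u))
    (sinh_le_mul_cosh (by positivity)) hvc (by linarith) (by nlinarith) hQ
  rw [show s * u = (s - 1) * u + u by ring, sinh_add, ← sub_nonneg]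
  refine (div_nonneg (sub_nonneg.2 hslope)
    (by positivity : 0 ≤ cosh u * (i - (s - 1)) ^ 2)).trans_eq ?_
  field_simp
  ring

theorem idNum_le_of_sq_le {s u : ℝ} (hs : s = 1.0399) (hu : 0 < u) (hu' : u ^ 2 ≤ 17 / 10) :
    idNum s u ≤ cosh u ^ s * idDen s u := by
  have hle := le_of_tendsto_of_hasDerivAt_nonneg hu (tendsto_cosh_rpow_mul_idNum_div_idDen s).neg
    (fun v hv => (hasDerivAt_cosh_rpow_mul_idNum_div_idDen hv.1 (idDen_pos hs hv.1).ne').neg)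
    (fun v hv => ?_)
  · have hcosh := cosh_pos u
    rw [neg_le_neg_iff] at hle
    rwa [rpow_neg hcosh.le, ← div_eq_inv_mul, div_div, div_le_one
      (mul_pos (idDen_pos hs hu) (by positivity)), mul_comm] at hle
  · have := cosh_pos v
    have hslope := identric_slope_nonneg hs hv.1
      ((pow_le_pow_left₀ hv.1.le hv.2.le 2).trans hu')
    rw [neg_nonneg]
    exact mul_nonpos_of_nonneg_of_nonpos (by positivity) (by linarith)

end IdentricSmall

section OneAddRpow

theorem hasDerivAt_one_add_rpow (p : ℝ) {x : ℝ} (hx : 0 ≤ x) :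
    HasDerivAt (fun x => (1 + x) ^ p) (p * (1 + x) ^ (p - 1)) x :=
  (((hasDerivAt_id x).const_add 1).rpow_const (Or.inl (by simp only [id]; positivity))).congr_deriv
    (by simp only [id]; ring)

theorem one_sub_le_one_add_rpow {p x : ℝ} (hp : 0 ≤ p) (hp1 : p ≤ 1) (hx : 0 ≤ x) :
    1 - (1 - p) * x ≤ (1 + x) ^ (p - 1) := by
  have hbernoulli : (1 + x) ^ (1 - p) ≤ 1 + (1 - p) * x :=
    rpow_one_add_le_one_add_mul_self (by linarith) (by linarith) (by linarith)
  have hpos : 0 < (1 + x) ^ (1 - p) := rpow_pos_of_pos (by linarith) _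
  rw [← neg_sub 1 p, rpow_neg (by linarith), ← one_div, le_div_iff₀ hpos]
  rcases le_total 0 (1 - (1 - p) * x) with hsign | hsign
  · nlinarith [mul_le_mul_of_nonneg_left hbernoulli hsign, sq_nonneg ((1 - p) * x)]
  · nlinarith

theorem quadratic_le_one_add_rpow {p x : ℝ} (hp : 0 ≤ p) (hp1 : p ≤ 1) (hx : 0 ≤ x) :
    1 + p * x - p * (1 - p) / 2 * x ^ 2 ≤ (1 + x) ^ p := by
  rw [← sub_nonneg]
  refine nonneg_of_hasDerivAt_nonneg
    (f := fun x => (1 + x) ^ p - (1 + p * x - p * (1 - p) / 2 * x ^ 2)) (by simp)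
    (fun z hz => (hasDerivAt_one_add_rpow p hz).fun_sub (((hasDerivAt_const_mul p).const_add
      1).fun_sub (((hasDerivAt_id z).fun_pow 2).const_mul _))) (fun z hz => ?_) hx
  have := mul_le_mul_of_nonneg_left (one_sub_le_one_add_rpow hp hp1 hz.le) hp
  norm_num
  linarith

theorem cubic_le_one_add_rpow {p x : ℝ} (hp : 0 ≤ p) (hp1 : p ≤ 1) (hx : 0 ≤ x) :
    1 + (1 + p) * x + (1 + p) * p / 2 * x ^ 2 - (1 + p) * p * (1 - p) / 6 * x ^ 3 ≤
      (1 + x) ^ (1 + p) := by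
  rw [← sub_nonneg]
  refine nonneg_of_hasDerivAt_nonneg
    (f := fun x => (1 + x) ^ (1 + p) - (1 + (1 + p) * x + (1 + p) * p / 2 * x ^ 2 -
      (1 + p) * p * (1 - p) / 6 * x ^ 3)) (by simp)
    (fun z hz => (hasDerivAt_one_add_rpow (1 + p) hz).fun_sub
      ((((hasDerivAt_const_mul (1 + p)).const_add 1).fun_add
        (((hasDerivAt_id z).fun_pow 2).const_mul _)).fun_sub
          (((hasDerivAt_id z).fun_pow 3).const_mul _))) (fun z hz => ?_) hx
  have := mul_le_mul_of_nonneg_left (quadratic_le_one_add_rpow hp hp1 hz.le)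
    (by linarith : 0 ≤ 1 + p)
  simp only [id, add_sub_cancel_left]
  norm_num
  linarith

end OneAddRpow

section IdentricLarge

/-- A polynomial lower bound for `2 ^ (-0.0399) * (1 + y) ^ 1.0399`: the truncated binomial series
times the rational lower bound `0.972722` of `2 ^ (-0.0399)`. -/
noncomputable def binomialCubic (y : ℝ) : ℝ :=
  0.972722 * (1 + 1.0399 * y + 1.0399 * 0.0399 / 2 * y ^ 2 -
    1.0399 * 0.0399 * (1 - 0.0399) / 6 * y ^ 3)

theorem mul_one_add_le_binomialCubic {y : ℝ} (hy : 0 ≤ y) (hy' : y ≤ 2 / 27) :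
    0.972722 * (1 + y) ≤ binomialCubic y := by
  have : y ^ 3 ≤ 2 / 27 * y ^ 2 := by rw [pow_succ']; gcongr
  unfold binomialCubic
  nlinarith

theorem binomialCubic_le_one_add {y : ℝ} (hy : 0 ≤ y) (hy' : y ≤ 2 / 27) :
    binomialCubic y ≤ 1 + y := by
  have : y ^ 2 ≤ 2 / 27 * y := by rw [sq]; gcongr
  have : 0 ≤ y ^ 3 := by positivity
  unfold binomialCubic
  linarith

theorem one_add_mul_binomialCubic_le {y : ℝ} (hy : 0 ≤ y) (hy' : y ≤ 2 / 27) :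
    (1 + y) * binomialCubic y ≤ 1.16 := by
  calc (1 + y) * binomialCubic y ≤ (1 + 2 / 27) * (1 + 2 / 27) := by
        gcongr
        · linarith [mul_one_add_le_binomialCubic hy hy']
        · linarith [binomialCubic_le_one_add hy hy']
    _ ≤ 1.16 := by norm_num

theorem binomialCubic_le {y : ℝ} (hy : 0 ≤ y) :
    binomialCubic y ≤ 2 ^ (-0.0399 : ℝ) * (1 + y) ^ (1.0399 : ℝ) := by
  have hcubic := cubic_le_one_add_rpow (p := 0.0399) (by norm_num) (by norm_num) hy
  have htwo : 0.972722 ≤ (2 : ℝ) ^ (-0.0399 : ℝ) := by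
    rw [rpow_def_of_pos two_pos]
    have hlog : -(0.0276566 : ℝ) ≤ log 2 * -0.0399 := by linarith [log_two_lt_d9]
    exact le_trans (by norm_num)
      ((cubic_le_exp_neg (by norm_num)).trans (exp_le_exp.2 hlog))
  calc binomialCubic y ≤ 0.972722 * (1 + y) ^ (1.0399 : ℝ) :=
        mul_le_mul_of_nonneg_left (by norm_num at hcubic ⊢; exact hcubic) (by norm_num)
    _ ≤ _ := by gcongr

/-- With `y = e⁻²ᵘ`, the inequality `I ≤ λ_s` at `(e⁻ᵘ, eᵘ)` for `s = 1.0399`, after division by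
the dominant exponentials. -/
def IdentricBound (y : ℝ) : Prop :=
  2 * 2.0399 * exp (-1) * (1 + y ^ (1.0399 : ℝ) - 2 ^ (-0.0399 : ℝ) * (1 + y) ^ (1.0399 : ℝ)) ≤
    0.0399 * exp (-(negMulLog y / (1 - y))) *
      (2 + 2 * y * y ^ (1.0399 : ℝ) -
        (1 + y) * (2 ^ (-0.0399 : ℝ) * (1 + y) ^ (1.0399 : ℝ)))

theorem idNum_le_of_identricBound {s u : ℝ} (hs : s = 1.0399) (hu : 0 < u)
    (h : IdentricBound (exp (-2 * u))) :
    idNum s u ≤ cosh u ^ s * idDen s u := by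
  have hy1 : 0 < 1 - exp (-2 * u) := by
    rw [sub_pos, exp_lt_one_iff]
    linarith
  have hT : exp (u * cosh u / sinh u - 1) =
      exp u * exp (-1) * exp (negMulLog (exp (-2 * u)) / (1 - exp (-2 * u))) := by
    rw [← exp_add, ← exp_add, cosh_eq_exp_mul u, sinh_eq_exp_mul u, negMulLog, log_exp]
    congr 1
    have := (exp_pos u).ne'
    generalize exp (-2 * u) = y at *
    field_simp
    ring
  have hX : cosh u ^ s =
      exp (s * u) * (2 ^ (-0.0399 : ℝ) * (1 + exp (-2 * u)) ^ (1.0399 : ℝ) / 2) := by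
    rw [cosh_rpow_eq, hs, show (-1.0399 : ℝ) = -0.0399 + -1 by norm_num,
      rpow_add two_pos, rpow_neg_one]
    ring
  have hY : exp (-2 * (s * u)) = exp (-2 * u) ^ (1.0399 : ℝ) := by
    rw [← exp_mul, hs]
    ring_nf
  unfold IdentricBound at h
  unfold idNum idDen
  rw [hT, hX, cosh_eq_exp_mul u, sinh_eq_exp_mul u, cosh_eq_exp_mul (s * u),
    sinh_eq_exp_mul (s * u), hY]
  rw [exp_neg (_ / _)] at h
  have hE := exp_pos (negMulLog (exp (-2 * u)) / (1 - exp (-2 * u)))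
  generalize exp (negMulLog (exp (-2 * u)) / (1 - exp (-2 * u))) = E at *
  generalize exp (-2 * u) ^ (1.0399 : ℝ) = Y at *
  generalize 2 ^ (-0.0399 : ℝ) * (1 + exp (-2 * u)) ^ (1.0399 : ℝ) = R at *
  generalize exp (-2 * u) = y at *
  have hmul := mul_nonneg (by positivity : 0 ≤ exp (s * u) * exp u * E / 4) (sub_nonneg.2 h)
  rw [← sub_nonneg]
  refine hmul.trans_eq ?_
  rw [hs]
  field_simp
  ring

theorem identricBound_of_binomialCubic {y : ℝ} (hy : 0 < y) (hy' : y ≤ 2 / 27)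
    (h : 1.50088 * (1 + y ^ (1.0399 : ℝ) - binomialCubic y) ≤
      0.0399 * exp (-(negMulLog y / (1 - y))) *
        (2 + 2 * y * y ^ (1.0399 : ℝ) - (1 + y) * binomialCubic y)) :
    IdentricBound y := by
  have hr := binomialCubic_le hy.le
  have hw : 0 ≤ negMulLog y := negMulLog_nonneg hy.le (by linarith)
  have hE1 : exp (-(negMulLog y / (1 - y))) ≤ 1 := by
    rw [exp_le_one_iff, neg_nonpos]
    exact div_nonneg hw (by linarith)
  have hE := exp_pos (-(negMulLog y / (1 - y)))
  have hY : 0 < y ^ (1.0399 : ℝ) := rpow_pos_of_pos hy _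
  have ha := exp_neg_one_gt_d9
  have ha' := exp_neg_one_lt_d9
  unfold IdentricBound
  generalize exp (-(negMulLog y / (1 - y))) = E at *
  generalize y ^ (1.0399 : ℝ) = Y at *
  generalize 2 ^ (-0.0399 : ℝ) * (1 + y) ^ (1.0399 : ℝ) = R at *
  have hB : 0 ≤ 2 + 2 * y * Y - (1 + y) * binomialCubic y := by
    have : 0 ≤ 2 * y * Y := by positivity
    linarith [one_add_mul_binomialCubic_le hy.le hy']
  have hcubic : 2 * 2.0399 * exp (-1) * (1 + Y - binomialCubic y) ≤
      0.0399 * E * (2 + 2 * y * Y - (1 + y) * binomialCubic y) := by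
    rcases le_total 0 (1 + Y - binomialCubic y) with hsign | hsign
    · exact (mul_le_mul_of_nonneg_right (by linarith) hsign).trans h
    · exact (mul_nonpos_of_nonneg_of_nonpos (by positivity) hsign).trans (by positivity)
  have hslope : 0.0399 * E * (1 + y) ≤ 2 * 2.0399 * exp (-1) := by
    have : 0.0399 * E * (1 + y) ≤ 0.0399 * 1 * (1 + 2 / 27) := by gcongr
    linarith
  linarith [mul_nonneg (sub_nonneg.2 hr) (sub_nonneg.2 hslope)]

end IdentricLarge

section IdentricMiddle

/-- The difference of the two sides of `identricBound_of_binomialCubic` once the transcendental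
terms are replaced by polynomials in `y`, a lower bound `l` of `-y log y`, an upper bound `c` of
`1 / (1 - y)` and bounds `m`, `M` of `-log y`. -/
noncomputable def identricMargin (y l c m M : ℝ) : ℝ :=
  0.0399 * (1 - l * c + 9 / 20 * (l * c) ^ 2) *
      (2 + 2 * y * (y - 0.0399 * l) - (1 + y) * binomialCubic y) -
    1.50088 * (1 + y * (1 - 0.0399 ^ 2 * m * M / 2) - 0.0399 * (1 - 0.0399 * (m + M) / 2) * l -
      binomialCubic y)

theorem identricMargin_mono {y l w c m M : ℝ} (hy : 0 < y) (hy' : y ≤ 2 / 27) (hl : 0 ≤ l)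
    (hlw : l ≤ w) (hw : w ≤ 0.26) (hc : 0 ≤ c) (hc' : c ≤ 27 / 25) (hmM : m + M ≤ 12) :
    identricMargin y l c m M ≤ identricMargin y w c m M := by
  have hr := mul_one_add_le_binomialCubic hy.le hy'
  have hr' := one_add_mul_binomialCubic_le hy.le hy'
  unfold identricMargin
  generalize binomialCubic y = r at *
  have hw0 := hl.trans hlw
  have hyw : y * w ≤ 2 / 27 * 0.26 := by gcongr
  have hB0 : 0 ≤ 2 + 2 * y * (y - 0.0399 * w) - (1 + y) * r := by
    nlinarith
  have hB1 : 2 + 2 * y * (y - 0.0399 * w) - (1 + y) * r ≤ 1.028 := by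
    have : (1 + y) * (0.972722 * (1 + y)) ≤ (1 + y) * r := by gcongr
    have : 0 ≤ y * w := by positivity
    nlinarith
  have hcB : c * (2 + 2 * y * (y - 0.0399 * w) - (1 + y) * r) ≤ 27 / 25 * 1.028 := by gcongr
  have hlc : l * c ≤ 0.26 * (27 / 25) := by
    gcongr
    exact hlw.trans hw
  have hg : 1 - l * c + 9 / 20 * (l * c) ^ 2 ≤ 1 := by
    have : 0 ≤ l * c := by positivity
    nlinarith
  have hslope : 2 * y * 0.0399 * (1 - l * c + 9 / 20 * (l * c) ^ 2) ≤ 0.006 := by nlinarith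
  generalize hB : 2 + 2 * y * (y - 0.0399 * w) - (1 + y) * r = B at *
  have hlinear : 0 ≤ (w - l) * (1.50088 * (1 - 0.0399 * (m + M) / 2) - c * B -
      2 * y * 0.0399 * (1 - l * c + 9 / 20 * (l * c) ^ 2)) :=
    mul_nonneg (by linarith) (by linarith)
  have hquadratic : 0 ≤ 9 / 20 * c ^ 2 * ((w - l) * (w + l)) * B := by
    have := sub_nonneg.2 hlw
    positivity
  linear_combination 0.0399 * (hlinear + hquadratic) +
    0.0399 * (1 - l * c + 9 / 20 * (l * c) ^ 2) * hB

theorem quadratic_le_exp_neg {z : ℝ} (hz : 0 ≤ z) (hz' : z ≤ 3 / 10) :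
    1 - z + 9 / 20 * z ^ 2 ≤ exp (-z) := by
  linarith [cubic_le_exp_neg hz, mul_nonneg (sq_nonneg z) (sub_nonneg.2 hz')]

theorem rpow_one_add_eq {y ε : ℝ} (hy : 0 < y) :
    y ^ (1 + ε) = y * exp (-(ε * -log y)) := by
  rw [rpow_add hy, rpow_one, rpow_def_of_pos hy]
  ring_nf

theorem sub_mul_negMulLog_le_rpow {y : ℝ} (ε : ℝ) (hy : 0 < y) :
    y - ε * negMulLog y ≤ y ^ (1 + ε) := by
  have := mul_le_mul_of_nonneg_left (one_sub_le_exp_neg (ε * -log y)) hy.le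
  rw [rpow_one_add_eq hy, negMulLog]
  linarith

theorem rpow_le_of_neg_log_mem_Icc {y ε m M : ℝ} (hy : 0 < y) (hε : 0 ≤ ε) (hm : 0 ≤ m)
    (hmy : m ≤ -log y) (hyM : -log y ≤ M) :
    y ^ (1 + ε) ≤ y * (1 - ε ^ 2 * m * M / 2) - ε * (1 - ε * (m + M) / 2) * negMulLog y := by
  have hexp := exp_neg_le_quadratic (mul_nonneg hε (hm.trans hmy))
  have hchord : 0 ≤ (-log y - m) * (M - -log y) :=
    mul_nonneg (sub_nonneg.2 hmy) (sub_nonneg.2 hyM)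
  have := mul_le_mul_of_nonneg_left (hexp.trans (by
    linarith [mul_nonneg (sq_nonneg ε) hchord] :
      _ ≤ 1 - ε ^ 2 * m * M / 2 - ε * (1 - ε * (m + M) / 2) * -log y)) hy.le
  rw [rpow_one_add_eq hy, negMulLog]
  linarith

theorem negMulLog_le_mul_add_exp_neg {y : ℝ} (hy : 0 < y) (c : ℝ) :
    negMulLog y ≤ c * y + exp (-(c + 1)) := by
  have htangent := mul_le_mul_of_nonneg_left (add_one_le_exp (-log y - (c + 1))) hy.le
  have hcancel : y * exp (-log y - (c + 1)) = exp (-(c + 1)) := by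
    rw [sub_eq_add_neg, exp_add, exp_neg (log y), exp_log hy, mul_inv_cancel_left₀ hy.ne']
  rw [negMulLog]
  linarith

theorem identricBound_of_margin_nonneg {y l c m M : ℝ} (hy : 0 < y) (hy' : y ≤ 2 / 27)
    (hm : 0 ≤ m) (hmy : m ≤ -log y) (hyM : -log y ≤ M) (hmM : m + M ≤ 12) (hl : 0 ≤ l)
    (hly : l ≤ negMulLog y) (hc : 1 / (1 - y) ≤ c) (hc' : c ≤ 27 / 25)
    (h : 0 ≤ identricMargin y l c m M) : IdentricBound y := by
  have hw : negMulLog y ≤ 0.26 := by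
    have htangent := negMulLog_le_mul_add_exp_neg hy 1
    have hexp := exp_neg_natCast_le 2
    norm_num at htangent hexp ⊢
    linarith
  have hc0 : 0 < c := lt_of_lt_of_le (one_div_pos.2 (by linarith)) hc
  have hmargin := h.trans (identricMargin_mono hy hy' hl hly hw hc0.le hc' hmM)
  have hYl := sub_mul_negMulLog_le_rpow 0.0399 hy
  have hYu := rpow_le_of_neg_log_mem_Icc hy (by norm_num : (0 : ℝ) ≤ 0.0399) hm hmy hyM
  have hw0 := hl.trans hly
  have hwc : negMulLog y * c ≤ 0.26 * (27 / 25) := by gcongr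
  have hexp : 1 - negMulLog y * c + 9 / 20 * (negMulLog y * c) ^ 2 ≤
      exp (-(negMulLog y / (1 - y))) := by
    refine (quadratic_le_exp_neg (by positivity) (by linarith)).trans
      (exp_le_exp.2 (neg_le_neg ?_))
    rw [div_eq_mul_one_div]
    gcongr
  have hg : 0 ≤ 1 - negMulLog y * c + 9 / 20 * (negMulLog y * c) ^ 2 := by nlinarith
  have hY := rpow_nonneg hy.le 1.0399
  refine identricBound_of_binomialCubic hy hy' ?_
  unfold identricMargin at hmargin
  norm_num only at hYl hYu hmargin hexp hg hY ⊢
  generalize y ^ (10399 / 10000 : ℝ) = Y at *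
  have hB : 0 ≤ 2 + 2 * y * Y - (1 + y) * binomialCubic y := by
    have : 0 ≤ 2 * y * Y := by positivity
    linarith [one_add_mul_binomialCubic_le hy.le hy']
  calc _ ≤ 399 / 10000 * (1 - negMulLog y * c + 9 / 20 * (negMulLog y * c) ^ 2) *
        (2 + 2 * y * (y - 399 / 10000 * negMulLog y) - (1 + y) * binomialCubic y) := by
        linarith
    _ ≤ 399 / 10000 * (1 - negMulLog y * c + 9 / 20 * (negMulLog y * c) ^ 2) *
        (2 + 2 * y * Y - (1 + y) * binomialCubic y) := by gcongr
    _ ≤ _ := by gcongr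

end IdentricMiddle

section IdentricIntervals

theorem identricBound_of_mem_Icc {y₁ y₂ k m M : ℝ} (hy₁ : 0 < y₁) (hy₁₂ : y₁ ≤ y₂)
    (hy₂ : y₂ ≤ 2 / 27) (hm : 0 ≤ m) (hmy : m ≤ -log y₂) (hk : 0 ≤ k)
    (hky : k ≤ -log y₁) (hyM : -log y₁ ≤ M) (hmM : m + M ≤ 12)
    (hmargin : ∀ t, 0 ≤ t → t ≤ 1 → 0 ≤ identricMargin ((1 - t) * y₁ + t * y₂)
      ((1 - t) * (y₁ * k) + t * (y₂ * m))
      ((1 - y₁ - y₂ + ((1 - t) * y₁ + t * y₂)) / ((1 - y₁) * (1 - y₂))) m M)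
    {y : ℝ} (hy : y ∈ Icc y₁ y₂) : IdentricBound y := by
  have hy₂pos := hy₁.trans_le hy₁₂
  have hpos : 0 < y := hy₁.trans_le hy.1
  have hy₁' : 0 < 1 - y₁ := by linarith
  have hy₂' : 0 < 1 - y₂ := by linarith
  have hlog₁ := log_le_log hy₁ hy.1
  have hlog₂ := log_le_log hpos hy.2
  have hc : 1 / (1 - y) ≤ (1 - y₁ - y₂ + y) / ((1 - y₁) * (1 - y₂)) := by
    rw [div_le_div_iff₀ (by linarith [hy.2]) (by positivity)]
    linarith [mul_nonneg (sub_nonneg.2 hy.1) (sub_nonneg.2 hy.2)]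
  have hc' : (1 - y₁ - y₂ + y) / ((1 - y₁) * (1 - y₂)) ≤ 27 / 25 := by
    calc (1 - y₁ - y₂ + y) / ((1 - y₁) * (1 - y₂)) ≤ (1 - y₁) / ((1 - y₁) * (1 - y₂)) := by
          gcongr
          linarith [hy.2]
      _ ≤ 27 / 25 := by
          rw [div_mul_cancel_left₀ hy₁'.ne', inv_le_comm₀ hy₂' (by norm_num)]
          linarith
  obtain ⟨r, t, hr, ht, hrt, rfl⟩ := Icc_subset_segment hy
  obtain rfl : r = 1 - t := eq_sub_of_add_eq hrt
  simp only [smul_eq_mul] at *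
  have hchord : (1 - t) * (y₁ * k) + t * (y₂ * m) ≤
      negMulLog ((1 - t) * y₁ + t * y₂) := by
    refine le_trans ?_ (concaveOn_negMulLog.2 hy₁.le hy₂pos.le hr ht hrt)
    simp only [smul_eq_mul, negMulLog, neg_mul_comm]
    gcongr
  refine identricBound_of_margin_nonneg hpos (hy.2.trans hy₂) hm (by linarith) (by linarith) hmM
    ?_ hchord hc hc' (hmargin t ht (by linarith))
  positivity

theorem identricBound_of_mem_Icc_one_div_twenty_four {y : ℝ} (hy : y ∈ Icc (1 / 24) (2 / 27)) :
    IdentricBound y := by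
  have := log_two_gt_d9
  have := log_two_lt_d9
  have := log_three_gt_d9
  have := log_three_lt_d9
  have hlog₁ : -log (1 / 24) = 3 * log 2 + log 3 := by
    rw [one_div, log_inv, neg_neg, show (24 : ℝ) = 2 ^ 3 * 3 by norm_num,
      log_mul (by norm_num) (by norm_num), log_pow]
    norm_num
  have hlog₂ : -log (2 / 27) = 3 * log 3 - log 2 := by
    rw [log_div two_ne_zero (by norm_num), show (27 : ℝ) = 3 ^ 3 by norm_num, log_pow]
    norm_num
  refine identricBound_of_mem_Icc (k := 3.178) (m := 2.602) (M := 3.179) (by norm_num) (by norm_num)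
    le_rfl (by norm_num) (by linarith) (by norm_num) (by linarith) (by linarith) (by norm_num)
    (fun t ht ht' => ?_) hy
  have hB (k m : ℕ) : 0 ≤ t ^ k * (1 - t) ^ m :=
    mul_nonneg (pow_nonneg ht k) (pow_nonneg (sub_nonneg.2 ht') m)
  unfold identricMargin binomialCubic
  norm_num only
  linarith [hB 0 8, hB 1 7, hB 2 6, hB 3 5, hB 4 4, hB 5 3, hB 6 2, hB 7 1, hB 8 0]

theorem identricBound_of_mem_Icc_one_div_seventy_two {y : ℝ} (hy : y ∈ Icc (1 / 72) (1 / 24)) :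
    IdentricBound y := by
  have := log_two_gt_d9
  have := log_two_lt_d9
  have := log_three_gt_d9
  have := log_three_lt_d9
  have hlog₁ : -log (1 / 72) = 3 * log 2 + 2 * log 3 := by
    rw [one_div, log_inv, neg_neg, show (72 : ℝ) = 2 ^ 3 * 3 ^ 2 by norm_num,
      log_mul (by norm_num) (by norm_num), log_pow, log_pow]
    norm_num
  have hlog₂ : -log (1 / 24) = 3 * log 2 + log 3 := by
    rw [one_div, log_inv, neg_neg, show (24 : ℝ) = 2 ^ 3 * 3 by norm_num,
      log_mul (by norm_num) (by norm_num), log_pow]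
    norm_num
  refine identricBound_of_mem_Icc (k := 4.276) (m := 3.178) (M := 4.277) (by norm_num)
    (by norm_num) (by norm_num) (by norm_num) (by linarith) (by norm_num) (by linarith)
    (by linarith) (by norm_num) (fun t ht ht' => ?_) hy
  have hB (k m : ℕ) : 0 ≤ t ^ k * (1 - t) ^ m :=
    mul_nonneg (pow_nonneg ht k) (pow_nonneg (sub_nonneg.2 ht') m)
  unfold identricMargin binomialCubic
  norm_num only
  linarith [hB 0 8, hB 1 7, hB 2 6, hB 3 5, hB 4 4, hB 5 3, hB 6 2, hB 7 1, hB 8 0]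

theorem identricBound_of_mem_Icc_one_div_five_hundred_twelve {y : ℝ}
    (hy : y ∈ Icc (1 / 512) (1 / 72)) : IdentricBound y := by
  have := log_two_gt_d9
  have := log_two_lt_d9
  have := log_three_gt_d9
  have hlog₁ : -log (1 / 512) = 9 * log 2 := by
    rw [one_div, log_inv, neg_neg, show (512 : ℝ) = 2 ^ 9 by norm_num, log_pow]
    norm_num
  have hlog₂ : -log (1 / 72) = 3 * log 2 + 2 * log 3 := by
    rw [one_div, log_inv, neg_neg, show (72 : ℝ) = 2 ^ 3 * 3 ^ 2 by norm_num,
      log_mul (by norm_num) (by norm_num), log_pow, log_pow]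
    norm_num
  refine identricBound_of_mem_Icc (k := 6.238) (m := 4.276) (M := 6.239) (by norm_num)
    (by norm_num) (by norm_num) (by norm_num) (by linarith) (by norm_num) (by linarith)
    (by linarith) (by norm_num) (fun t ht ht' => ?_) hy
  have hB (k m : ℕ) : 0 ≤ t ^ k * (1 - t) ^ m :=
    mul_nonneg (pow_nonneg ht k) (pow_nonneg (sub_nonneg.2 ht') m)
  unfold identricMargin binomialCubic
  norm_num only
  linarith [hB 0 8, hB 1 7, hB 2 6, hB 3 5, hB 4 4, hB 5 3, hB 6 2, hB 7 1, hB 8 0]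

theorem rpow_le_mul_of_le_one_div {y : ℝ} (hy : 0 < y) (hy' : y ≤ 1 / 512) :
    y ^ (1.0399 : ℝ) ≤ 0.78 * y := by
  have hlog := log_le_log hy hy'
  rw [one_div, log_inv, show (512 : ℝ) = 2 ^ 9 by norm_num, log_pow] at hlog
  have hexp : exp (-(0.0399 * -log y)) ≤ exp (-0.2488) := by
    rw [exp_le_exp]
    push_cast at hlog
    linarith [log_two_gt_d9]
  have hquartic : exp (-0.2488 : ℝ) ≤ 0.78 :=
    (exp_neg_le_quartic (by norm_num)).trans (by norm_num)
  calc y ^ (1.0399 : ℝ) = exp (-(0.0399 * -log y)) * y := by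
        rw [mul_comm, ← rpow_one_add_eq hy]
        norm_num
    _ ≤ 0.78 * y := by gcongr; exact hexp.trans hquartic

theorem identricBound_of_le_one_div_five_hundred_twelve {y : ℝ} (hy : 0 < y)
    (hy' : y ≤ 1 / 512) : IdentricBound y := by
  have hw : negMulLog y ≤ 6 * y + 0.000912 := by
    have htangent := negMulLog_le_mul_add_exp_neg hy 6
    have hexp := exp_neg_natCast_le 7
    norm_num at htangent hexp ⊢
    linarith
  have hw0 : 0 ≤ negMulLog y := negMulLog_nonneg hy.le (by linarith)
  have hE : 1 - 512 / 511 * (6 * y + 0.000912) ≤ exp (-(negMulLog y / (1 - y))) := by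
    refine le_trans ?_ (one_sub_le_exp_neg _)
    have : negMulLog y / (1 - y) ≤ 512 / 511 * negMulLog y := by
      rw [div_le_iff₀ (by linarith)]
      nlinarith
    linarith
  have hY := rpow_le_mul_of_le_one_div hy hy'
  have hY0 : 0 ≤ y ^ (1.0399 : ℝ) := rpow_nonneg hy.le _
  have hr : 0.972722 * (1 + 1.0399 * y) ≤ binomialCubic y := by
    unfold binomialCubic
    nlinarith [mul_nonneg (sq_nonneg y) (sub_nonneg.2 hy')]
  have hr' : (1 + y) * binomialCubic y ≤ 0.972723 + 1.987 * y := by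
    unfold binomialCubic
    nlinarith [pow_pos hy 3, pow_pos hy 4]
  refine identricBound_of_binomialCubic hy (by linarith) ?_
  generalize y ^ (1.0399 : ℝ) = Y at *
  have hB : 1.027277 - 1.987 * y ≤ 2 + 2 * y * Y - (1 + y) * binomialCubic y := by
    have : 0 ≤ 2 * y * Y := by positivity
    linarith
  calc 1.50088 * (1 + Y - binomialCubic y)
      ≤ 0.0399 * ((1 - 512 / 511 * (6 * y + 0.000912)) * (1.027277 - 1.987 * y)) := by
        nlinarith
    _ ≤ 0.0399 * (exp (-(negMulLog y / (1 - y))) *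
        (2 + 2 * y * Y - (1 + y) * binomialCubic y)) := by
        gcongr
        linarith
    _ = _ := (mul_assoc _ _ _).symm

theorem identricBound_of_le_two_div {y : ℝ} (hy : 0 < y) (hy' : y ≤ 2 / 27) : IdentricBound y := by
  rcases le_total y (1 / 512) with h₁ | h₁
  · exact identricBound_of_le_one_div_five_hundred_twelve hy h₁
  rcases le_total y (1 / 72) with h₂ | h₂
  · exact identricBound_of_mem_Icc_one_div_five_hundred_twelve ⟨h₁, h₂⟩
  rcases le_total y (1 / 24) with h₃ | h₃
  · exact identricBound_of_mem_Icc_one_div_seventy_two ⟨h₂, h₃⟩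
  · exact identricBound_of_mem_Icc_one_div_twenty_four ⟨h₃, hy'⟩

theorem meanLE_meanI_lambdaMean_1_0399 : MeanLE meanI (lambdaMean 1.0399) := by
  refine isHomMean_meanI.meanLE (isHomMean_lambdaMean _) fun u hu => ?_
  rw [meanI_le_lambdaMean_exp_iff (by norm_num) hu]
  rcases le_total (exp (-2 * u)) (2 / 27) with hy | hy
  · exact idNum_le_of_identricBound rfl hu (identricBound_of_le_two_div (exp_pos _) hy)
  · refine idNum_le_of_sq_le (by norm_num) hu ?_
    have hlog := log_le_log (by norm_num) hy
    rw [log_exp, log_div two_ne_zero (by norm_num), show (27 : ℝ) = 3 ^ 3 by norm_num,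
      log_pow] at hlog
    push_cast at hlog
    nlinarith [log_two_gt_d9, log_three_lt_d9]

end IdentricIntervals

section SharpRanges

theorem HasDiagCoeff.meanLE_lambdaMean_left_iff {M : ℝ → ℝ → ℝ} {s t : ℝ}
    (hM : HasDiagCoeff M ((t - 2) / 6)) (ht : MeanLE (lambdaMean t) M) :
    MeanLE (lambdaMean s) M ↔ s ≤ t := by
  refine ⟨fun h => ?_, fun hst => (meanLE_lambdaMean hst).trans ht⟩
  have := (hasDiagCoeff_lambdaMean s).le hM h
  linarith

theorem HasDiagCoeff.meanLE_lambdaMean_right_iff {M : ℝ → ℝ → ℝ} {s t : ℝ}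
    (hM : HasDiagCoeff M ((t - 2) / 6)) (ht : MeanLE M (lambdaMean t)) :
    MeanLE M (lambdaMean s) ↔ t ≤ s := by
  refine ⟨fun h => ?_, fun hst => ht.trans (meanLE_lambdaMean hst)⟩
  have := hM.le (hasDiagCoeff_lambdaMean s) h
  linarith

variable {s : ℝ}

theorem meanLE_lambdaMean_meanH_iff : MeanLE (lambdaMean s) meanH ↔ s ≤ -4 :=
  HasDiagCoeff.meanLE_lambdaMean_left_iff (by convert hasDiagCoeff_meanH using 1; norm_num)
    meanLE_lambdaMean_neg_four_meanH

theorem meanLE_meanH_lambdaMean_iff : MeanLE meanH (lambdaMean s) ↔ -3 ≤ s :=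
  ⟨neg_three_le_of_meanLE_meanH_lambdaMean,
    fun hs => meanLE_meanH_lambdaMean_neg_three.trans (meanLE_lambdaMean hs)⟩

theorem meanLE_lambdaMean_meanG_iff : MeanLE (lambdaMean s) meanG ↔ s ≤ -1 :=
  HasDiagCoeff.meanLE_lambdaMean_left_iff (by convert hasDiagCoeff_meanG using 1; norm_num)
    meanLE_lambdaMean_neg_one_meanG

theorem meanLE_meanG_lambdaMean_iff : MeanLE meanG (lambdaMean s) ↔ -1 / 2 ≤ s :=
  ⟨neg_half_le_of_meanLE_meanG_lambdaMean,
    fun hs => meanLE_meanG_lambdaMean_neg_half.trans (meanLE_lambdaMean hs)⟩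

theorem meanLE_lambdaMean_meanL_iff : MeanLE (lambdaMean s) meanL ↔ s ≤ 0 :=
  HasDiagCoeff.meanLE_lambdaMean_left_iff (by convert hasDiagCoeff_meanL using 1; norm_num)
    meanLE_lambdaMean_zero_meanL

theorem exists_meanLE_meanL_lambdaMean_iff :
    ∃ s₀ : ℝ, 1 / 12 < s₀ ∧ s₀ < 1 / 11 ∧ ∀ s, MeanLE meanL (lambdaMean s) ↔ s₀ ≤ s := by
  obtain ⟨s₀, ⟨hl, hr⟩, hiff⟩ := exists_meanLE_lambdaMean_iff_le
    not_meanLE_meanL_lambdaMean_one_div_twelve meanLE_meanL_lambdaMean_nine_div_hundred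
    fun s ⟨hl, _⟩ => ⟨by linarith, by linarith, by linarith⟩
  exact ⟨s₀, hl, by linarith, hiff⟩

theorem meanLE_lambdaMean_meanI_iff : MeanLE (lambdaMean s) meanI ↔ s ≤ 1 :=
  HasDiagCoeff.meanLE_lambdaMean_left_iff (by convert hasDiagCoeff_meanI using 1; norm_num)
    meanLE_lambdaMean_one_meanI

theorem exists_meanLE_meanI_lambdaMean_iff :
    ∃ s₁ : ℝ, 1.03 < s₁ ∧ s₁ < 1.04 ∧ ∀ s, MeanLE meanI (lambdaMean s) ↔ s₁ ≤ s := by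
  obtain ⟨s₁, ⟨hl, hr⟩, hiff⟩ := exists_meanLE_lambdaMean_iff_le
    not_meanLE_meanI_lambdaMean_1_03 meanLE_meanI_lambdaMean_1_0399
    fun s ⟨hl, _⟩ => ⟨by linarith, by linarith, by linarith⟩
  exact ⟨s₁, hl, by linarith, hiff⟩

theorem meanLE_lambdaMean_meanA_iff : MeanLE (lambdaMean s) meanA ↔ s ≤ 2 :=
  HasDiagCoeff.meanLE_lambdaMean_left_iff (by convert hasDiagCoeff_meanA using 1; norm_num)
    fun _ _ ha hb => (lambdaMean_two ha hb).le

theorem meanLE_meanA_lambdaMean_iff : MeanLE meanA (lambdaMean s) ↔ 2 ≤ s :=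
  HasDiagCoeff.meanLE_lambdaMean_right_iff (by convert hasDiagCoeff_meanA using 1; norm_num)
    fun _ _ ha hb => (lambdaMean_two ha hb).ge

theorem meanLE_lambdaMean_meanS_iff : MeanLE (lambdaMean s) meanS ↔ s ≤ 5 :=
  HasDiagCoeff.meanLE_lambdaMean_left_iff (by convert hasDiagCoeff_meanS using 1; norm_num)
    meanLE_lambdaMean_five_meanS

end SharpRanges

theorem theorem3 :
    -- 1: monotone in the parameter
    (∀ a b : ℝ, 0 < a → 0 < b → Monotone (fun s : ℝ => lambdaMean s a b)) ∧
    -- 2: below H, with the best possible bound on the parameter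
    (∀ s : ℝ, (∀ a b : ℝ, 0 < a → 0 < b → lambdaMean s a b ≤ meanH a b) ↔ s ≤ -4) ∧
    -- 3: between H and G, with both ends of the parameter range best possible
    (∀ s : ℝ, (∀ a b : ℝ, 0 < a → 0 < b → meanH a b ≤ lambdaMean s a b) ↔ -3 ≤ s) ∧
    (∀ s : ℝ, (∀ a b : ℝ, 0 < a → 0 < b → lambdaMean s a b ≤ meanG a b) ↔ s ≤ -1) ∧
    -- 4: between G and L
    (∀ s : ℝ, (∀ a b : ℝ, 0 < a → 0 < b → meanG a b ≤ lambdaMean s a b) ↔ -1 / 2 ≤ s) ∧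
    (∀ s : ℝ, (∀ a b : ℝ, 0 < a → 0 < b → lambdaMean s a b ≤ meanL a b) ↔ s ≤ 0) ∧
    -- 5: between L and I
    (∃ s₀ : ℝ, 1 / 12 < s₀ ∧ s₀ < 1 / 11 ∧
      ∀ s : ℝ, (∀ a b : ℝ, 0 < a → 0 < b → meanL a b ≤ lambdaMean s a b) ↔ s₀ ≤ s) ∧
    (∀ s : ℝ, (∀ a b : ℝ, 0 < a → 0 < b → lambdaMean s a b ≤ meanI a b) ↔ s ≤ 1) ∧
    -- 6: between I and A
    (∃ s₁ : ℝ, 1.03 < s₁ ∧ s₁ < 1.04 ∧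
      ∀ s : ℝ, (∀ a b : ℝ, 0 < a → 0 < b → meanI a b ≤ lambdaMean s a b) ↔ s₁ ≤ s) ∧
    (∀ s : ℝ, (∀ a b : ℝ, 0 < a → 0 < b → lambdaMean s a b ≤ meanA a b) ↔ s ≤ 2) ∧
    -- 7: between A and S
    (∀ s : ℝ, (∀ a b : ℝ, 0 < a → 0 < b → meanA a b ≤ lambdaMean s a b) ↔ 2 ≤ s) ∧
    (∀ s : ℝ, (∀ a b : ℝ, 0 < a → 0 < b → lambdaMean s a b ≤ meanS a b) ↔ s ≤ 5) ∧
    -- 8: never above S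
    (¬ ∃ s : ℝ, ∀ a b : ℝ, 0 < a → 0 < b → meanS a b ≤ lambdaMean s a b) := by
  exact ⟨fun _ _ => lambdaMean_monotone,
    fun _ => meanLE_lambdaMean_meanH_iff,
    fun _ => meanLE_meanH_lambdaMean_iff,
    fun _ => meanLE_lambdaMean_meanG_iff,
    fun _ => meanLE_meanG_lambdaMean_iff,
    fun _ => meanLE_lambdaMean_meanL_iff,
    exists_meanLE_meanL_lambdaMean_iff,
    fun _ => meanLE_lambdaMean_meanI_iff,
    exists_meanLE_meanI_lambdaMean_iff,
    fun _ => meanLE_lambdaMean_meanA_iff,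
    fun _ => meanLE_meanA_lambdaMean_iff,
    fun _ => meanLE_lambdaMean_meanS_iff,
    fun ⟨s, hs⟩ => not_meanLE_meanS_lambdaMean s hs⟩
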